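/- **Setting.** Let $m\ge 0$, let $W$ be a compact smooth manifold of dimension $m$, $\bar M$ a smooth 4-manifold and $M$ a smooth manifold of dimension $5+m$. Suppose that $\pi: M\to\bar M$ is a smooth locally trivial fibration with fiber $S^1\times W$, and that $\Phi=(h,f): M\to S^1\times W$ is a smooth map which restricts to a diffeomorphism on each fiber of $\pi$. Let $S^1_x$ (resp. $W_x$) be the set of points of the $\pi$-fiber through $x$ at which $f$ (resp. $h$) takes the same value as at $x$. Let $g=\langle\cdot,\cdot\rangle$ be a smooth semi-Riemannian metric on $M$ and let $H_x:=(\ker d\pi_x)^{\perp}$; suppose that $g$ has signature $(-)$ on $T_xS^1_x$, $(+,\dots,+)$ on $T_xW_x$ and $(-,+,+,+)$ on $H_x$, for all $x$. Let $Y$ be a smooth vector field tangent to the circles $S^1_x$, with $\langle Y,Y\rangle=-1$, and suppose that $Y$ is a Killing field. Put $Y^\flat=\langle Y,\cdot\rangle$ and $F:=dY^\flat$, i.e. $F_{ij}=\partial_iY_j-\partial_jY_i$. Let $\nabla$ be the Levi-Civita connection and $G:=2\,\mathrm{Ric}-S\,g$, where $\mathrm{Ric}$ and $S$ are the Ricci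 and scalar curvatures. For a 2-tensor $T$, let ${}^eT$ be the endomorphism with $\langle u,{}^eT(v)\rangle=T(u,v)$, and let $\nabla\cdot T$ be the vector field with components $(\nabla\cdot T)^k=g^{kl}g^{ij}\nabla_iT_{jl}$. Write $|F|:=g^{ik}g^{jl}F_{ij}F_{kl}$. **Fluids.** Let $D\subset M$ be open. Suppose that $D$ is a fluid domain: at each $x\in D$ the endomorphism $pr_{H}\circ{}^eG|_{H}$ of $H_x$ (with $pr_H$ the orthogonal projection onto $H_x$) has an eigenvalue $-\mu(x)<0$ with a 1-dimensional timelike eigenspace. Let $X_0$ be a smooth vector field on $D$ which lies in this eigenspace at each point and satisfies $\langle X_0,X_0\rangle=-1$. Put $$e:=G(X_0,Y),\qquad X:=X_0+\frac e\mu\,Y,\qquad P:=G-G_{|T},$$ where $G_{|T}(u,v):=G(pr_Tu,pr_Tv)$ and $pr_T$ is the orthogonal projection onto the plane $T_x$ spanned by $X_0(x)$ and $Y(x)$. Suppose that the fluid is *pluperfect* on $D$: it is perfect, i.e. ${}^eP(Y)=0$, and $\nabla\cdot P=0$. (For example $P=0$: charged dust.) **Theorem.** Then on $D$: 1. $\nabla\cdot(\mu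 X)=\nabla\cdot(\mu X_0)=0$; 2. $\nabla\cdot(eX)=\nabla\cdot(eX_0)=0$; 3. $X(e/\mu)=X_0(e/\mu)=0$; 4. $\nabla_XX=0$, that is, $X$ is a geodesic vector field; 5. $\mu\,\nabla_{X_0}X_0=e\;{}^eF(X_0)$; in particular $\nabla_{X_0}X_0=0$ at every point where $e=0$; 6. $dF=0$ and $\nabla\cdot F=e\,X_0+\tfrac12|F|\,Y$. -/

import Mathlib

open scoped Manifold ContDiff

noncomputable section

namespace KaluzaKlein

/-! ### Linear algebra of a (possibly indefinite) bilinear form -/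

section LinearAlgebra

variable {V : Type*} [AddCommGroup V] [Module ℝ V]

/-- The `B`-orthogonal projection onto a subspace `K` with `V = K ⊕ K^⊥`
(the value `0` is used when `K` is degenerate). -/
def orthProj (B : LinearMap.BilinForm ℝ V) (K : Submodule ℝ V) : V →ₗ[ℝ] K :=
  open scoped Classical in
  if h : IsCompl K (B.orthogonal K) then K.projectionOnto (B.orthogonal K) h else 0

/-- The restriction of `B` to the subspace `K` is nondegenerate with `p` minus signs and
`q` plus signs: `K` has a pseudo-orthonormal basis of that type. -/
def HasSignature (B : LinearMap.BilinForm ℝ V) (K : Submodule ℝ V) (p q : ℕ) : Prop :=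
  ∃ b : Module.Basis (Fin p ⊕ Fin q) ℝ K,
    (∀ i, B (b (Sum.inl i)) (b (Sum.inl i)) = -1) ∧
    (∀ j, B (b (Sum.inr j)) (b (Sum.inr j)) = 1) ∧
    ∀ s t, s ≠ t → B (b s) (b t) = 0

/-- The restriction of `T` to the subspace `K`, extended by zero on the `B`-orthogonal of `K`. -/
def restrictTo (B : LinearMap.BilinForm ℝ V) (K : Submodule ℝ V)
    (T : LinearMap.BilinForm ℝ V) : LinearMap.BilinForm ℝ V :=
  T.compl₁₂ (K.subtype ∘ₗ orthProj B K) (K.subtype ∘ₗ orthProj B K)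

/-- The endomorphism `ᵉT` associated to `T` by a nondegenerate `B`:
`B u (ᵉT v) = T u v` for all `u`, `v`, when `B` is symmetric. -/
def endo [FiniteDimensional ℝ V] (B : LinearMap.BilinForm ℝ V) (hB : B.Nondegenerate)
    (T : LinearMap.BilinForm ℝ V) : V →ₗ[ℝ] V :=
  (B.toDual hB).symm.toLinearMap ∘ₗ T.flip

end LinearAlgebra

/-! ### Tensor calculus in coordinates

In this part `g` is the matrix field `(g_ij)` of a metric in a chart with values in `ℝⁿ`; vector
fields, 1-forms and 2-tensors are given by their component functions. -/

section Coordinates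

variable {n : ℕ}

/-- The partial derivative `∂_i f`. -/
def pd (i : Fin n) (f : EuclideanSpace ℝ (Fin n) → ℝ) (y : EuclideanSpace ℝ (Fin n)) : ℝ :=
  fderiv ℝ f y (EuclideanSpace.single i 1)

variable (g : EuclideanSpace ℝ (Fin n) → Matrix (Fin n) (Fin n) ℝ)

/-- The Christoffel symbols `Γ^k_ij` of the Levi-Civita connection. -/
def christoffel (k i j : Fin n) (y : EuclideanSpace ℝ (Fin n)) : ℝ :=
  (1 / 2) * ∑ l, (g y)⁻¹ k l *
    (pd i (fun z => g z j l) y + pd j (fun z => g z i l) y - pd l (fun z => g z i j) y)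

/-- `∇_i V^k`. -/
def covVec (V : EuclideanSpace ℝ (Fin n) → Fin n → ℝ) (i k : Fin n)
    (y : EuclideanSpace ℝ (Fin n)) : ℝ :=
  pd i (fun z => V z k) y + ∑ j, christoffel g k i j y * V y j

/-- `∇_i T_jk`. -/
def covTensor (T : EuclideanSpace ℝ (Fin n) → Matrix (Fin n) (Fin n) ℝ) (i j k : Fin n)
    (y : EuclideanSpace ℝ (Fin n)) : ℝ :=
  pd i (fun z => T z j k) y - ∑ l, christoffel g l i j y * T y l k
    - ∑ l, christoffel g l i k y * T y j l

/-- The divergence `∇_i V^i` of a vector field. -/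
def divVecCoord (V : EuclideanSpace ℝ (Fin n) → Fin n → ℝ) (y : EuclideanSpace ℝ (Fin n)) : ℝ :=
  ∑ i, covVec g V i i y

/-- The divergence of a 2-tensor, as a vector: `g^{kl} g^{ij} ∇_i T_jl`. -/
def divTensorCoord (T : EuclideanSpace ℝ (Fin n) → Matrix (Fin n) (Fin n) ℝ)
    (y : EuclideanSpace ℝ (Fin n)) : Fin n → ℝ :=
  fun k => ∑ l, (g y)⁻¹ k l * ∑ i, ∑ j, (g y)⁻¹ i j * covTensor g T i j l y

/-- The Ricci curvature `Ric_jk = ∂_i Γ^i_jk - ∂_j Γ^i_ik + Γ^i_il Γ^l_jk - Γ^i_jl Γ^l_ik`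
(positive on round spheres). -/
def ricciCoord (y : EuclideanSpace ℝ (Fin n)) : Matrix (Fin n) (Fin n) ℝ :=
  Matrix.of fun j k => ∑ i,
    (pd i (christoffel g i j k) y - pd j (christoffel g i i k) y
      + ∑ l, (christoffel g i i l y * christoffel g l j k y
        - christoffel g i j l y * christoffel g l i k y))

/-- The scalar curvature `g^{ij} Ric_ij`. -/
def scalarCoord (y : EuclideanSpace ℝ (Fin n)) : ℝ :=
  ∑ i, ∑ j, (g y)⁻¹ i j * ricciCoord g y i j

/-- The exterior derivative of a 1-form: `(dα)_ij = ∂_i α_j - ∂_j α_i`. -/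
def extDerivOne (α : EuclideanSpace ℝ (Fin n) → Fin n → ℝ) (y : EuclideanSpace ℝ (Fin n)) :
    Matrix (Fin n) (Fin n) ℝ :=
  Matrix.of fun i j => pd i (fun z => α z j) y - pd j (fun z => α z i) y

/-- The exterior derivative of a 2-form: `(dF)_ijk = ∂_i F_jk + ∂_j F_ki + ∂_k F_ij`. -/
def extDerivTwo (F : EuclideanSpace ℝ (Fin n) → Matrix (Fin n) (Fin n) ℝ) (i j k : Fin n)
    (y : EuclideanSpace ℝ (Fin n)) : ℝ :=
  pd i (fun z => F z j k) y + pd j (fun z => F z k i) y + pd k (fun z => F z i j) y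

/-- The full contraction `g^{ik} g^{jl} F_ij F_kl`. -/
def contraction (F : EuclideanSpace ℝ (Fin n) → Matrix (Fin n) (Fin n) ℝ)
    (y : EuclideanSpace ℝ (Fin n)) : ℝ :=
  ∑ i, ∑ j, ∑ k, ∑ l, (g y)⁻¹ i k * (g y)⁻¹ j l * F y i j * F y k l

end Coordinates

/-! ### Semi-Riemannian manifolds

The differential operators and the curvature are computed in a chart `φ` of the maximal smooth
atlas, at points of the source of `φ`; their values are tangent vectors and bilinear forms on the
tangent spaces of the manifold. -/

section Manifold

variable {n : ℕ} {M : Type*} [TopologicalSpace M] [ChartedSpace (EuclideanSpace ℝ (Fin n)) M]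

instance finiteDimensional_tangentSpace (x : M) : FiniteDimensional ℝ (TangentSpace (𝓡 n) x) :=
  inferInstanceAs (FiniteDimensional ℝ (EuclideanSpace ℝ (Fin n)))

/-- The smooth charts of `M`. -/
abbrev smoothCharts (n : ℕ) (M : Type*) [TopologicalSpace M]
    [ChartedSpace (EuclideanSpace ℝ (Fin n)) M] :
    Set (OpenPartialHomeomorph M (EuclideanSpace ℝ (Fin n))) :=
  IsManifold.maximalAtlas (𝓡 n) ∞ M

/-- A vector field is smooth on a set. -/
def SmoothFieldOn (V : ∀ x : M, TangentSpace (𝓡 n) x) [IsManifold (𝓡 n) ∞ M]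
    (D : Set M) : Prop :=
  ContMDiffOn (𝓡 n) (𝓡 n).tangent ∞ (fun x => (⟨x, V x⟩ : TangentBundle (𝓡 n) M)) D

/-- A smooth semi-Riemannian metric. -/
structure SemiRiemannianMetric (n : ℕ) (M : Type*) [TopologicalSpace M]
    [ChartedSpace (EuclideanSpace ℝ (Fin n)) M] [IsManifold (𝓡 n) ∞ M] where
  inner (x : M) : TangentSpace (𝓡 n) x →L[ℝ] TangentSpace (𝓡 n) x →L[ℝ] ℝ
  symm (x : M) (v w : TangentSpace (𝓡 n) x) : inner x v w = inner x w v
  nondegenerate (x : M) (v : TangentSpace (𝓡 n) x) (hv : ∀ w, inner x v w = 0) : v = 0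
  contMDiff : ContMDiff (𝓡 n)
    ((𝓡 n).prod 𝓘(ℝ, EuclideanSpace ℝ (Fin n) →L[ℝ] EuclideanSpace ℝ (Fin n) →L[ℝ] ℝ)) ∞
    (fun x => Bundle.TotalSpace.mk'
      (EuclideanSpace ℝ (Fin n) →L[ℝ] EuclideanSpace ℝ (Fin n) →L[ℝ] ℝ)
      (E := fun x : M => TangentSpace (𝓡 n) x →L[ℝ] TangentSpace (𝓡 n) x →L[ℝ] ℝ) x (inner x))

/-- The coordinate vector `∂_i` of the chart `φ` at `x`. -/
def frame (φ : OpenPartialHomeomorph M (EuclideanSpace ℝ (Fin n))) (x : M) (i : Fin n) :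
    TangentSpace (𝓡 n) x :=
  (mfderiv (𝓡 n) (𝓡 n) φ x).inverse (EuclideanSpace.single i (1 : ℝ))

/-- The tangent vector `∑ a^i ∂_i` at `x`. -/
def ofComponents (φ : OpenPartialHomeomorph M (EuclideanSpace ℝ (Fin n))) (x : M)
    (a : Fin n → ℝ) : TangentSpace (𝓡 n) x :=
  ∑ i, a i • frame φ x i

/-- The linear map sending a tangent vector at `x` to its components in the chart `φ`. -/
def components (φ : OpenPartialHomeomorph M (EuclideanSpace ℝ (Fin n))) (x : M) :
    TangentSpace (𝓡 n) x →ₗ[ℝ] (Fin n → ℝ) :=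
  (EuclideanSpace.equiv (Fin n) ℝ).toLinearMap ∘ₗ
    (mfderiv (𝓡 n) (𝓡 n) φ x).toLinearMap

/-- The component functions of a vector field in the chart `φ`. -/
def vecInChart (φ : OpenPartialHomeomorph M (EuclideanSpace ℝ (Fin n)))
    (V : ∀ x : M, TangentSpace (𝓡 n) x) : EuclideanSpace ℝ (Fin n) → Fin n → ℝ :=
  fun y => components φ (φ.symm y) (V (φ.symm y))

/-- The component functions of a 2-tensor field in the chart `φ`. -/
def tensorInChart (φ : OpenPartialHomeomorph M (EuclideanSpace ℝ (Fin n)))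
    (T : ∀ x : M, LinearMap.BilinForm ℝ (TangentSpace (𝓡 n) x)) :
    EuclideanSpace ℝ (Fin n) → Matrix (Fin n) (Fin n) ℝ :=
  fun y => Matrix.of fun i j => T (φ.symm y) (frame φ (φ.symm y) i) (frame φ (φ.symm y) j)

/-- The bilinear form on the tangent space at `x` with given components in the chart `φ`. -/
def tensorOfComponents (φ : OpenPartialHomeomorph M (EuclideanSpace ℝ (Fin n)))
    (A : EuclideanSpace ℝ (Fin n) → Matrix (Fin n) (Fin n) ℝ) (x : M) :
    LinearMap.BilinForm ℝ (TangentSpace (𝓡 n) x) :=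
  (Matrix.toBilin' (A (φ x))).compl₁₂ (components φ x) (components φ x)

/-- The derivative `V(f)` of a function along a vector field. -/
def dirDeriv (V : ∀ x : M, TangentSpace (𝓡 n) x) (f : M → ℝ) (x : M) : ℝ :=
  mfderiv (𝓡 n) 𝓘(ℝ, ℝ) f x (V x)

namespace SemiRiemannianMetric

variable [IsManifold (𝓡 n) ∞ M] (g : SemiRiemannianMetric n M)
  (φ : OpenPartialHomeomorph M (EuclideanSpace ℝ (Fin n)))

/-- The metric at `x` as a bilinear form. -/
def bilin (x : M) : LinearMap.BilinForm ℝ (TangentSpace (𝓡 n) x) :=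
  LinearMap.mk₂ ℝ (fun v w => g.inner x v w) (by simp) (by simp) (by simp) (by simp)

theorem bilin_nondegenerate (x : M) : (g.bilin x).Nondegenerate :=
  ⟨fun v hv => g.nondegenerate x v hv,
   fun v hv => g.nondegenerate x v fun w => by rw [g.symm]; exact hv w⟩

/-- The endomorphism field `ᵉT` with `g(u, ᵉT(v)) = T(u, v)`. -/
def endoAt (x : M) (T : LinearMap.BilinForm ℝ (TangentSpace (𝓡 n) x)) :
    TangentSpace (𝓡 n) x →ₗ[ℝ] TangentSpace (𝓡 n) x :=
  endo (g.bilin x) (g.bilin_nondegenerate x) T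

/-- The matrix field `(g_ij)` in the chart `φ`. -/
def inChart : EuclideanSpace ℝ (Fin n) → Matrix (Fin n) (Fin n) ℝ :=
  tensorInChart φ g.bilin

/-- The covariant derivative `∇_V W` for the Levi-Civita connection. -/
def nabla (V W : ∀ x : M, TangentSpace (𝓡 n) x) (x : M) : TangentSpace (𝓡 n) x :=
  ofComponents φ x fun k =>
    ∑ i, vecInChart φ V (φ x) i * covVec (g.inChart φ) (vecInChart φ W) i k (φ x)

/-- The divergence of a vector field. -/
def divVec (V : ∀ x : M, TangentSpace (𝓡 n) x) (x : M) : ℝ :=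
  divVecCoord (g.inChart φ) (vecInChart φ V) (φ x)

/-- The divergence of a 2-tensor field, as a vector field. -/
def divTensor (T : ∀ x : M, LinearMap.BilinForm ℝ (TangentSpace (𝓡 n) x)) (x : M) :
    TangentSpace (𝓡 n) x :=
  ofComponents φ x (divTensorCoord (g.inChart φ) (tensorInChart φ T) (φ x))

/-- Twice the Einstein curvature: `G = 2 Ric - S g`. -/
def einstein (x : M) : LinearMap.BilinForm ℝ (TangentSpace (𝓡 n) x) :=
  tensorOfComponents φ (fun y =>
    (2 : ℝ) • ricciCoord (g.inChart φ) y - scalarCoord (g.inChart φ) y • g.inChart φ y) x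

/-- The components of the 1-form `V^♭ = g(V, ·)`. -/
def flat (V : ∀ x : M, TangentSpace (𝓡 n) x) : EuclideanSpace ℝ (Fin n) → Fin n → ℝ :=
  fun y i => g.bilin (φ.symm y) (V (φ.symm y)) (frame φ (φ.symm y) i)

/-- The 2-form `d(V^♭)`. -/
def dFlat (V : ∀ x : M, TangentSpace (𝓡 n) x) (x : M) :
    LinearMap.BilinForm ℝ (TangentSpace (𝓡 n) x) :=
  tensorOfComponents φ (extDerivOne (g.flat φ V)) x

/-- The vector field `V` is a Killing field: `∇_i V_j + ∇_j V_i = 0` in every smooth chart. -/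
def IsKilling (V : ∀ x : M, TangentSpace (𝓡 n) x) : Prop :=
  ∀ φ ∈ smoothCharts n M, ∀ x ∈ φ.source, ∀ i j : Fin n,
    ∑ k, g.inChart φ (φ x) j k * covVec (g.inChart φ) (vecInChart φ V) i k (φ x)
      + ∑ k, g.inChart φ (φ x) i k * covVec (g.inChart φ) (vecInChart φ V) j k (φ x) = 0

end SemiRiemannianMetric

end Manifold

/-! ### Multi-fiber bundles and spacetime -/

section Spacetime

variable {m : ℕ} {M B W : Type*}
  [TopologicalSpace M] [ChartedSpace (EuclideanSpace ℝ (Fin (5 + m))) M]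
  [TopologicalSpace B] [ChartedSpace (EuclideanSpace ℝ (Fin 4)) B]
  [TopologicalSpace W] [ChartedSpace (EuclideanSpace ℝ (Fin m)) W]

/-- An `(S¹, W)`-multi-fiber bundle structure on `M`: a smooth fibration `π : M → B` with fiber
`S¹ × W` (given by smooth local trivializations) and a smooth map `Φ = (h, f) : M → S¹ × W` whose
restriction to each fiber of `π` is a diffeomorphism onto `S¹ × W`. -/
structure MultiFiberBundle (m : ℕ) (M B W : Type*)
    [TopologicalSpace M] [ChartedSpace (EuclideanSpace ℝ (Fin (5 + m))) M]
    [TopologicalSpace B] [ChartedSpace (EuclideanSpace ℝ (Fin 4)) B]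
    [TopologicalSpace W] [ChartedSpace (EuclideanSpace ℝ (Fin m)) W] where
  proj : M → B
  h : M → Circle
  f : M → W
  contMDiff_proj : ContMDiff (𝓡 (5 + m)) (𝓡 4) ∞ proj
  contMDiff_h : ContMDiff (𝓡 (5 + m)) (𝓡 1) ∞ h
  contMDiff_f : ContMDiff (𝓡 (5 + m)) (𝓡 m) ∞ f
  locally_trivial : ∀ b : B, ∃ t : Bundle.Trivialization (Circle × W) proj, b ∈ t.baseSet ∧
    ContMDiffOn (𝓡 (5 + m)) ((𝓡 4).prod ((𝓡 1).prod (𝓡 m))) ∞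
      t.toOpenPartialHomeomorph t.source ∧
    ContMDiffOn ((𝓡 4).prod ((𝓡 1).prod (𝓡 m))) (𝓡 (5 + m)) ∞
      t.toOpenPartialHomeomorph.symm t.target ∧
    ∀ b' ∈ t.baseSet, ∃ d : Diffeomorph ((𝓡 1).prod (𝓡 m)) ((𝓡 1).prod (𝓡 m))
        (Circle × W) (Circle × W) ∞,
      ∀ z : Circle × W, d z = (h (t.toOpenPartialHomeomorph.symm (b', z)),
        f (t.toOpenPartialHomeomorph.symm (b', z)))

namespace MultiFiberBundle

variable (𝓑 : MultiFiberBundle m M B W)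

/-- The tangent space at `x` of the fiber of `π` through `x`. -/
def fiberTangent (x : M) : Submodule ℝ (TangentSpace (𝓡 (5 + m)) x) :=
  LinearMap.ker (mfderiv (𝓡 (5 + m)) (𝓡 4) 𝓑.proj x).toLinearMap

/-- The tangent space at `x` of the circle `S¹_x`, on which `π` and `f` are constant. -/
def circleTangent (x : M) : Submodule ℝ (TangentSpace (𝓡 (5 + m)) x) :=
  𝓑.fiberTangent x ⊓ LinearMap.ker (mfderiv (𝓡 (5 + m)) (𝓡 m) 𝓑.f x).toLinearMap

/-- The tangent space at `x` of the fiber `W_x`, on which `π` and `h` are constant. -/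
def wTangent (x : M) : Submodule ℝ (TangentSpace (𝓡 (5 + m)) x) :=
  𝓑.fiberTangent x ⊓ LinearMap.ker (mfderiv (𝓡 (5 + m)) (𝓡 1) 𝓑.h x).toLinearMap

variable [IsManifold (𝓡 (5 + m)) ∞ M] (g : SemiRiemannianMetric (5 + m) M)

/-- The horizontal space `H_x`, orthogonal to the fiber of `π`. -/
def horizontal (x : M) : Submodule ℝ (TangentSpace (𝓡 (5 + m)) x) :=
  (g.bilin x).orthogonal (𝓑.fiberTangent x)

/-- Compatibility of the metric with the multi-fiber structure: signature `(-)` on the circles,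
`(+,…,+)` on the fibers `W_x`, and `(-,+,+,+)` on the horizontal spaces. -/
structure IsCompatible : Prop where
  circle : ∀ x, HasSignature (g.bilin x) (𝓑.circleTangent x) 1 0
  w : ∀ x, HasSignature (g.bilin x) (𝓑.wTangent x) 0 m
  horizontal : ∀ x, HasSignature (g.bilin x) (𝓑.horizontal g x) 1 3

/-- `Y` is an electromagnetic potential: a smooth vector field tangent to the circles `S¹_x`
with `g(Y,Y) = -1`, which is a Killing field. -/
structure IsPotential (Y : ∀ x : M, TangentSpace (𝓡 (5 + m)) x) : Prop where
  smooth : SmoothFieldOn Y Set.univ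
  tangent : ∀ x, Y x ∈ 𝓑.circleTangent x
  unit : ∀ x, g.bilin x (Y x) (Y x) = -1
  killing : g.IsKilling Y

/-- The endomorphism `ᵉG_H = pr_H ∘ (ᵉG restricted to H)` of the horizontal space at `x`. -/
def endoH (φ : OpenPartialHomeomorph M (EuclideanSpace ℝ (Fin (5 + m)))) (x : M) :
    Module.End ℝ (𝓑.horizontal g x) :=
  orthProj (g.bilin x) (𝓑.horizontal g x) ∘ₗ
    g.endoAt x (g.einstein φ x) ∘ₗ (𝓑.horizontal g x).subtype

/-- `D` is a fluid domain with energy density `μ` and apparent field `X₀`: at each point of `D`,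
`-μ < 0` is an eigenvalue of `ᵉG_H` with a 1-dimensional eigenspace, which contains the vector
`X₀`, timelike with `g(X₀,X₀) = -1`; and `X₀` is smooth on `D`. -/
structure IsFluidDomain (D : Set M) (μ : M → ℝ)
    (X₀ : ∀ x : M, TangentSpace (𝓡 (5 + m)) x) : Prop where
  isOpen : IsOpen D
  smooth : SmoothFieldOn X₀ D
  pos : ∀ x ∈ D, 0 < μ x
  unit : ∀ x ∈ D, g.bilin x (X₀ x) (X₀ x) = -1
  finrank_eigenspace : ∀ φ ∈ smoothCharts (5 + m) M, ∀ x ∈ D ∩ φ.source,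
    Module.finrank ℝ (Module.End.eigenspace (𝓑.endoH g φ x) (-μ x)) = 1
  mem_eigenspace : ∀ φ ∈ smoothCharts (5 + m) M, ∀ x ∈ D ∩ φ.source,
    ∃ hx : X₀ x ∈ 𝓑.horizontal g x,
      (⟨X₀ x, hx⟩ : 𝓑.horizontal g x) ∈ Module.End.eigenspace (𝓑.endoH g φ x) (-μ x)

end MultiFiberBundle

variable [IsManifold (𝓡 (5 + m)) ∞ M] (g : SemiRiemannianMetric (5 + m) M)
  (φ : OpenPartialHomeomorph M (EuclideanSpace ℝ (Fin (5 + m))))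
  (Y X₀ : ∀ x : M, TangentSpace (𝓡 (5 + m)) x)

/-- The electric charge density `e = G(X₀, Y)`. -/
def charge (x : M) : ℝ := g.einstein φ x (X₀ x) (Y x)

/-- The vector field of the fluid, `X = X₀ + (e/μ) Y`. -/
def fluidField (μ : M → ℝ) (x : M) : TangentSpace (𝓡 (5 + m)) x :=
  X₀ x + (charge g φ Y X₀ x / μ x) • Y x

/-- The time-plane, spanned by `X₀` and `Y`. -/
def timePlane (x : M) : Submodule ℝ (TangentSpace (𝓡 (5 + m)) x) :=
  Submodule.span ℝ {X₀ x, Y x}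

/-- The pressure `P = G - G|_T`, where `G|_T` is the restriction of `G` to the time-plane. -/
def pressure (x : M) : LinearMap.BilinForm ℝ (TangentSpace (𝓡 (5 + m)) x) :=
  g.einstein φ x - restrictTo (g.bilin x) (timePlane Y X₀ x) (g.einstein φ x)

/-- The fluid is pluperfect on `D`: it is perfect, `ᵉP(Y) = 0`, and `∇·P = 0`. -/
structure IsPluperfect (D : Set M) : Prop where
  perfect : ∀ φ ∈ smoothCharts (5 + m) M, ∀ x ∈ D ∩ φ.source,
    g.endoAt x (pressure g φ Y X₀ x) (Y x) = 0
  div_pressure : ∀ φ ∈ smoothCharts (5 + m) M, ∀ x ∈ D ∩ φ.source,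
    g.divTensor φ (pressure g φ Y X₀) x = 0

end Spacetime

end KaluzaKlein

end

noncomputable section

namespace KaluzaKlein

set_option maxSynthPendingDepth 3

/-! Every assertion is local, and is proved in a chart for forms and connections on an open subset
of `Euc n`.

G is divergence free by the twice contracted Bianchi identity (`fderiv_scalar`,
`divForm_einsteinForm`) and ∇·P = 0 by assumption, so G|_T is divergence free. As X₀ and Y are
orthogonal of square -1, G|_T = μ X₀⊗X₀ + e (X₀⊗Y + Y⊗X₀) + c Y⊗Y with c = G(Y,Y).

To expand this divergence, the derivatives along Y are needed. A Killing field preserves g, hence Γ,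
the curvature and G (`lie_conn`, `lie_curv`, `lie_einsteinForm`), and also the gradients of the base
coordinates, which span H. Differentiating the eigenvector equation along Y gives Y(μ) = 0 and puts
[Y,X₀] in the eigenspace; this is a line and X₀ has constant square, so [Y,X₀] = 0
(`lie_field_and_density`). Hence e and c are constant along Y, and ∇_Y X₀ = ∇_{X₀} Y. Since div Y =
0 and ∇_Y Y = 0, there remains (`balance`) (X₀(μ) + μ div X₀) X₀ + μ ∇_{X₀}X₀ + (X₀(e) + e div X₀) Y
+ 2e ∇_{X₀}Y = 0. Both covariant derivatives are orthogonal to X₀ and Y. So the two brackets vanish,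
which gives the conservation laws and the constancy of e/μ, and μ ∇_{X₀}X₀ = -2e ∇_{X₀}Y. This is
the Lorentz equation, because F = 2g(∇Y,·) is skew; it is also ∇_X X = 0, because e/μ is constant
along X₀ and Y.

F is closed because it is exact. From ∇²Y = -R(Y,·)· follows ∇·F = -2 Ric(Y,·), and g(∇Y,Y) = 0
differentiated gives |F| = 4 Ric(Y,Y). Perfectness determines G(·,Y), and these combine into the
last formula.

The operator `corrDeriv T y b B` is ∇_b T for B = Γ_b and the Lie derivative along Y for b = Y, B =
-DY; its commutation with contractions is proved once for both. -/

/-- Euclidean coordinate space. -/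
abbrev Euc (n : ℕ) : Type := EuclideanSpace ℝ (Fin n)

/-- The coordinate basis vector. -/
abbrev stdVec {n : ℕ} (i : Fin n) : Euc n := EuclideanSpace.single i (1 : ℝ)

/-! ### Directional derivatives, second derivatives and smooth matrix inverses -/

section Calculus

variable {n : ℕ} {F : Type*} [NormedAddCommGroup F] [NormedSpace ℝ F]
  {F₁ F₂ : Type*} [NormedAddCommGroup F₁] [NormedSpace ℝ F₁]
  [NormedAddCommGroup F₂] [NormedSpace ℝ F₂]

theorem sum_coord_smul (v : Euc n) : ∑ i, v i • (stdVec i : Euc n) = v := by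
  ext j
  simp [Pi.single_apply]

theorem map_eq_sum_coord {G : Type*} [AddCommGroup G] [Module ℝ G]
    (L : Euc n →ₗ[ℝ] G) (v : Euc n) :
    L v = ∑ i, v i • L (stdVec i) := by
  conv_lhs => rw [← sum_coord_smul v]
  simp

theorem fderiv_apply_one {T : Euc n → F₁ →L[ℝ] F} {V : Euc n → F₁} {y : Euc n}
    (hT : DifferentiableAt ℝ T y) (hV : DifferentiableAt ℝ V y) (a : Euc n) :
    fderiv ℝ (fun z => T z (V z)) y a = fderiv ℝ T y a (V y) + T y (fderiv ℝ V y a) := by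
  rw [(hT.hasFDerivAt.clm_apply hV.hasFDerivAt).fderiv]
  simp [add_comm]

theorem fderiv_apply_two {T : Euc n → F₁ →L[ℝ] F₂ →L[ℝ] F} {V : Euc n → F₁} {W : Euc n → F₂}
    {y : Euc n}
    (hT : DifferentiableAt ℝ T y) (hV : DifferentiableAt ℝ V y) (hW : DifferentiableAt ℝ W y)
    (a : Euc n) :
    fderiv ℝ (fun z => T z (V z) (W z)) y a =
      fderiv ℝ T y a (V y) (W y) + T y (fderiv ℝ V y a) (W y) + T y (V y) (fderiv ℝ W y a) := by
  rw [fderiv_apply_one (hT.clm_apply hV) hW, fderiv_apply_one hT hV]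
  simp

theorem fderiv_eq_of_eqOn {U : Set (Euc n)} (hU : IsOpen U) {f h : Euc n → F}
    (hfh : ∀ y ∈ U, f y = h y) {y : Euc n} (hy : y ∈ U) : fderiv ℝ f y = fderiv ℝ h y :=
  Filter.EventuallyEq.fderiv_eq (Filter.eventually_of_mem (hU.mem_nhds hy) hfh)

theorem ContDiffOn.diffAt {U : Set (Euc n)} (hU : IsOpen U) {f : Euc n → F}
    (hf : ContDiffOn ℝ ∞ f U) {y : Euc n} (hy : y ∈ U) : DifferentiableAt ℝ f y :=
  (hf.contDiffAt (hU.mem_nhds hy)).differentiableAt (by simp)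

theorem ContDiffOn.fderivOn {U : Set (Euc n)} (hU : IsOpen U) {f : Euc n → F}
    (hf : ContDiffOn ℝ ∞ f U) : ContDiffOn ℝ ∞ (fderiv ℝ f) U :=
  hf.fderiv_of_isOpen hU (by simp)

theorem ContDiffOn.fderiv_fderiv_comm {U : Set (Euc n)} (hU : IsOpen U) {f : Euc n → F}
    (hf : ContDiffOn ℝ ∞ f U) {y : Euc n} (hy : y ∈ U) (a b : Euc n) :
    fderiv ℝ (fderiv ℝ f) y a b = fderiv ℝ (fderiv ℝ f) y b a :=
  ((hf.contDiffAt (hU.mem_nhds hy)).isSymmSndFDerivAt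
    (by rw [minSmoothness_of_isRCLikeNormedField]; exact WithTop.coe_le_coe.mpr le_top)) a b

theorem contDiffOn_matrix_det {U : Set (Euc n)} {k : ℕ} (M : Euc n → Matrix (Fin k) (Fin k) ℝ)
    (hM : ∀ i j, ContDiffOn ℝ ∞ (fun y => M y i j) U) :
    ContDiffOn ℝ ∞ (fun y => (M y).det) U := by
  simp only [Matrix.det_apply]
  exact ContDiffOn.sum fun σ _ => ContDiffOn.const_smul _ (contDiffOn_prod fun j _ => hM _ _)

/-- Cramer's rule: the entries of the adjugate are themselves determinants. -/
theorem contDiffOn_matrix_inv {U : Set (Euc n)} {k : ℕ} (M : Euc n → Matrix (Fin k) (Fin k) ℝ)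
    (hM : ∀ i j, ContDiffOn ℝ ∞ (fun y => M y i j) U) (hdet : ∀ y ∈ U, IsUnit (M y).det)
    (i j : Fin k) : ContDiffOn ℝ ∞ (fun y => (M y)⁻¹ i j) U := by
  simp only [Matrix.inv_def, Matrix.smul_apply, Ring.inverse_eq_inv', smul_eq_mul]
  refine ((contDiffOn_matrix_det M hM).inv fun y hy => (hdet y hy).ne_zero).mul ?_
  simp only [Matrix.adjugate_apply]
  refine contDiffOn_matrix_det _ fun k l => ?_
  simp only [Matrix.updateRow_apply]
  split_ifs
  · exact contDiffOn_const
  · exact hM k l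

end Calculus

/-! ### Levi-Civita connections, curvature and metric contractions in coordinates -/

/-- On `U`, `g` is a smooth nondegenerate symmetric form and `Γ` is the Christoffel form of its
Levi-Civita connection. -/
structure IsLeviCivitaOn {n : ℕ} (U : Set (Euc n)) (g : Euc n → Euc n →L[ℝ] Euc n →L[ℝ] ℝ)
    (Γ : Euc n → Euc n →L[ℝ] Euc n →L[ℝ] Euc n) : Prop where
  isOpen : IsOpen U
  smooth : ContDiffOn ℝ ∞ g U
  smooth_conn : ContDiffOn ℝ ∞ Γ U
  symm : ∀ y ∈ U, ∀ a b, g y a b = g y b a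
  nondeg : ∀ y ∈ U, ∀ a, (∀ b, g y a b = 0) → a = 0
  torsion_free : ∀ y ∈ U, ∀ a b, Γ y a b = Γ y b a
  compat : ∀ y ∈ U, ∀ a b c, fderiv ℝ g y a b c = g y (Γ y a b) c + g y b (Γ y a c)

/-- The curvature `R(a, b)c` of the connection `D + Γ`. -/
def curv {n : ℕ} (Γ : Euc n → Euc n →L[ℝ] Euc n →L[ℝ] Euc n) (y : Euc n) :
    Euc n →L[ℝ] Euc n →L[ℝ] Euc n →L[ℝ] Euc n :=
  fderiv ℝ Γ y - (fderiv ℝ Γ y).flip +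
    ((ContinuousLinearMap.compL ℝ (Euc n) (Euc n) (Euc n)).bilinearComp (Γ y) (Γ y)
      - ((ContinuousLinearMap.compL ℝ (Euc n) (Euc n) (Euc n)).bilinearComp (Γ y) (Γ y)).flip)

/-- The Ricci form of the connection `D + Γ`. -/
def ricciForm {n : ℕ} (Γ : Euc n → Euc n →L[ℝ] Euc n →L[ℝ] Euc n) (y : Euc n) :
    Euc n →L[ℝ] Euc n →L[ℝ] ℝ :=
  ∑ i, (ContinuousLinearMap.compL ℝ (Euc n) (Euc n) ℝ (EuclideanSpace.proj i)).comp
    (curv Γ y (stdVec i))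

/-- The vector metrically dual to the `i`-th coordinate. -/
def dualVec {n : ℕ} (g : Euc n → Euc n →L[ℝ] Euc n →L[ℝ] ℝ) (i : Fin n) (y : Euc n) : Euc n :=
  ∑ j, (Matrix.of fun k l => g y (stdVec k) (stdVec l))⁻¹ i j • stdVec j

/-- The metric trace of a form. -/
def metricTrace {n : ℕ} (g T : Euc n → Euc n →L[ℝ] Euc n →L[ℝ] ℝ) (y : Euc n) : ℝ :=
  ∑ i, T y (stdVec i) (dualVec g i y)

/-- The derivative of the form field `T` in the direction `b`, corrected by the endomorphism `B`. -/
def corrDeriv {n : ℕ} (T : Euc n → Euc n →L[ℝ] Euc n →L[ℝ] ℝ) (y b : Euc n)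
    (B : Euc n →L[ℝ] Euc n) (u v : Euc n) : ℝ :=
  fderiv ℝ T y b u v - T y (B u) v - T y u (B v)

/-- The corrected derivative of the curvature. -/
def corrDerivCurv {n : ℕ} (Γ : Euc n → Euc n →L[ℝ] Euc n →L[ℝ] Euc n) (y b : Euc n)
    (B : Euc n →L[ℝ] Euc n) (u v w : Euc n) : Euc n :=
  fderiv ℝ (curv Γ) y b u v w + B (curv Γ y u v w) - curv Γ y (B u) v w - curv Γ y u (B v) w
    - curv Γ y u v (B w)

section CurvatureBasics

variable {n : ℕ} {U : Set (Euc n)} {g : Euc n → Euc n →L[ℝ] Euc n →L[ℝ] ℝ}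
  {Γ : Euc n → Euc n →L[ℝ] Euc n →L[ℝ] Euc n}

theorem curv_apply (y a b c : Euc n) :
    curv Γ y a b c = fderiv ℝ Γ y a b c - fderiv ℝ Γ y b a c + Γ y a (Γ y b c)
      - Γ y b (Γ y a c) := by
  simp [curv]; abel

theorem curv_antisymm (y a b c : Euc n) : curv Γ y a b c = - curv Γ y b a c := by
  simp only [curv_apply]; abel

theorem ricciForm_apply (y b c : Euc n) :
    ricciForm Γ y b c = ∑ i, (curv Γ y (stdVec i) b c) i := by
  simp [ricciForm]

/-- The trace of a product is independent of the order; this lets the trace defining Ric commute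
with the correction by an endomorphism. -/
theorem sum_coord_comm (L M : Euc n →L[ℝ] Euc n) :
    ∑ i, (L (M (stdVec i))) i = ∑ i, (M (L (stdVec i))) i := by
  have h : ∀ L M : Euc n →L[ℝ] Euc n, ∑ i, (L (M (stdVec i))) i =
      ∑ i, ∑ j, (M (stdVec i)) j * (L (stdVec j)) i := by
    intro L M
    refine Finset.sum_congr rfl fun i _ => ?_
    have := map_eq_sum_coord (L : Euc n →ₗ[ℝ] Euc n) (M (stdVec i))
    simp only [ContinuousLinearMap.coe_coe] at this
    rw [this]; simp
  rw [h, h, Finset.sum_comm]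
  exact Finset.sum_congr rfl fun i _ => Finset.sum_congr rfl fun j _ => mul_comm _ _

namespace IsLeviCivitaOn

variable (h : IsLeviCivitaOn U g Γ)
include h

theorem smooth_curv : ContDiffOn ℝ ∞ (curv Γ) U := by
  have h1 := ContDiffOn.fderivOn h.isOpen h.smooth_conn
  rw [contDiffOn_clm_apply]; intro a
  rw [contDiffOn_clm_apply]; intro b
  rw [contDiffOn_clm_apply]; intro c
  simp only [curv_apply]
  have e : ∀ a b, ContDiffOn ℝ ∞ (fun y => Γ y a b) U := fun a b =>
    (h.smooth_conn.clm_apply contDiffOn_const).clm_apply contDiffOn_const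
  have e1 : ∀ a b c, ContDiffOn ℝ ∞ (fun y => fderiv ℝ Γ y a b c) U := fun a b c =>
    ((h1.clm_apply contDiffOn_const).clm_apply contDiffOn_const).clm_apply contDiffOn_const
  exact (((e1 a b c).sub (e1 b a c)).add
    ((h.smooth_conn.clm_apply contDiffOn_const).clm_apply (e b c))).sub
    ((h.smooth_conn.clm_apply contDiffOn_const).clm_apply (e a c))

theorem smooth_ricciForm : ContDiffOn ℝ ∞ (ricciForm Γ) U := by
  rw [contDiffOn_clm_apply]; intro b
  rw [contDiffOn_clm_apply]; intro c
  simp only [ricciForm_apply]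
  refine ContDiffOn.sum fun i _ => ?_
  have : ContDiffOn ℝ ∞ (fun y => curv Γ y (stdVec i) b c) U :=
    ((h.smooth_curv.clm_apply contDiffOn_const).clm_apply contDiffOn_const).clm_apply
      contDiffOn_const
  exact (EuclideanSpace.proj (𝕜 := ℝ) i).contDiff.comp_contDiffOn this

/-- A row vector killing the Gram matrix would be orthogonal to every basis vector, against
nondegeneracy. -/
theorem isUnit_det {y : Euc n} (hy : y ∈ U) :
    IsUnit (Matrix.of fun k l => g y (stdVec k) (stdVec l)).det := by
  rw [isUnit_iff_ne_zero]
  intro h0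
  obtain ⟨v, hv, hv0⟩ := Matrix.exists_vecMul_eq_zero_iff.mpr h0
  have : (WithLp.toLp 2 v : Euc n) = 0 := by
    refine h.nondeg y hy _ fun b => ?_
    have h1 := map_eq_sum_coord (g y (WithLp.toLp 2 v)).toLinearMap b
    simp only [ContinuousLinearMap.coe_coe] at h1
    rw [h1]
    refine Finset.sum_eq_zero fun j _ => ?_
    have h2 := map_eq_sum_coord ((g y).flip (stdVec j)).toLinearMap (WithLp.toLp 2 v)
    simp only [ContinuousLinearMap.coe_coe, ContinuousLinearMap.flip_apply] at h2
    rw [h2]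
    have h3 := congrFun hv0 j
    simp only [Matrix.vecMul, dotProduct, Matrix.of_apply, Pi.zero_apply] at h3
    simp only [smul_eq_mul]
    rw [h3, mul_zero]
  apply hv
  ext i
  simpa using congrArg (fun w : Euc n => w i) this

theorem inner_dualVec {y : Euc n} (hy : y ∈ U) (i : Fin n) (v : Euc n) :
    g y (dualVec g i y) v = v i := by
  have h1 := map_eq_sum_coord (g y (dualVec g i y)).toLinearMap v
  simp only [ContinuousLinearMap.coe_coe] at h1
  rw [h1]
  have h2 : ∀ k, g y (dualVec g i y) (stdVec k) = (1 : Matrix (Fin n) (Fin n) ℝ) i k := by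
    intro k
    rw [← Matrix.nonsing_inv_mul _ (h.isUnit_det hy)]
    simp [dualVec, Matrix.mul_apply]
  simp [h2, Matrix.one_apply]

theorem inner_dualVec' {y : Euc n} (hy : y ∈ U) (i : Fin n) (v : Euc n) :
    g y v (dualVec g i y) = v i := by
  rw [h.symm y hy, h.inner_dualVec hy]

theorem eq_of_inner {y : Euc n} (hy : y ∈ U) {a b : Euc n} (hab : ∀ c, g y a c = g y b c) :
    a = b := by
  rw [← sub_eq_zero]
  refine h.nondeg y hy _ fun c => ?_
  simp [hab c]

theorem smooth_dualVec (i : Fin n) : ContDiffOn ℝ ∞ (dualVec g i) U := by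
  have e : ∀ k l, ContDiffOn ℝ ∞ (fun y => g y (stdVec k) (stdVec l)) U := fun a b =>
    (h.smooth.clm_apply contDiffOn_const).clm_apply contDiffOn_const
  unfold dualVec
  exact ContDiffOn.sum fun j _ => ContDiffOn.fun_smul
    (contDiffOn_matrix_inv (fun y => Matrix.of fun k l => g y (stdVec k) (stdVec l)) e
      (fun y hy => h.isUnit_det hy) i j) contDiffOn_const

/-- The numbers `g y v (stdVec i)` are the coordinates of `v` in the basis `dualVec g i y`. -/
theorem sum_dual_left {y : Euc n} (hy : y ∈ U) (L : Euc n →ₗ[ℝ] ℝ) (v : Euc n) :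
    ∑ i, g y v (stdVec i) * L (dualVec g i y) = L v := by
  have : v = ∑ i, g y v (stdVec i) • dualVec g i y := by
    refine h.eq_of_inner hy fun c => ?_
    have h1 := map_eq_sum_coord (g y v).toLinearMap c
    simp only [ContinuousLinearMap.coe_coe] at h1
    rw [h1]
    simp [h.inner_dualVec hy, mul_comm]
  conv_rhs => rw [this]
  simp

/-- The two orders of contraction with the inverse metric agree. -/
theorem sum_swap {y : Euc n} (hy : y ∈ U) (T : Euc n →ₗ[ℝ] Euc n →ₗ[ℝ] ℝ) :
    ∑ i, T (stdVec i) (dualVec g i y) = ∑ i, T (dualVec g i y) (stdVec i) := by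
  -- Expanding each `stdVec i` in the dual basis turns both sides into double sums that differ only
  -- by the names of the indices and the symmetry of `g`.
  have h1 : ∀ i, T (stdVec i) (dualVec g i y) =
      ∑ j, g y (stdVec i) (stdVec j) * T (dualVec g j y) (dualVec g i y) := fun i => by
    have := h.sum_dual_left hy (T.flip (dualVec g i y)) (stdVec i)
    simpa using this.symm
  have h2 : ∀ i, T (dualVec g i y) (stdVec i) =
      ∑ j, g y (stdVec i) (stdVec j) * T (dualVec g i y) (dualVec g j y) := fun i => by
    have := h.sum_dual_left hy (T (dualVec g i y)) (stdVec i)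
    simpa using this.symm
  simp only [h1, h2]
  rw [Finset.sum_comm]
  refine Finset.sum_congr rfl fun i _ => Finset.sum_congr rfl fun j _ => ?_
  rw [h.symm y hy]

theorem sum_coord_eq {y : Euc n} (hy : y ∈ U) (L : Euc n →L[ℝ] Euc n) :
    ∑ i, (L (stdVec i)) i = ∑ i, g y (L (stdVec i)) (dualVec g i y) :=
  Finset.sum_congr rfl fun i _ => (h.inner_dualVec' hy i _).symm

/-- A skew endomorphism is trace free. -/
theorem sum_coord_of_skew {y : Euc n} (hy : y ∈ U) (L : Euc n →L[ℝ] Euc n)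
    (hL : ∀ a b, g y (L a) b + g y (L b) a = 0) : ∑ i, (L (stdVec i)) i = 0 := by
  have h1 := h.sum_coord_eq hy L
  let T : Euc n →ₗ[ℝ] Euc n →ₗ[ℝ] ℝ :=
    LinearMap.mk₂ ℝ (fun a b => g y (L a) b) (by simp) (by simp) (by simp) (by simp)
  have h2 := h.sum_swap hy T
  simp only [T, LinearMap.mk₂_apply] at h2
  -- Skewness makes the swapped contraction minus the trace, whereas `h2` makes it equal to the
  -- trace.
  have h3 : ∑ i, g y (L (dualVec g i y)) (stdVec i) =
      - ∑ i, g y (L (stdVec i)) (dualVec g i y) := by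
    rw [← Finset.sum_neg_distrib]
    exact Finset.sum_congr rfl fun i _ => by linarith [hL (dualVec g i y) (stdVec i)]
  linarith

end IsLeviCivitaOn

end CurvatureBasics

section Calculus

variable {n : ℕ} {F F₁ F₂ F₃ : Type*} [NormedAddCommGroup F] [NormedSpace ℝ F]
  [NormedAddCommGroup F₁] [NormedSpace ℝ F₁]
  [NormedAddCommGroup F₂] [NormedSpace ℝ F₂]
  [NormedAddCommGroup F₃] [NormedSpace ℝ F₃]

theorem fderiv_const_one {T : Euc n → F₁ →L[ℝ] F} {y : Euc n}
    (hT : DifferentiableAt ℝ T y) (b : F₁) (a : Euc n) :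
    fderiv ℝ (fun z => T z b) y a = fderiv ℝ T y a b := by
  rw [fderiv_apply_one hT (differentiableAt_const b)]
  simp

theorem fderiv_const_two {T : Euc n → F₁ →L[ℝ] F₂ →L[ℝ] F} {y : Euc n}
    (hT : DifferentiableAt ℝ T y) (b : F₁) (c : F₂) (a : Euc n) :
    fderiv ℝ (fun z => T z b c) y a = fderiv ℝ T y a b c := by
  rw [fderiv_const_one (hT.clm_apply (differentiableAt_const b)) c, fderiv_const_one hT]

theorem fderiv_const_three {T : Euc n → F₁ →L[ℝ] F₂ →L[ℝ] F₃ →L[ℝ] F} {y : Euc n}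
    (hT : DifferentiableAt ℝ T y) (b : F₁) (c : F₂) (d : F₃) (a : Euc n) :
    fderiv ℝ (fun z => T z b c d) y a = fderiv ℝ T y a b c d := by
  rw [fderiv_const_two (hT.clm_apply (differentiableAt_const b)) c, fderiv_const_one hT]

end Calculus

/-! ### Symmetries of the curvature and the Bianchi identities -/

namespace IsLeviCivitaOn

variable {n : ℕ} {U : Set (Euc n)} {g : Euc n → Euc n →L[ℝ] Euc n →L[ℝ] ℝ}
  {Γ : Euc n → Euc n →L[ℝ] Euc n →L[ℝ] Euc n} (h : IsLeviCivitaOn U g Γ)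
include h

theorem diff_metric {y : Euc n} (hy : y ∈ U) : DifferentiableAt ℝ g y :=
  ContDiffOn.diffAt h.isOpen h.smooth hy

theorem diff_conn {y : Euc n} (hy : y ∈ U) : DifferentiableAt ℝ Γ y :=
  ContDiffOn.diffAt h.isOpen h.smooth_conn hy

theorem diff_curv {y : Euc n} (hy : y ∈ U) : DifferentiableAt ℝ (curv Γ) y :=
  ContDiffOn.diffAt h.isOpen h.smooth_curv hy

theorem diff_fderiv_metric {y : Euc n} (hy : y ∈ U) : DifferentiableAt ℝ (fderiv ℝ g) y :=
  ContDiffOn.diffAt h.isOpen (ContDiffOn.fderivOn h.isOpen h.smooth) hy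

theorem diff_fderiv_conn {y : Euc n} (hy : y ∈ U) : DifferentiableAt ℝ (fderiv ℝ Γ) y :=
  ContDiffOn.diffAt h.isOpen (ContDiffOn.fderivOn h.isOpen h.smooth_conn) hy

theorem fderiv_conn_symm {y : Euc n} (hy : y ∈ U) (a b c : Euc n) :
    fderiv ℝ Γ y a b c = fderiv ℝ Γ y a c b := by
  rw [← fderiv_const_two (h.diff_conn hy), ← fderiv_const_two (h.diff_conn hy),
    fderiv_eq_of_eqOn h.isOpen (fun z hz => h.torsion_free z hz b c) hy]

/-- Metric compatibility is differentiated once, then used again to remove the first derivatives of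
`g`. -/
theorem fderiv_fderiv_metric {y : Euc n} (hy : y ∈ U) (a b c d : Euc n) :
    fderiv ℝ (fderiv ℝ g) y a b c d =
      g y (Γ y a (Γ y b c)) d + g y (Γ y b c) (Γ y a d) + g y (fderiv ℝ Γ y a b c) d
      + (g y (Γ y a c) (Γ y b d) + g y c (Γ y a (Γ y b d)) + g y c (fderiv ℝ Γ y a b d)) := by
  have dΓ : ∀ u v, DifferentiableAt ℝ (fun z => Γ z u v) y := fun u v =>
    ((h.diff_conn hy).clm_apply (differentiableAt_const u)).clm_apply (differentiableAt_const v)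
  rw [← fderiv_const_three (h.diff_fderiv_metric hy),
    fderiv_eq_of_eqOn h.isOpen (fun z hz => h.compat z hz b c d) hy,
    fderiv_fun_add (((h.diff_metric hy).clm_apply (dΓ b c)).clm_apply (differentiableAt_const d))
      (((h.diff_metric hy).clm_apply (differentiableAt_const c)).clm_apply (dΓ b d))]
  rw [add_apply,
    fderiv_apply_two (h.diff_metric hy) (dΓ b c) (differentiableAt_const d),
    fderiv_apply_two (h.diff_metric hy) (differentiableAt_const c) (dΓ b d),
    fderiv_const_two (h.diff_conn hy), fderiv_const_two (h.diff_conn hy),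
    h.compat y hy, h.compat y hy]
  simp

/-- Second derivatives of `g` in the directions `a`, `b` commute, and by `fderiv_fderiv_metric`
their commutator is g(R(a,b)c, d) + g(c, R(a,b)d). -/
theorem curv_skew {y : Euc n} (hy : y ∈ U) (a b c d : Euc n) :
    g y (curv Γ y a b c) d + g y (curv Γ y a b d) c = 0 := by
  have h1 := ContDiffOn.fderiv_fderiv_comm h.isOpen h.smooth hy a b
  have h2 := congrArg (fun L => L c d) h1
  simp only [h.fderiv_fderiv_metric hy] at h2
  rw [h.symm y hy (curv Γ y a b d) c]
  simp only [curv_apply, map_add, map_sub, add_apply,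
    sub_apply]
  linarith

/-- Since Γ, and with it its derivative, is symmetric in the lower indices, the terms of the cyclic
sum cancel in pairs. -/
theorem curv_bianchi {y : Euc n} (hy : y ∈ U) (a b c : Euc n) :
    curv Γ y a b c + curv Γ y b c a + curv Γ y c a b = 0 := by
  simp only [curv_apply]
  rw [h.fderiv_conn_symm hy a c b, h.fderiv_conn_symm hy b a c, h.fderiv_conn_symm hy c b a,
    h.torsion_free y hy a c, h.torsion_free y hy b a, h.torsion_free y hy c b]
  abel

/-- By the first Bianchi identity the difference of the two sides is the trace of R(c,b), a skew
endomorphism. -/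
theorem ricciForm_symm {y : Euc n} (hy : y ∈ U) (b c : Euc n) :
    ricciForm Γ y b c = ricciForm Γ y c b := by
  have h1 := h.sum_coord_of_skew hy (curv Γ y c b) (h.curv_skew hy c b)
  rw [ricciForm_apply, ricciForm_apply, ← sub_eq_zero, ← Finset.sum_sub_distrib, ← h1]
  refine Finset.sum_congr rfl fun i _ => ?_
  have h2 := h.curv_bianchi hy (stdVec i) b c
  rw [curv_antisymm y c (stdVec i) b, curv_antisymm y b c] at h2
  have h3 := congrArg (fun v : Euc n => v i) h2
  simp only [PiLp.add_apply, PiLp.neg_apply, PiLp.zero_apply] at h3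
  linarith

theorem fderiv_curv {y : Euc n} (hy : y ∈ U) (a b c d : Euc n) :
    fderiv ℝ (curv Γ) y a b c d =
      fderiv ℝ (fderiv ℝ Γ) y a b c d - fderiv ℝ (fderiv ℝ Γ) y a c b d
      + (fderiv ℝ Γ y a b (Γ y c d) + Γ y b (fderiv ℝ Γ y a c d))
      - (fderiv ℝ Γ y a c (Γ y b d) + Γ y c (fderiv ℝ Γ y a b d)) := by
  have dΓ : ∀ u v, DifferentiableAt ℝ (fun z => Γ z u v) y := fun u v =>
    ((h.diff_conn hy).clm_apply (differentiableAt_const u)).clm_apply (differentiableAt_const v)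
  have dΓ' : ∀ u v w, DifferentiableAt ℝ (fun z => Γ z u (Γ z v w)) y := fun u v w =>
    ((h.diff_conn hy).clm_apply (differentiableAt_const u)).clm_apply (dΓ v w)
  have dd : ∀ u v w, DifferentiableAt ℝ (fun z => fderiv ℝ Γ z u v w) y := fun u v w =>
    (((h.diff_fderiv_conn hy).clm_apply (differentiableAt_const u)).clm_apply
      (differentiableAt_const v)).clm_apply (differentiableAt_const w)
  rw [← fderiv_const_three (h.diff_curv hy)]
  simp only [curv_apply]
  rw [fderiv_fun_sub (((dd b c d).fun_sub (dd c b d)).fun_add (dΓ' b c d)) (dΓ' c b d),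
    fderiv_fun_add ((dd b c d).fun_sub (dd c b d)) (dΓ' b c d), fderiv_fun_sub (dd b c d) (dd c b d)]
  simp only [add_apply, sub_apply]
  rw [fderiv_const_three (h.diff_fderiv_conn hy), fderiv_const_three (h.diff_fderiv_conn hy),
    fderiv_apply_two (h.diff_conn hy) (differentiableAt_const b) (dΓ c d),
    fderiv_apply_two (h.diff_conn hy) (differentiableAt_const c) (dΓ b d),
    fderiv_const_two (h.diff_conn hy), fderiv_const_two (h.diff_conn hy)]
  simp

-- The second Bianchi identity as a formal identity between D²Γ, DΓ and Γ. Second derivatives cancel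
-- by their symmetry, and the terms R(Γ(a,b),c) cancel by the symmetry of Γ and the antisymmetry of
-- R. Abstract operators on an additive group leave an identity within reach of `abel`.
omit h in
theorem bianchi_second_algebra {V : Type*} [AddCommGroup V] (D₂ : V → V → V → V → V)
    (D₁ R : V → V → V → V) (DR : V → V → V → V → V) (G : V → V → V)
    (hD₂ : ∀ a b c d, D₂ a b c d = D₂ b a c d) (hG : ∀ a b, G a b = G b a)
    (G_add : ∀ a u v, G a (u + v) = G a u + G a v)
    (G_sub : ∀ a u v, G a (u - v) = G a u - G a v)
    (hR : ∀ a b c, R a b c = D₁ a b c - D₁ b a c + G a (G b c) - G b (G a c))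
    (hDR : ∀ a b c d, DR a b c d = D₂ a b c d - D₂ a c b d + (D₁ a b (G c d) + G b (D₁ a c d))
      - (D₁ a c (G b d) + G c (D₁ a b d))) (a b c w : V) :
    (DR a b c w + G a (R b c w) - R (G a b) c w - R b (G a c) w - R b c (G a w))
      + (DR b c a w + G b (R c a w) - R (G b c) a w - R c (G b a) w - R c a (G b w))
      + (DR c a b w + G c (R a b w) - R (G c a) b w - R a (G c b) w - R a b (G c w)) = 0 := by
  simp only [hDR, hR, G_add, G_sub]
  rw [hD₂ b a c w, hD₂ c b a w, hD₂ c a b w, hG b a, hG c a, hG c b]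
  abel

theorem curv_bianchi_second {y : Euc n} (hy : y ∈ U) (a b c w : Euc n) :
    corrDerivCurv Γ y a (Γ y a) b c w + corrDerivCurv Γ y b (Γ y b) c a w
      + corrDerivCurv Γ y c (Γ y c) a b w = 0 :=
  bianchi_second_algebra (fun a b c d => fderiv ℝ (fderiv ℝ Γ) y a b c d)
    (fun a b c => fderiv ℝ Γ y a b c) (fun a b c => curv Γ y a b c)
    (fun a b c d => fderiv ℝ (curv Γ) y a b c d) (fun a b => Γ y a b)
    (fun a b c d => by rw [ContDiffOn.fderiv_fderiv_comm h.isOpen h.smooth_conn hy a b])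
    (h.torsion_free y hy) (fun a => (Γ y a).map_add) (fun a => (Γ y a).map_sub)
    (curv_apply y) (h.fderiv_curv hy) a b c w

/-! ### Corrected derivatives and their commutation with contractions -/

section Derivation

variable {y b : Euc n} {B : Euc n →L[ℝ] Euc n}


/-- The contraction defining Ric involves no metric, so any `B` is allowed: the two correction terms
in the contracted slots have equal traces and cancel. -/
theorem corrDeriv_ricciForm (hy : y ∈ U) (u v : Euc n) :
    corrDeriv (ricciForm Γ) y b B u v =
      ∑ i, (corrDerivCurv Γ y b B (stdVec i) u v) i := by
  have dR : ∀ i, DifferentiableAt ℝ (fun z => curv Γ z (stdVec i) u v) y := fun i =>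
    (((h.diff_curv hy).clm_apply (differentiableAt_const _)).clm_apply
      (differentiableAt_const _)).clm_apply (differentiableAt_const _)
  have hd : fderiv ℝ (ricciForm Γ) y b u v = ∑ i, (fderiv ℝ (curv Γ) y b (stdVec i) u v) i := by
    rw [← fderiv_const_two (ContDiffOn.diffAt h.isOpen h.smooth_ricciForm hy)]
    simp only [ricciForm_apply]
    have hs : ∀ i : Fin n, HasFDerivAt (fun z => (curv Γ z (stdVec i) u v) i)
        ((EuclideanSpace.proj (𝕜 := ℝ) i).comp
          (fderiv ℝ (fun z => curv Γ z (stdVec i) u v) y)) y := fun i =>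
      (EuclideanSpace.proj (𝕜 := ℝ) i).hasFDerivAt.comp y (dR i).hasFDerivAt
    rw [(HasFDerivAt.fun_sum fun i _ => hs i).fderiv, sum_apply]
    refine Finset.sum_congr rfl fun i _ => ?_
    rw [← fderiv_const_three (h.diff_curv hy)]
    simp
  have hc := sum_coord_comm B (((curv Γ y).flip u).flip v)
  simp only [ContinuousLinearMap.flip_apply] at hc
  simp only [corrDeriv, corrDerivCurv, hd, ricciForm_apply, PiLp.sub_apply, PiLp.add_apply,
    Finset.sum_sub_distrib, Finset.sum_add_distrib, hc]
  ring

theorem corrDeriv_metric_conn (hy : y ∈ U) (a u v : Euc n) :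
    corrDeriv g y a (Γ y a) u v = 0 := by
  rw [corrDeriv, h.compat y hy]; ring

/-- A derivation that kills `g` preserves the skewness of the curvature: `curv_skew` is
differentiated, and the correction terms cancel by `curv_skew` itself. -/
theorem corrDerivCurv_skew (hy : y ∈ U) (hB : ∀ u v, corrDeriv g y b B u v = 0)
    (u v w z : Euc n) :
    g y (corrDerivCurv Γ y b B u v w) z + g y (corrDerivCurv Γ y b B u v z) w = 0 := by
  have dR : ∀ w, DifferentiableAt ℝ (fun z => curv Γ z u v w) y := fun i =>
    (((h.diff_curv hy).clm_apply (differentiableAt_const _)).clm_apply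
      (differentiableAt_const _)).clm_apply (differentiableAt_const _)
  have dg : ∀ w z, DifferentiableAt ℝ (fun p => g p (curv Γ p u v w) z) y := fun w z =>
    ((h.diff_metric hy).clm_apply (dR w)).clm_apply (differentiableAt_const _)
  have h1 := congrArg (fun L => L b)
    (fderiv_eq_of_eqOn h.isOpen (fun p hp => h.curv_skew hp u v w z) hy)
  simp only [fderiv_fun_add (dg w z) (dg z w), add_apply] at h1
  rw [fderiv_apply_two (h.diff_metric hy) (dR w) (differentiableAt_const z),
    fderiv_apply_two (h.diff_metric hy) (dR z) (differentiableAt_const w),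
    fderiv_const_three (h.diff_curv hy), fderiv_const_three (h.diff_curv hy)] at h1
  have hB' : ∀ p q, fderiv ℝ g y b p q = g y (B p) q + g y p (B q) := fun p q => by
    have := hB p q
    rw [corrDeriv] at this
    linarith
  simp only [hB', fderiv_fun_const, Pi.zero_apply, zero_apply,
    map_zero, add_zero] at h1
  have e1 := h.curv_skew hy (B u) v w z
  have e2 := h.curv_skew hy u (B v) w z
  have e3 := h.curv_skew hy u v (B w) z
  have e4 := h.curv_skew hy u v w (B z)
  simp only [corrDerivCurv, map_add, map_sub, add_apply, sub_apply]
  linarith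

/-- Obtained by differentiating g(`dualVec g i`, v) = v_i. The first term comes from the derivative
of `g`; the second is the correction of the coordinate covector itself. -/
theorem inner_fderiv_dualVec (hy : y ∈ U) (hB : ∀ u v, corrDeriv g y b B u v = 0) (i : Fin n) :
    fderiv ℝ (dualVec g i) y b = - B (dualVec g i y) - ∑ j, (B (stdVec j)) i • dualVec g j y := by
  refine h.eq_of_inner hy fun v => ?_
  have h1 := congrArg (fun L => L b)
    (fderiv_eq_of_eqOn h.isOpen (fun p hp => h.inner_dualVec hp i v) hy)
  simp only at h1
  rw [fderiv_apply_two (h.diff_metric hy) (ContDiffOn.diffAt h.isOpen (h.smooth_dualVec i) hy)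
    (differentiableAt_const v)] at h1
  have h2 := hB (dualVec g i y) v
  rw [corrDeriv, h.inner_dualVec hy] at h2
  have h3 := congrArg (fun w : Euc n => w i) (map_eq_sum_coord B.toLinearMap v)
  simp only [ContinuousLinearMap.coe_coe, WithLp.ofLp_sum, Finset.sum_apply, PiLp.smul_apply,
    smul_eq_mul] at h3
  simp only [fderiv_fun_const, Pi.zero_apply, zero_apply, map_zero, add_zero] at h1
  simp only [map_sub, map_neg, map_sum, map_smul, sub_apply, neg_apply, sum_apply, smul_apply,
    smul_eq_mul, h.inner_dualVec hy]
  simp only [mul_comm ((B (stdVec _)) i)]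
  linarith

theorem smooth_metricTrace {T : Euc n → Euc n →L[ℝ] Euc n →L[ℝ] ℝ} (hT : ContDiffOn ℝ ∞ T U) :
    ContDiffOn ℝ ∞ (metricTrace g T) U := by
  unfold metricTrace
  exact ContDiffOn.sum fun i _ => (hT.clm_apply contDiffOn_const).clm_apply (h.smooth_dualVec i)

/-- A derivation that kills `g` commutes with metric contraction: the second term of
`inner_fderiv_dualVec` supplies the correction in the first slot of `T`, the first term the one in
the second slot. -/
theorem fderiv_metricTrace (hy : y ∈ U) (hB : ∀ u v, corrDeriv g y b B u v = 0)
    {T : Euc n → Euc n →L[ℝ] Euc n →L[ℝ] ℝ} (hT : DifferentiableAt ℝ T y) :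
    fderiv ℝ (metricTrace g T) y b = ∑ i, corrDeriv T y b B (stdVec i) (dualVec g i y) := by
  have ds : ∀ i, DifferentiableAt ℝ (dualVec g i) y := fun i =>
    ContDiffOn.diffAt h.isOpen (h.smooth_dualVec i) hy
  unfold metricTrace
  rw [fderiv_fun_sum fun i _ =>
    (hT.clm_apply (differentiableAt_const (stdVec i))).clm_apply (ds i), sum_apply]
  have h1 : ∀ i, fderiv ℝ (fun z => T z (stdVec i) (dualVec g i z)) y b =
      fderiv ℝ T y b (stdVec i) (dualVec g i y) - T y (stdVec i) (B (dualVec g i y))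
        - ∑ j, (B (stdVec j)) i * T y (stdVec i) (dualVec g j y) := fun i => by
    rw [fderiv_apply_two hT (differentiableAt_const _) (ds i), h.inner_fderiv_dualVec hy hB]
    simp
    ring
  have h2 : ∀ j, T y (B (stdVec j)) (dualVec g j y) =
      ∑ i, (B (stdVec j)) i * T y (stdVec i) (dualVec g j y) := fun j => by
    have := map_eq_sum_coord ((T y).flip (dualVec g j y)).toLinearMap (B (stdVec j))
    simpa using this
  simp only [h1, corrDeriv, h2, Finset.sum_sub_distrib]
  rw [Finset.sum_comm (γ := Fin n)]
  ring

end Derivation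

end IsLeviCivitaOn

/-! ### Divergence of 2-tensors and the twice contracted Bianchi identity -/

/-- The divergence of a 2-tensor, as a linear form. -/
def divForm {n : ℕ} (g : Euc n → Euc n →L[ℝ] Euc n →L[ℝ] ℝ)
    (Γ : Euc n → Euc n →L[ℝ] Euc n →L[ℝ] Euc n) (T : Euc n → Euc n →L[ℝ] Euc n →L[ℝ] ℝ)
    (y c : Euc n) : ℝ :=
  ∑ i, corrDeriv T y (stdVec i) (Γ y (stdVec i)) (dualVec g i y) c

/-- The form `2 Ric - S g`. -/
def einsteinForm {n : ℕ} (g : Euc n → Euc n →L[ℝ] Euc n →L[ℝ] ℝ)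
    (Γ : Euc n → Euc n →L[ℝ] Euc n →L[ℝ] Euc n) (y : Euc n) : Euc n →L[ℝ] Euc n →L[ℝ] ℝ :=
  (2 : ℝ) • ricciForm Γ y - metricTrace g (ricciForm Γ) y • g y

namespace IsLeviCivitaOn

variable {n : ℕ} {U : Set (Euc n)} {g : Euc n → Euc n →L[ℝ] Euc n →L[ℝ] ℝ}
  {Γ : Euc n → Euc n →L[ℝ] Euc n →L[ℝ] Euc n} (h : IsLeviCivitaOn U g Γ)
include h

theorem corrDerivCurv_antisymm {y : Euc n} (hy : y ∈ U) (b : Euc n) (B : Euc n →L[ℝ] Euc n)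
    (u v w : Euc n) : corrDerivCurv Γ y b B u v w = - corrDerivCurv Γ y b B v u w := by
  have : fderiv ℝ (curv Γ) y b u v w = - fderiv ℝ (curv Γ) y b v u w := by
    rw [h.fderiv_curv hy, h.fderiv_curv hy]; abel
  rw [corrDerivCurv, corrDerivCurv, this, curv_antisymm y u v w, curv_antisymm y (B u) v w,
    curv_antisymm y u (B v) w, curv_antisymm y u v (B w)]
  simp only [map_neg]
  abel

theorem corrDeriv_ricciForm_symm {y : Euc n} (hy : y ∈ U) (b : Euc n) (B : Euc n →L[ℝ] Euc n)
    (u v : Euc n) : corrDeriv (ricciForm Γ) y b B u v = corrDeriv (ricciForm Γ) y b B v u := by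
  have hd := ContDiffOn.diffAt h.isOpen h.smooth_ricciForm hy
  have : fderiv ℝ (ricciForm Γ) y b u v = fderiv ℝ (ricciForm Γ) y b v u := by
    rw [← fderiv_const_two hd, ← fderiv_const_two hd,
      fderiv_eq_of_eqOn h.isOpen (fun z hz => h.ricciForm_symm hz u v) hy]
  rw [corrDeriv, corrDeriv, this, h.ricciForm_symm hy (B u), h.ricciForm_symm hy u]
  ring

/-- The twice contracted Bianchi identity. -/
theorem fderiv_scalar {y : Euc n} (hy : y ∈ U) (b : Euc n) :
    fderiv ℝ (metricTrace g (ricciForm Γ)) y b = 2 * divForm g Γ (ricciForm Γ) y b := by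
  have hN : ∀ a, ∀ u v, corrDeriv g y a (Γ y a) u v = 0 := h.corrDeriv_metric_conn hy
  rw [h.fderiv_metricTrace hy (hN b) (ContDiffOn.diffAt h.isOpen h.smooth_ricciForm hy)]
  have hr : ∀ a u v, corrDeriv (ricciForm Γ) y a (Γ y a) u v =
      ∑ i, g y (corrDerivCurv Γ y a (Γ y a) (stdVec i) u v) (dualVec g i y) := fun a u v => by
    rw [h.corrDeriv_ricciForm hy]
    exact Finset.sum_congr rfl fun i _ => (h.inner_dualVec' hy i _).symm
  have hdiv : divForm g Γ (ricciForm Γ) y b = ∑ j, ∑ i,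
      g y (corrDerivCurv Γ y (stdVec j) (Γ y (stdVec j)) (stdVec i) b (dualVec g j y))
        (dualVec g i y) := by
    refine Finset.sum_congr rfl fun j _ => ?_
    rw [h.corrDeriv_ricciForm_symm hy, hr]
  -- The second Bianchi identity for b, e_i, e_j, applied to e^j and paired with e^i. Antisymmetry
  -- in one term and skewness in the other bring both to the shape of `hdiv`, so each sums to the
  -- divergence of Ric; hence the factor 2.
  have key : ∀ i j : Fin n,
      g y (corrDerivCurv Γ y b (Γ y b) (stdVec i) (stdVec j) (dualVec g j y)) (dualVec g i y) =
      g y (corrDerivCurv Γ y (stdVec i) (Γ y (stdVec i)) (stdVec j) b (dualVec g i y))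
        (dualVec g j y) +
      g y (corrDerivCurv Γ y (stdVec j) (Γ y (stdVec j)) (stdVec i) b (dualVec g j y))
        (dualVec g i y) := fun i j => by
    have h1 := congrArg (fun v => g y v (dualVec g i y))
      (h.curv_bianchi_second hy b (stdVec i) (stdVec j) (dualVec g j y))
    have h2 := h.corrDerivCurv_skew hy (hN (stdVec i)) (stdVec j) b (dualVec g j y) (dualVec g i y)
    rw [h.corrDerivCurv_antisymm hy (stdVec j) _ b (stdVec i)] at h1
    simp only [map_add, map_neg, add_apply, neg_apply, map_zero, zero_apply] at h1
    linarith
  simp only [hr, hdiv]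
  rw [Finset.sum_comm]
  simp only [key, Finset.sum_add_distrib]
  rw [Finset.sum_comm, two_mul]

theorem smooth_einsteinForm : ContDiffOn ℝ ∞ (einsteinForm g Γ) U :=
  ContDiffOn.sub (ContDiffOn.const_smul (2 : ℝ) h.smooth_ricciForm)
    (ContDiffOn.fun_smul (h.smooth_metricTrace h.smooth_ricciForm) h.smooth)

theorem einsteinForm_symm {y : Euc n} (hy : y ∈ U) (b c : Euc n) :
    einsteinForm g Γ y b c = einsteinForm g Γ y c b := by
  simp [einsteinForm, h.ricciForm_symm hy b c, h.symm y hy b c]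

/-- In the product rule for S g the term S · (corrected derivative of g) vanishes by `hB`. -/
theorem corrDeriv_einsteinForm {y : Euc n} (hy : y ∈ U) {b : Euc n} {B : Euc n →L[ℝ] Euc n}
    (hB : ∀ u v, corrDeriv g y b B u v = 0) (u v : Euc n) :
    corrDeriv (einsteinForm g Γ) y b B u v = 2 * corrDeriv (ricciForm Γ) y b B u v
      - fderiv ℝ (metricTrace g (ricciForm Γ)) y b * g y u v := by
  have hd := ContDiffOn.diffAt h.isOpen h.smooth_ricciForm hy
  have hS := ContDiffOn.diffAt h.isOpen (h.smooth_metricTrace h.smooth_ricciForm) hy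
  have h1 : fderiv ℝ (einsteinForm g Γ) y b =
      (2 : ℝ) • fderiv ℝ (ricciForm Γ) y b -
        (metricTrace g (ricciForm Γ) y • fderiv ℝ g y b +
          fderiv ℝ (metricTrace g (ricciForm Γ)) y b • g y) := by
    unfold einsteinForm
    rw [((hd.hasFDerivAt.fun_const_smul (2 : ℝ)).fun_sub
      (hS.hasFDerivAt.fun_smul (h.diff_metric hy).hasFDerivAt)).fderiv]
    simp
  have h2 := hB u v
  simp only [corrDeriv] at h2 ⊢
  rw [h1]
  simp only [einsteinForm, sub_apply, smul_apply, add_apply, smul_eq_mul]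
  linear_combination (-metricTrace g (ricciForm Γ) y) * h2

/-- The divergence of S g is dS, which is 2 ∇·Ric by `fderiv_scalar`. -/
theorem divForm_einsteinForm {y : Euc n} (hy : y ∈ U) (c : Euc n) :
    divForm g Γ (einsteinForm g Γ) y c = 0 := by
  have h1 : ∑ i, fderiv ℝ (metricTrace g (ricciForm Γ)) y (stdVec i) * g y (dualVec g i y) c =
      fderiv ℝ (metricTrace g (ricciForm Γ)) y c := by
    have := map_eq_sum_coord (fderiv ℝ (metricTrace g (ricciForm Γ)) y).toLinearMap c
    simp only [ContinuousLinearMap.coe_coe] at this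
    rw [this]
    exact Finset.sum_congr rfl fun i _ => by rw [h.inner_dualVec hy, smul_eq_mul, mul_comm]
  have h2 := h.fderiv_scalar hy c
  simp only [divForm] at h2 ⊢
  simp only [h.corrDeriv_einsteinForm hy (h.corrDeriv_metric_conn hy _), Finset.sum_sub_distrib,
    ← Finset.mul_sum, h1]
  linarith

end IsLeviCivitaOn

/-! ### Killing fields and the form dY^♭ -/

/-- The covariant derivative `a ↦ ∇_a V`. -/
def covD {n : ℕ} (Γ : Euc n → Euc n →L[ℝ] Euc n →L[ℝ] Euc n) (V : Euc n → Euc n) (y : Euc n) :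
    Euc n →L[ℝ] Euc n :=
  fderiv ℝ V y + (Γ y).flip (V y)

/-- `Y` is a smooth Killing field of `g` on `U`. -/
structure IsKillingOn {n : ℕ} (U : Set (Euc n)) (g : Euc n → Euc n →L[ℝ] Euc n →L[ℝ] ℝ)
    (Y : Euc n → Euc n) : Prop where
  smooth : ContDiffOn ℝ ∞ Y U
  lie_metric : ∀ y ∈ U, ∀ a b,
    fderiv ℝ g y (Y y) a b + g y (fderiv ℝ Y y a) b + g y a (fderiv ℝ Y y b) = 0

/-- The form `(a, b) ↦ 2 g(∇_a Y, b)`, equal to `dY^♭` when `Y` is Killing. -/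
def fieldForm {n : ℕ} (g : Euc n → Euc n →L[ℝ] Euc n →L[ℝ] ℝ)
    (Γ : Euc n → Euc n →L[ℝ] Euc n →L[ℝ] Euc n) (Y : Euc n → Euc n) (y : Euc n) :
    Euc n →L[ℝ] Euc n →L[ℝ] ℝ :=
  (2 : ℝ) • (g y).comp (covD Γ Y y)

section

variable {n : ℕ} {U : Set (Euc n)} {g : Euc n → Euc n →L[ℝ] Euc n →L[ℝ] ℝ}
  {Γ : Euc n → Euc n →L[ℝ] Euc n →L[ℝ] Euc n} {Y : Euc n → Euc n}

theorem covD_apply (V : Euc n → Euc n) (y a : Euc n) :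
    covD Γ V y a = fderiv ℝ V y a + Γ y a (V y) := by
  simp [covD]

theorem fieldForm_apply (y a b : Euc n) : fieldForm g Γ Y y a b = 2 * g y (covD Γ Y y a) b := by
  simp [fieldForm]

/-- Here `P`, `H`, `J` stand for the first three derivatives of Y. `h₀` says that the Lie derivative
of Γ vanishes and `h₁` is its derivative. Antisymmetrizing `h₁` in `u`, `v` removes `J`; `h₀` then
eliminates the remaining `H`, and the Lie derivative of the curvature is left. -/
theorem lie_curv_algebra {V : Type*} [AddCommGroup V] (J : V → V → V → V) (H : V → V → V)
    (P : V → V) (D₂ : V → V → V → V → V)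
    (D₁ R : V → V → V → V) (DR : V → V → V → V → V) (G : V → V → V) (Y : V)
    (hJ : ∀ a b c, J a b c = J b a c) (hH : ∀ a b, H a b = H b a)
    (hD₂ : ∀ a b c d, D₂ a b c d = D₂ b a c d)
    (G_sub : ∀ a u v, G a (u - v) = G a u - G a v)
    (P_add : ∀ u v, P (u + v) = P u + P v) (P_sub : ∀ u v, P (u - v) = P u - P v)
    (hR : ∀ a b c, R a b c = D₁ a b c - D₁ b a c + G a (G b c) - G b (G a c))
    (hDR : ∀ a b c d, DR a b c d = D₂ a b c d - D₂ a c b d + (D₁ a b (G c d) + G b (D₁ a c d))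
      - (D₁ a c (G b d) + G c (D₁ a b d)))
    (h₀ : ∀ a b, H a b + D₁ Y a b - P (G a b) + G (P a) b + G a (P b) = 0)
    (h₁ : ∀ u v w, J u v w + (D₂ u Y v w + D₁ (P u) v w) - (H u (G v w) + P (D₁ u v w))
      + (D₁ u (P v) w + G (H u v) w) + (D₁ u v (P w) + G v (H u w)) = 0) (u v w : V) :
    DR Y u v w - P (R u v w) + R (P u) v w + R u (P v) w + R u v (P w) = 0 := by
  have hH' : ∀ a b, H a b = P (G a b) - D₁ Y a b - G (P a) b - G a (P b) := fun a b => by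
    have h2 := h₀ a b
    rw [← sub_eq_zero, ← h2]; abel
  have e1 := h₁ u v w
  have e2 := h₁ v u w
  rw [hJ v u w, hH v u, hD₂ v Y u w] at e2
  rw [hD₂ u Y v w] at e1
  have e3 : _ - _ = (0 : V) := (congrArg₂ (· - ·) e1 e2).trans (sub_zero 0)
  rw [← e3]
  rw [hH' u (G v w), hH' v (G u w), hH' u w, hH' v w]
  simp only [hDR, hR, G_sub, P_add, P_sub]
  abel

/-- With b = Y and B = -DY the corrected derivative is the Lie derivative, so the results on
derivations killing `g` apply. -/
theorem IsKillingOn.corrDeriv_metric (hY : IsKillingOn U g Y) {y : Euc n} (hy : y ∈ U)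
    (u v : Euc n) : corrDeriv g y (Y y) (-fderiv ℝ Y y) u v = 0 := by
  have := hY.lie_metric y hy u v
  simp only [corrDeriv, neg_apply, map_neg]
  linarith

/-- Metric compatibility and symmetry of Γ translate the covariant Killing equation into the
vanishing of the Lie derivative of `g`. -/
theorem IsKillingOn.of_skew (h : IsLeviCivitaOn U g Γ) (hY : ContDiffOn ℝ ∞ Y U)
    (hs : ∀ y ∈ U, ∀ a b, g y (covD Γ Y y a) b + g y (covD Γ Y y b) a = 0) :
    IsKillingOn U g Y := by
  refine ⟨hY, fun y hy a b => ?_⟩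
  have h1 := hs y hy a b
  rw [h.compat y hy, h.torsion_free y hy _ a, h.torsion_free y hy _ b,
    h.symm y hy a (Γ y b _), h.symm y hy a (fderiv ℝ Y y b)]
  simp only [covD_apply, map_add, add_apply] at h1
  linarith

namespace IsLeviCivitaOn

variable (h : IsLeviCivitaOn U g Γ) 

section Killing

variable (hY : IsKillingOn U g Y) {y : Euc n} (hy : y ∈ U)
include h hY hy

theorem diff_killing : DifferentiableAt ℝ Y y := ContDiffOn.diffAt h.isOpen hY.smooth hy

theorem diff_fderiv_killing : DifferentiableAt ℝ (fderiv ℝ Y) y :=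
  ContDiffOn.diffAt h.isOpen (ContDiffOn.fderivOn h.isOpen hY.smooth) hy

theorem covD_skew (a b : Euc n) : g y (covD Γ Y y a) b + g y (covD Γ Y y b) a = 0 := by
  have h1 := hY.lie_metric y hy a b
  rw [h.compat y hy, h.torsion_free y hy _ a, h.torsion_free y hy _ b,
    h.symm y hy a (Γ y b _), h.symm y hy a (fderiv ℝ Y y b)] at h1
  simp only [covD_apply, map_add, add_apply]
  linarith

/-- The Lie derivative of the connection along a Killing field vanishes. -/
theorem lie_conn (a b : Euc n) :
    fderiv ℝ (fderiv ℝ Y) y a b + fderiv ℝ Γ y (Y y) a b - fderiv ℝ Y y (Γ y a b)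
      + Γ y (fderiv ℝ Y y a) b + Γ y a (fderiv ℝ Y y b) = 0 := by
  have dY := h.diff_killing hY hy
  have dDY : ∀ a, DifferentiableAt ℝ (fun z => fderiv ℝ Y z a) y := fun a =>
    (h.diff_fderiv_killing hY hy).clm_apply (differentiableAt_const a)
  -- The Lie derivative of Γ along Y, in coordinates.
  let A : Euc n → Euc n → Euc n := fun a b =>
    fderiv ℝ (fderiv ℝ Y) y a b + fderiv ℝ Γ y (Y y) a b - fderiv ℝ Y y (Γ y a b)
      + Γ y (fderiv ℝ Y y a) b + Γ y a (fderiv ℝ Y y b)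
  have A_symm : ∀ a b, A a b = A b a := fun a b => by
    simp only [A]
    rw [ContDiffOn.fderiv_fderiv_comm h.isOpen hY.smooth hy a b, h.fderiv_conn_symm hy,
      h.torsion_free y hy a b, h.torsion_free y hy _ b, h.torsion_free y hy a]
    abel
  -- This is the Killing equation differentiated in the direction `c`.
  have A_skew : ∀ c a b, g y (A c a) b + g y (A c b) a = 0 := fun c a b => by
    have h1 := congrArg (fun L => L c)
      (fderiv_eq_of_eqOn h.isOpen (fun z hz => hY.lie_metric z hz a b) hy)
    have d1 : DifferentiableAt ℝ (fun z => fderiv ℝ g z (Y z) a b) y :=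
      (((h.diff_fderiv_metric hy).clm_apply dY).clm_apply (differentiableAt_const a)).clm_apply
        (differentiableAt_const b)
    have d2 : DifferentiableAt ℝ (fun z => g z (fderiv ℝ Y z a) b) y :=
      ((h.diff_metric hy).clm_apply (dDY a)).clm_apply (differentiableAt_const b)
    have d3 : DifferentiableAt ℝ (fun z => g z a (fderiv ℝ Y z b)) y :=
      ((h.diff_metric hy).clm_apply (differentiableAt_const a)).clm_apply (dDY b)
    rw [fderiv_fun_add (d1.fun_add d2) d3, fderiv_fun_add d1 d2] at h1
    simp only [add_apply] at h1
    rw [fderiv_const_two ((h.diff_fderiv_metric hy).clm_apply dY),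
      fderiv_apply_one (h.diff_fderiv_metric hy) dY,
      fderiv_apply_two (h.diff_metric hy) (dDY a) (differentiableAt_const b),
      fderiv_apply_two (h.diff_metric hy) (differentiableAt_const a) (dDY b),
      fderiv_const_one (h.diff_fderiv_killing hY hy),
      fderiv_const_one (h.diff_fderiv_killing hY hy),
      ContDiffOn.fderiv_fderiv_comm h.isOpen h.smooth hy c (Y y)] at h1
    simp only [add_apply, h.fderiv_fderiv_metric hy, fderiv_fun_const, Pi.zero_apply,
      zero_apply, map_zero, add_zero] at h1
    have k1 := hY.lie_metric y hy (Γ y c a) b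
    have k2 := hY.lie_metric y hy a (Γ y c b)
    rw [h.compat y hy] at k1 k2 h1
    rw [h.compat y hy, h.compat y hy] at h1
    rw [h.symm y hy (A c b) a]
    simp only [A, map_add, map_sub, add_apply, sub_apply]
    linarith
  -- The trilinear form g(A(a,b),c) is symmetric in its first two slots and skew in its last two,
  -- hence zero: three alternate swaps reverse its sign and permute nothing in total.
  have hA : A a b = 0 := by
    refine h.nondeg y hy _ fun c => ?_
    have e1 := A_skew a b c
    have e2 := A_skew b c a
    have e3 := A_skew c a b
    rw [A_symm b a] at e2
    rw [A_symm c b] at e3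
    rw [A_symm c a] at e3
    linarith
  exact hA

/-- The Lie derivative of the curvature along a Killing field vanishes. -/
theorem lie_curv (u v w : Euc n) : corrDerivCurv Γ y (Y y) (-fderiv ℝ Y y) u v w = 0 := by
  have dY := h.diff_killing hY hy
  have dDY : ∀ a, DifferentiableAt ℝ (fun z => fderiv ℝ Y z a) y := fun a =>
    (h.diff_fderiv_killing hY hy).clm_apply (differentiableAt_const a)
  have sDY := ContDiffOn.fderivOn h.isOpen hY.smooth
  have dDDY : DifferentiableAt ℝ (fderiv ℝ (fderiv ℝ Y)) y :=
    ContDiffOn.diffAt h.isOpen (ContDiffOn.fderivOn h.isOpen sDY) hy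
  have dΓ : ∀ u v, DifferentiableAt ℝ (fun z => Γ z u v) y := fun u v =>
    ((h.diff_conn hy).clm_apply (differentiableAt_const u)).clm_apply (differentiableAt_const v)
  -- The identity `lie_conn` holds on all of `U`, so it may be differentiated in the direction `u`.
  have h1 : ∀ u v w, fderiv ℝ (fderiv ℝ (fderiv ℝ Y)) y u v w
      + (fderiv ℝ (fderiv ℝ Γ) y u (Y y) v w + fderiv ℝ Γ y (fderiv ℝ Y y u) v w)
      - (fderiv ℝ (fderiv ℝ Y) y u (Γ y v w) + fderiv ℝ Y y (fderiv ℝ Γ y u v w))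
      + (fderiv ℝ Γ y u (fderiv ℝ Y y v) w + Γ y (fderiv ℝ (fderiv ℝ Y) y u v) w)
      + (fderiv ℝ Γ y u v (fderiv ℝ Y y w) + Γ y v (fderiv ℝ (fderiv ℝ Y) y u w)) = 0 := by
    intro u v w
    have h2 := congrArg (fun L => L u)
      (fderiv_eq_of_eqOn h.isOpen (fun z hz => h.lie_conn hY hz v w) hy)
    have d1 : DifferentiableAt ℝ (fun z => fderiv ℝ (fderiv ℝ Y) z v w) y :=
      (dDDY.clm_apply (differentiableAt_const v)).clm_apply (differentiableAt_const w)
    have d2 : DifferentiableAt ℝ (fun z => fderiv ℝ Γ z (Y z) v w) y :=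
      (((h.diff_fderiv_conn hy).clm_apply dY).clm_apply (differentiableAt_const v)).clm_apply
        (differentiableAt_const w)
    have d3 : DifferentiableAt ℝ (fun z => fderiv ℝ Y z (Γ z v w)) y :=
      (h.diff_fderiv_killing hY hy).clm_apply (dΓ v w)
    have d4 : DifferentiableAt ℝ (fun z => Γ z (fderiv ℝ Y z v) w) y :=
      ((h.diff_conn hy).clm_apply (dDY v)).clm_apply (differentiableAt_const w)
    have d5 : DifferentiableAt ℝ (fun z => Γ z v (fderiv ℝ Y z w)) y :=
      ((h.diff_conn hy).clm_apply (differentiableAt_const v)).clm_apply (dDY w)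
    rw [fderiv_fun_add (((d1.fun_add d2).fun_sub d3).fun_add d4) d5,
      fderiv_fun_add ((d1.fun_add d2).fun_sub d3) d4, fderiv_fun_sub (d1.fun_add d2) d3,
      fderiv_fun_add d1 d2] at h2
    simp only [add_apply, sub_apply] at h2
    rw [fderiv_const_two dDDY, fderiv_const_two ((h.diff_fderiv_conn hy).clm_apply dY),
      fderiv_apply_one (h.diff_fderiv_conn hy) dY,
      fderiv_apply_one (h.diff_fderiv_killing hY hy) (dΓ v w),
      fderiv_const_two (h.diff_conn hy),
      fderiv_apply_two (h.diff_conn hy) (dDY v) (differentiableAt_const w),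
      fderiv_apply_two (h.diff_conn hy) (differentiableAt_const v) (dDY w),
      fderiv_const_one (h.diff_fderiv_killing hY hy),
      fderiv_const_one (h.diff_fderiv_killing hY hy)] at h2
    simp only [add_apply, fderiv_fun_const, Pi.zero_apply,
      zero_apply, map_zero, add_zero] at h2
    exact h2
  have key := lie_curv_algebra (fun a b c => fderiv ℝ (fderiv ℝ (fderiv ℝ Y)) y a b c)
    (fun a b => fderiv ℝ (fderiv ℝ Y) y a b) (fun a => fderiv ℝ Y y a)
    (fun a b c d => fderiv ℝ (fderiv ℝ Γ) y a b c d)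
    (fun a b c => fderiv ℝ Γ y a b c) (fun a b c => curv Γ y a b c)
    (fun a b c d => fderiv ℝ (curv Γ) y a b c d) (fun a b => Γ y a b) (Y y)
    (fun a b c => by rw [ContDiffOn.fderiv_fderiv_comm h.isOpen sDY hy a b])
    (fun a b => ContDiffOn.fderiv_fderiv_comm h.isOpen hY.smooth hy a b)
    (fun a b c d => by rw [ContDiffOn.fderiv_fderiv_comm h.isOpen h.smooth_conn hy a b])
    (fun a => (Γ y a).map_sub) (fderiv ℝ Y y).map_add
    (fderiv ℝ Y y).map_sub (curv_apply y) (h.fderiv_curv hy) (h.lie_conn hY hy) h1 u v w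
  rw [← key]
  simp only [corrDerivCurv, neg_apply, map_neg]
  abel

theorem lie_ricciForm (u v : Euc n) :
    corrDeriv (ricciForm Γ) y (Y y) (-fderiv ℝ Y y) u v = 0 := by
  rw [h.corrDeriv_ricciForm hy]
  simp [h.lie_curv hY hy]

/-- The scalar curvature is constant along Y, being the metric trace of Ric, and both `g` and Ric
are invariant. -/
theorem lie_einsteinForm (u v : Euc n) :
    corrDeriv (einsteinForm g Γ) y (Y y) (-fderiv ℝ Y y) u v = 0 := by
  rw [h.corrDeriv_einsteinForm hy (hY.corrDeriv_metric hy), h.lie_ricciForm hY hy,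
    h.fderiv_metricTrace hy (hY.corrDeriv_metric hy)
      (ContDiffOn.diffAt h.isOpen h.smooth_ricciForm hy)]
  simp [h.lie_ricciForm hY hy]

theorem sum_covD_killing : ∑ i, (covD Γ Y y (stdVec i)) i = 0 :=
  h.sum_coord_of_skew hy _ (h.covD_skew hY hy)

theorem hasFDerivAt_covD_killing (a b : Euc n) :
    fderiv ℝ (covD Γ Y) y a b = fderiv ℝ (fderiv ℝ Y) y a b + fderiv ℝ Γ y a b (Y y)
      + Γ y b (fderiv ℝ Y y a) := by
  have dY := h.diff_killing hY hy
  have dDY := h.diff_fderiv_killing hY hy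
  have d2 : DifferentiableAt ℝ (fun z => Γ z b (Y z)) y :=
    ((h.diff_conn hy).clm_apply (differentiableAt_const b)).clm_apply dY
  have dflip : DifferentiableAt ℝ (fun z => (Γ z).flip (Y z)) y :=
    DifferentiableAt.clm_apply
      ((ContinuousLinearMap.flipₗᵢ ℝ (Euc n) (Euc n) (Euc n)).differentiable.differentiableAt.comp
        y (h.diff_conn hy)) dY
  have dc : DifferentiableAt ℝ (covD Γ Y) y := dDY.fun_add dflip
  rw [← fderiv_const_one dc]
  simp only [covD_apply]
  rw [fderiv_fun_add (dDY.clm_apply (differentiableAt_const b)) d2, add_apply,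
    fderiv_const_one dDY, fderiv_apply_two (h.diff_conn hy) (differentiableAt_const b) dY]
  simp
  abel

/-- `∇²_{a,b} Y = - R(Y, a)b` for a Killing field `Y`. -/
theorem second_covD_killing (a b : Euc n) :
    fderiv ℝ (covD Γ Y) y a b + Γ y a (covD Γ Y y b) - covD Γ Y y (Γ y a b) =
      - curv Γ y (Y y) a b := by
  -- Written with covariant derivatives, the vanishing of the Lie derivative of Γ is exactly this
  -- identity.
  have h1 := h.lie_conn hY hy a b
  rw [← sub_eq_zero, ← h1, h.hasFDerivAt_covD_killing hY hy, curv_apply, covD_apply, covD_apply,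
    h.fderiv_conn_symm hy a b, h.torsion_free y hy b (fderiv ℝ Y y a),
    h.torsion_free y hy b (Y y), h.torsion_free y hy (Γ y a b) (Y y)]
  simp only [map_add]
  abel

end Killing

theorem smooth_covD {V : Euc n → Euc n} (hV : ContDiffOn ℝ ∞ V U) (h : IsLeviCivitaOn U g Γ) :
    ContDiffOn ℝ ∞ (covD Γ V) U := by
  rw [contDiffOn_clm_apply]; intro b
  simp only [covD_apply]
  exact ((ContDiffOn.fderivOn h.isOpen hV).clm_apply contDiffOn_const).add
    ((h.smooth_conn.clm_apply contDiffOn_const).clm_apply hV)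

theorem smooth_fieldForm (hY : ContDiffOn ℝ ∞ Y U) (h : IsLeviCivitaOn U g Γ) :
    ContDiffOn ℝ ∞ (fieldForm g Γ Y) U := by
  rw [contDiffOn_clm_apply]; intro a
  rw [contDiffOn_clm_apply]; intro b
  simp only [fieldForm_apply]
  exact contDiffOn_const.mul
    ((h.smooth.clm_apply ((smooth_covD hY h).clm_apply contDiffOn_const)).clm_apply
      contDiffOn_const)

section Killing

variable (hY : IsKillingOn U g Y) {y : Euc n} (hy : y ∈ U)
include h hY hy

/-- Since ∇g = 0, only the second covariant derivative of Y contributes. -/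
theorem corrDeriv_fieldForm (a b c : Euc n) :
    corrDeriv (fieldForm g Γ Y) y a (Γ y a) b c = - 2 * g y (curv Γ y (Y y) a b) c := by
  have dc : DifferentiableAt ℝ (covD Γ Y) y :=
    ContDiffOn.diffAt h.isOpen (smooth_covD hY.smooth h) hy
  have dcb : DifferentiableAt ℝ (fun z => covD Γ Y z b) y :=
    dc.clm_apply (differentiableAt_const b)
  have dF : DifferentiableAt ℝ (fieldForm g Γ Y) y :=
    ContDiffOn.diffAt h.isOpen (smooth_fieldForm hY.smooth h) hy
  have h1 := congrArg (fun v => g y v c) (h.second_covD_killing hY hy a b)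
  simp only [map_add, map_sub, add_apply, sub_apply, map_neg, neg_apply] at h1
  rw [corrDeriv, ← fderiv_const_two dF]
  simp only [fieldForm_apply]
  rw [fderiv_const_mul (((h.diff_metric hy).clm_apply dcb).clm_apply (differentiableAt_const c)),
    smul_apply,
    fderiv_apply_two (h.diff_metric hy) dcb (differentiableAt_const c), fderiv_const_one dc,
    h.compat y hy]
  simp only [fderiv_fun_const, Pi.zero_apply, zero_apply, map_zero, add_zero, smul_eq_mul]
  linarith

/-- `∇·F = -2 Ric(Y, ·)`. -/
theorem divForm_fieldForm (c : Euc n) :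
    divForm g Γ (fieldForm g Γ Y) y c = - 2 * ricciForm Γ y (Y y) c := by
  have h1 : ∀ i, corrDeriv (fieldForm g Γ Y) y (stdVec i) (Γ y (stdVec i)) (dualVec g i y) c =
      -2 * (curv Γ y (stdVec i) (Y y) c) i := fun i => by
    rw [h.corrDeriv_fieldForm hY hy, curv_antisymm]
    -- Skewness exchanges `c` with the dual vector, so that the sum becomes the trace defining
    -- Ric(Y, c).
    have := h.curv_skew hy (stdVec i) (Y y) (dualVec g i y) c
    rw [h.inner_dualVec' hy] at this
    simp only [map_neg, neg_apply]
    linarith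
  rw [divForm, ricciForm_apply, Finset.mul_sum]
  exact Finset.sum_congr rfl fun i _ => h1 i

/-- For a torsion-free metric connection dY^♭(a,b) = g(∇_aY,b) - g(∇_bY,a); the Killing equation
makes the two terms equal. -/
theorem fieldForm_eq_extDeriv (a b : Euc n) :
    fieldForm g Γ Y y a b = fderiv ℝ (fun z => g z (Y z)) y a b
      - fderiv ℝ (fun z => g z (Y z)) y b a := by
  have dY := h.diff_killing hY hy
  have e1 := h.covD_skew hY hy a b
  rw [fderiv_apply_one (h.diff_metric hy) dY, fderiv_apply_one (h.diff_metric hy) dY,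
    fieldForm_apply]
  simp only [add_apply, h.compat y hy]
  rw [h.torsion_free y hy b a]
  simp only [covD_apply, map_add, add_apply] at e1 ⊢
  linarith

/-- The form `F = dY^♭` is closed. -/
theorem fieldForm_closed (a b c : Euc n) :
    fderiv ℝ (fieldForm g Γ Y) y a b c + fderiv ℝ (fieldForm g Γ Y) y b c a
      + fderiv ℝ (fieldForm g Γ Y) y c a b = 0 := by
  have dF : DifferentiableAt ℝ (fieldForm g Γ Y) y :=
    ContDiffOn.diffAt h.isOpen (smooth_fieldForm hY.smooth h) hy
  have sα : ContDiffOn ℝ ∞ (fun z => g z (Y z)) U := h.smooth.clm_apply hY.smooth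
  have dα : DifferentiableAt ℝ (fderiv ℝ (fun z => g z (Y z))) y :=
    ContDiffOn.diffAt h.isOpen (ContDiffOn.fderivOn h.isOpen sα) hy
  have key : ∀ a b c, fderiv ℝ (fieldForm g Γ Y) y a b c =
      fderiv ℝ (fderiv ℝ (fun z => g z (Y z))) y a b c -
        -- The form is the antisymmetrized derivative of Y^♭, so the cyclic sum cancels by the
        -- symmetry of second derivatives.
        fderiv ℝ (fderiv ℝ (fun z => g z (Y z))) y a c b := fun a b c => by
    rw [← fderiv_const_two dF,
      fderiv_eq_of_eqOn h.isOpen (fun z hz => h.fieldForm_eq_extDeriv hY hz b c) hy,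
      fderiv_fun_sub
        ((dα.clm_apply (differentiableAt_const b)).clm_apply (differentiableAt_const c))
        ((dα.clm_apply (differentiableAt_const c)).clm_apply (differentiableAt_const b)),
      sub_apply, fderiv_const_two dα, fderiv_const_two dα]
  rw [key, key, key, ContDiffOn.fderiv_fderiv_comm h.isOpen sα hy a b,
    ContDiffOn.fderiv_fderiv_comm h.isOpen sα hy b c,
    ContDiffOn.fderiv_fderiv_comm h.isOpen sα hy c a]
  ring

end Killing

/-! ### Killing fields of constant square -1 -/

section UnitKilling

variable (hY : IsKillingOn U g Y) (hu : ∀ y ∈ U, g y (Y y) (Y y) = -1) {y : Euc n} (hy : y ∈ U)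
include h hY hu hy

theorem inner_covD_killing (a : Euc n) : g y (covD Γ Y y a) (Y y) = 0 := by
  have dY := h.diff_killing hY hy
  have h1 := congrArg (fun L => L a) (fderiv_eq_of_eqOn h.isOpen hu hy)
  simp only [fderiv_apply_two (h.diff_metric hy) dY dY, h.compat y hy, fderiv_fun_const,
    Pi.zero_apply, zero_apply] at h1
  rw [h.symm y hy (Y y), h.symm y hy (Y y) (fderiv ℝ Y y a)] at h1
  simp only [covD_apply, map_add, add_apply]
  linarith

/-- By skewness g(∇_Y Y, c) = -g(∇_c Y, Y), and this vanishes because g(Y,Y) is constant. -/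
theorem covD_killing_self : covD Γ Y y (Y y) = 0 := by
  refine h.nondeg y hy _ fun c => ?_
  have := h.covD_skew hY hy (Y y) c
  rw [h.inner_covD_killing hY hu hy] at this
  linarith

/-- Differentiating g(∇_aY, Y) = 0 in the direction `b` gives g(∇_aY, ∇_bY) = -g(∇²_{b,a}Y, Y), and
the second derivative is a curvature term by `second_covD_killing`. -/
theorem inner_covD_covD_killing (a b : Euc n) :
    g y (covD Γ Y y a) (covD Γ Y y b) = g y (curv Γ y b (Y y) (Y y)) a := by
  have dY := h.diff_killing hY hy
  have dc : DifferentiableAt ℝ (covD Γ Y) y :=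
    ContDiffOn.diffAt h.isOpen (smooth_covD hY.smooth h) hy
  have h1 := congrArg (fun L => L b)
    (fderiv_eq_of_eqOn h.isOpen (fun z hz => h.inner_covD_killing hY hu hz a) hy)
  rw [fderiv_apply_two (h.diff_metric hy) (dc.clm_apply (differentiableAt_const a)) dY,
    fderiv_const_one dc, h.compat y hy] at h1
  have h2 := congrArg (fun v => g y v (Y y)) (h.second_covD_killing hY hy b a)
  simp only [map_add, map_sub, add_apply, sub_apply, map_neg, neg_apply,
    h.inner_covD_killing hY hu hy] at h2
  have h3 := h.curv_skew hy (Y y) b a (Y y)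
  have h4 : g y (covD Γ Y y a) (covD Γ Y y b) =
    g y (covD Γ Y y a) (fderiv ℝ Y y b) + g y (covD Γ Y y a) (Γ y b (Y y)) := by
    rw [covD_apply Y y b, map_add]
  rw [curv_antisymm y b]
  simp only [fderiv_fun_const, Pi.zero_apply, zero_apply, map_neg, neg_apply] at h1 ⊢
  linarith

theorem ricciForm_killing :
    ricciForm Γ y (Y y) (Y y) =
      ∑ i, g y (covD Γ Y y (stdVec i)) (covD Γ Y y (dualVec g i y)) := by
  rw [ricciForm_apply]
  refine Finset.sum_congr rfl fun i _ => ?_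
  rw [h.symm y hy, h.inner_covD_covD_killing hY hu hy, h.inner_dualVec' hy]

/-- As F = 2g(∇Y,·), the full contraction is four times that of ∇Y, which is Ric(Y,Y) by
`ricciForm_killing`. -/
theorem contraction_fieldForm :
    ∑ i, ∑ j, fieldForm g Γ Y y (stdVec i) (stdVec j) *
      fieldForm g Γ Y y (dualVec g i y) (dualVec g j y) = 4 * ricciForm Γ y (Y y) (Y y) := by
  rw [h.ricciForm_killing hY hu hy, Finset.mul_sum]
  refine Finset.sum_congr rfl fun i _ => ?_
  have := h.sum_dual_left hy (fieldForm g Γ Y y (dualVec g i y)).toLinearMap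
    (covD Γ Y y (stdVec i))
  simp only [ContinuousLinearMap.coe_coe] at this
  simp only [fieldForm_apply (Y := Y) y (stdVec i), mul_assoc, ← Finset.mul_sum, this]
  rw [fieldForm_apply, h.symm y hy (covD Γ Y y (dualVec g i y))]
  ring

end UnitKilling

end IsLeviCivitaOn

end

/-! ### Horizontal vectors, gradients of base coordinates, divergences of products -/

/-- The vector `u` is orthogonal to the kernel of the differential of `p`. -/
def IsHor {n k : ℕ} (g : Euc n → Euc n →L[ℝ] Euc n →L[ℝ] ℝ) (p : Euc n → Euc k)
    (y u : Euc n) : Prop :=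
  ∀ v, fderiv ℝ p y v = 0 → g y v u = 0

/-- The gradient of the `a`-th component of `p`. -/
def gradVec {n k : ℕ} (g : Euc n → Euc n →L[ℝ] Euc n →L[ℝ] ℝ) (p : Euc n → Euc k)
    (a : Fin k) (y : Euc n) : Euc n :=
  ∑ i, (fderiv ℝ p y (stdVec i)) a • dualVec g i y

/-- The divergence of a vector field. -/
def divV {n : ℕ} (Γ : Euc n → Euc n →L[ℝ] Euc n →L[ℝ] Euc n) (V : Euc n → Euc n)
    (y : Euc n) : ℝ :=
  ∑ i, (covD Γ V y (stdVec i)) i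

/-- The form field `f V^♭ ⊗ W^♭`. -/
def tensorForm {n : ℕ} (g : Euc n → Euc n →L[ℝ] Euc n →L[ℝ] ℝ) (f : Euc n → ℝ)
    (V W : Euc n → Euc n) (y : Euc n) : Euc n →L[ℝ] Euc n →L[ℝ] ℝ :=
  (g y (V y)).smulRight (f y • g y (W y))

/-- The part of the stress form carried by the plane spanned by `X₀` and `Y`. -/
def planeForm {n : ℕ} (g : Euc n → Euc n →L[ℝ] Euc n →L[ℝ] ℝ) (μ e c : Euc n → ℝ)
    (X₀ Y : Euc n → Euc n) (y : Euc n) : Euc n →L[ℝ] Euc n →L[ℝ] ℝ :=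
  tensorForm g μ X₀ X₀ y + tensorForm g e X₀ Y y + tensorForm g e Y X₀ y + tensorForm g c Y Y y

section

variable {n k : ℕ} {U : Set (Euc n)} {g : Euc n → Euc n →L[ℝ] Euc n →L[ℝ] ℝ}
  {Γ : Euc n → Euc n →L[ℝ] Euc n →L[ℝ] Euc n} {y : Euc n}

theorem tensorForm_apply (f : Euc n → ℝ) (V W : Euc n → Euc n) (y a b : Euc n) :
    tensorForm g f V W y a b = f y * (g y (V y) a * g y (W y) b) := by
  simp [tensorForm]; ring

theorem covD_smul {f : Euc n → ℝ} {V : Euc n → Euc n} (hf : DifferentiableAt ℝ f y)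
    (hV : DifferentiableAt ℝ V y) (a : Euc n) :
    covD Γ (fun z => f z • V z) y a = fderiv ℝ f y a • V y + f y • covD Γ V y a := by
  rw [covD_apply, covD_apply, fderiv_fun_smul hf hV]
  simp
  abel

theorem covD_add {V W : Euc n → Euc n} (hV : DifferentiableAt ℝ V y)
    (hW : DifferentiableAt ℝ W y) (a : Euc n) :
    covD Γ (fun z => V z + W z) y a = covD Γ V y a + covD Γ W y a := by
  rw [covD_apply, covD_apply, covD_apply, fderiv_fun_add hV hW]
  simp
  abel

theorem divV_smul {f : Euc n → ℝ} {V : Euc n → Euc n} (hf : DifferentiableAt ℝ f y)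
    (hV : DifferentiableAt ℝ V y) :
    divV Γ (fun z => f z • V z) y = fderiv ℝ f y (V y) + f y * divV Γ V y := by
  have h1 := map_eq_sum_coord (fderiv ℝ f y).toLinearMap (V y)
  simp only [ContinuousLinearMap.coe_coe, smul_eq_mul] at h1
  simp only [divV, covD_smul hf hV, PiLp.add_apply, PiLp.smul_apply, smul_eq_mul,
    Finset.sum_add_distrib, Finset.mul_sum, h1]
  simp only [mul_comm]

theorem divV_add {V W : Euc n → Euc n} (hV : DifferentiableAt ℝ V y)
    (hW : DifferentiableAt ℝ W y) :
    divV Γ (fun z => V z + W z) y = divV Γ V y + divV Γ W y := by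
  simp [divV, covD_add hV hW, Finset.sum_add_distrib]

theorem corrDeriv_add {S T : Euc n → Euc n →L[ℝ] Euc n →L[ℝ] ℝ} (hS : DifferentiableAt ℝ S y)
    (hT : DifferentiableAt ℝ T y) (b : Euc n) (B : Euc n →L[ℝ] Euc n) (u v : Euc n) :
    corrDeriv (fun z => S z + T z) y b B u v = corrDeriv S y b B u v + corrDeriv T y b B u v := by
  simp only [corrDeriv, fderiv_fun_add hS hT, add_apply]
  ring

theorem corrDeriv_sub {S T : Euc n → Euc n →L[ℝ] Euc n →L[ℝ] ℝ} (hS : DifferentiableAt ℝ S y)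
    (hT : DifferentiableAt ℝ T y) (b : Euc n) (B : Euc n →L[ℝ] Euc n) (u v : Euc n) :
    corrDeriv (fun z => S z - T z) y b B u v = corrDeriv S y b B u v - corrDeriv T y b B u v := by
  simp only [corrDeriv, fderiv_fun_sub hS hT, sub_apply]
  ring

theorem divForm_add {S T : Euc n → Euc n →L[ℝ] Euc n →L[ℝ] ℝ} (hS : DifferentiableAt ℝ S y)
    (hT : DifferentiableAt ℝ T y) (c : Euc n) :
    divForm g Γ (fun z => S z + T z) y c = divForm g Γ S y c + divForm g Γ T y c := by
  simp only [divForm, corrDeriv_add hS hT, Finset.sum_add_distrib]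

theorem divForm_sub {S T : Euc n → Euc n →L[ℝ] Euc n →L[ℝ] ℝ} (hS : DifferentiableAt ℝ S y)
    (hT : DifferentiableAt ℝ T y) (c : Euc n) :
    divForm g Γ (fun z => S z - T z) y c = divForm g Γ S y c - divForm g Γ T y c := by
  simp only [divForm, corrDeriv_sub hS hT, Finset.sum_sub_distrib]

/-- Leibniz rule along a vector field which preserves the form field `T`. -/
theorem fderiv_of_lie_eq_zero {T : Euc n → Euc n →L[ℝ] Euc n →L[ℝ] ℝ} {Y V W : Euc n → Euc n}
    (hT : DifferentiableAt ℝ T y) (hV : DifferentiableAt ℝ V y) (hW : DifferentiableAt ℝ W y)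
    (hL : ∀ u v, corrDeriv T y (Y y) (-fderiv ℝ Y y) u v = 0) :
    fderiv ℝ (fun z => T z (V z) (W z)) y (Y y) =
      T y (fderiv ℝ V y (Y y) - fderiv ℝ Y y (V y)) (W y)
      + T y (V y) (fderiv ℝ W y (Y y) - fderiv ℝ Y y (W y)) := by
  have := hL (V y) (W y)
  rw [fderiv_apply_two hT hV hW]
  simp only [corrDeriv, neg_apply, map_neg, map_sub, sub_apply] at this ⊢
  linarith

namespace IsLeviCivitaOn

variable (h : IsLeviCivitaOn U g Γ)
include h

theorem diff_tensorForm {f : Euc n → ℝ} {V W : Euc n → Euc n} (hy : y ∈ U)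
    (hf : DifferentiableAt ℝ f y) (hV : DifferentiableAt ℝ V y) (hW : DifferentiableAt ℝ W y) :
    DifferentiableAt ℝ (tensorForm g f V W) y :=
  DifferentiableAt.clm_apply (c := fun z =>
      ContinuousLinearMap.smulRightL ℝ (Euc n) (Euc n →L[ℝ] ℝ) (g z (V z)))
    ((ContinuousLinearMap.smulRightL ℝ (Euc n) (Euc n →L[ℝ] ℝ)).differentiableAt.comp y
      ((h.diff_metric hy).clm_apply hV))
    (hf.fun_smul ((h.diff_metric hy).clm_apply hW))

theorem corrDeriv_tensorForm {f : Euc n → ℝ} {V W : Euc n → Euc n} (hy : y ∈ U)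
    (hf : DifferentiableAt ℝ f y) (hV : DifferentiableAt ℝ V y) (hW : DifferentiableAt ℝ W y)
    (a b c : Euc n) :
    corrDeriv (tensorForm g f V W) y a (Γ y a) b c =
      fderiv ℝ f y a * (g y (V y) b * g y (W y) c)
      + f y * (g y (covD Γ V y a) b * g y (W y) c + g y (V y) b * g y (covD Γ W y a) c) := by
  have d : ∀ {V : Euc n → Euc n} (_ : DifferentiableAt ℝ V y) (b : Euc n),
      DifferentiableAt ℝ (fun z => g z (V z) b) y := fun hV b =>
    ((h.diff_metric hy).clm_apply hV).clm_apply (differentiableAt_const b)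
  have dd : ∀ {V : Euc n → Euc n} (_ : DifferentiableAt ℝ V y) (b : Euc n),
      fderiv ℝ (fun z => g z (V z) b) y a = g y (covD Γ V y a) b + g y (V y) (Γ y a b) := by
    intro V hV b
    rw [fderiv_apply_two (h.diff_metric hy) hV (differentiableAt_const b), h.compat y hy,
      covD_apply]
    simp
    ring
  rw [corrDeriv, ← fderiv_const_two (h.diff_tensorForm hy hf hV hW)]
  simp only [tensorForm_apply]
  rw [fderiv_fun_mul hf ((d hV b).fun_mul (d hW c)), fderiv_fun_mul (d hV b) (d hW c)]
  simp only [add_apply, smul_apply, smul_eq_mul, dd hV, dd hW]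
  ring

/-- Leibniz rule ∇·(f V⊗W) = div(fV) W + f ∇_V W; the divergence contracts the first slot, so `V` is
the direction of differentiation. -/
theorem divForm_tensorForm {f : Euc n → ℝ} {V W : Euc n → Euc n} (hy : y ∈ U)
    (hf : DifferentiableAt ℝ f y) (hV : DifferentiableAt ℝ V y) (hW : DifferentiableAt ℝ W y)
    (c : Euc n) :
    divForm g Γ (tensorForm g f V W) y c =
      (fderiv ℝ f y (V y) + f y * divV Γ V y) * g y (W y) c
      + f y * g y (covD Γ W y (V y)) c := by
  have h1 := map_eq_sum_coord (fderiv ℝ f y).toLinearMap (V y)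
  have h2 := map_eq_sum_coord (((g y).flip c).comp (covD Γ W y)).toLinearMap (V y)
  simp only [ContinuousLinearMap.coe_coe, smul_eq_mul, ContinuousLinearMap.comp_apply,
    ContinuousLinearMap.flip_apply] at h1 h2
  simp only [divForm, h.corrDeriv_tensorForm hy hf hV hW, h.inner_dualVec' hy, h1, h2, divV]
  simp only [Finset.mul_sum, Finset.sum_mul, ← Finset.sum_add_distrib, add_mul]
  exact Finset.sum_congr rfl fun i _ => by ring

theorem inner_gradVec (hy : y ∈ U) (p : Euc n → Euc k) (a : Fin k) (v : Euc n) :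
    g y (gradVec g p a y) v = (fderiv ℝ p y v) a := by
  have h1 := congrArg (fun w : Euc k => w a) (map_eq_sum_coord (fderiv ℝ p y).toLinearMap v)
  simp only [ContinuousLinearMap.coe_coe, WithLp.ofLp_sum, Finset.sum_apply, PiLp.smul_apply,
    smul_eq_mul] at h1
  simp [gradVec, h.inner_dualVec hy, h1, mul_comm]

theorem isHor_gradVec (hy : y ∈ U) (p : Euc n → Euc k) (a : Fin k) :
    IsHor g p y (gradVec g p a y) := fun v hv => by
  rw [h.symm y hy, h.inner_gradVec hy, hv]; simp

theorem smooth_gradVec {p : Euc n → Euc k} (hp : ContDiffOn ℝ ∞ p U) (a : Fin k) :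
    ContDiffOn ℝ ∞ (gradVec g p a) U := by
  unfold gradVec
  refine ContDiffOn.sum fun i _ => ContDiffOn.fun_smul ?_ (h.smooth_dualVec i)
  exact (EuclideanSpace.proj (𝕜 := ℝ) a).contDiff.comp_contDiffOn
    ((ContDiffOn.fderivOn h.isOpen hp).clm_apply contDiffOn_const)

/-- Gradients of functions invariant under a Killing field are invariant. -/
theorem lie_gradVec {p : Euc n → Euc k} (hp : ContDiffOn ℝ ∞ p U) {Y : Euc n → Euc n}
    (hY : IsKillingOn U g Y) (hpY : ∀ z ∈ U, fderiv ℝ p z (Y z) = 0) (hy : y ∈ U) (a : Fin k) :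
    fderiv ℝ (gradVec g p a) y (Y y) = fderiv ℝ Y y (gradVec g p a y) := by
  have dg := ContDiffOn.diffAt h.isOpen (h.smooth_gradVec hp a) hy
  have dDp : DifferentiableAt ℝ (fderiv ℝ p) y :=
    ContDiffOn.diffAt h.isOpen (ContDiffOn.fderivOn h.isOpen hp) hy
  refine h.eq_of_inner hy fun v => ?_
  have h1 := congrArg (fun L => L (Y y))
    (fderiv_eq_of_eqOn h.isOpen (fun z hz => h.inner_gradVec hz p a v) hy)
  have h2 : fderiv ℝ (fun z => (fderiv ℝ p z v) a) y (Y y) =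
      (fderiv ℝ (fderiv ℝ p) y (Y y) v) a := by
    rw [← fderiv_const_one dDp]
    have hc : HasFDerivAt (fun z => (fderiv ℝ p z v) a)
        ((EuclideanSpace.proj (𝕜 := ℝ) a).comp (fderiv ℝ (fun z => fderiv ℝ p z v) y)) y :=
      (EuclideanSpace.proj (𝕜 := ℝ) a).hasFDerivAt.comp y
        (dDp.clm_apply (differentiableAt_const v)).hasFDerivAt
    rw [hc.fderiv]
    simp
  -- Differentiating dp(Y) = 0 in the direction `v` expresses D²p(Y,v) as -dp(DY(v)), the term that
  -- matches the Lie derivative of `g`.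
  have h3 := congrArg (fun L => L v) (fderiv_eq_of_eqOn h.isOpen hpY hy)
  rw [fderiv_apply_one dDp (ContDiffOn.diffAt h.isOpen hY.smooth hy),
    ContDiffOn.fderiv_fderiv_comm h.isOpen hp hy] at h3
  have h4 := congrArg (fun w : Euc k => w a) h3
  simp only [fderiv_fun_const, Pi.zero_apply, zero_apply, PiLp.add_apply, PiLp.zero_apply] at h4
  rw [h2, fderiv_apply_two (h.diff_metric hy) dg (differentiableAt_const v)] at h1
  have h5 := hY.lie_metric y hy (gradVec g p a y) v
  rw [h.inner_gradVec hy] at h5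
  simp only [fderiv_fun_const, Pi.zero_apply, zero_apply, map_zero, add_zero] at h1
  linarith

section Horizontal

variable {p : Euc n → Euc k} (hs : ∀ z ∈ U, Function.Surjective (fderiv ℝ p z))
  (hn : ∀ z ∈ U, ∀ w, IsHor g p z w → fderiv ℝ p z w = 0 → w = 0)
include hs hn

/-- A combination of gradients orthogonal to all of them is horizontal and killed by dp, hence zero
by `hn`. Surjectivity of dp shows that the gradients are independent. -/
theorem isUnit_gram (hy : y ∈ U) :
    IsUnit (Matrix.of fun a b => g y (gradVec g p a y) (gradVec g p b y)).det := by
  rw [isUnit_iff_ne_zero]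
  intro h0
  obtain ⟨c, hc, hc0⟩ := Matrix.exists_vecMul_eq_zero_iff.mpr h0
  have hw : ∑ a, c a • gradVec g p a y = 0 := by
    refine hn y hy _ (fun v hv => ?_) ?_
    · simp [h.isHor_gradVec hy p _ v hv]
    · ext b
      rw [← h.inner_gradVec hy, h.symm y hy]
      simpa [Matrix.vecMul, dotProduct] using congrFun hc0 b
  -- Pairing the vanishing combination with a lift of its own coefficient vector yields the sum of
  -- the squares of the coefficients.
  obtain ⟨v, hv⟩ := hs y hy (WithLp.toLp 2 c)
  have h1 := congrArg (fun w => g y w v) hw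
  simp only [map_sum, map_smul, sum_apply, smul_apply, smul_eq_mul, h.inner_gradVec hy, hv,
    map_zero, zero_apply] at h1
  have h2 := (Finset.sum_eq_zero_iff_of_nonneg fun a _ => mul_self_nonneg (c a)).mp h1
  exact hc (funext fun a => mul_self_eq_zero.mp (h2 a (Finset.mem_univ a)))

/-- The gradients form a smooth frame of the horizontal spaces. The coefficients come from the
inverse Gram matrix; the remainder is horizontal and killed by dp, hence zero. -/
theorem exists_gradVec_coeff {V : Euc n → Euc n} (hp : ContDiffOn ℝ ∞ p U)
    (hV : ContDiffOn ℝ ∞ V U) :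
    ∃ c : Fin k → Euc n → ℝ, (∀ a, ContDiffOn ℝ ∞ (c a) U) ∧
      ∀ z ∈ U, IsHor g p z (V z) → V z = ∑ a, c a z • gradVec g p a z := by
  refine ⟨fun a z => ∑ b, (Matrix.of fun a b => g z (gradVec g p a z) (gradVec g p b z))⁻¹ a b *
    g z (V z) (gradVec g p b z), fun a => ?_, fun z hz hVz => ?_⟩
  · have sg := fun b => h.smooth_gradVec hp b
    refine ContDiffOn.sum fun b _ => ContDiffOn.mul ?_
      ((h.smooth.clm_apply hV).clm_apply (sg b))
    exact contDiffOn_matrix_inv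
      (fun z => Matrix.of fun a b => g z (gradVec g p a z) (gradVec g p b z))
      (fun a b => (h.smooth.clm_apply (sg a)).clm_apply (sg b))
      (fun z hz => h.isUnit_gram hs hn hz) a b
  · rw [← sub_eq_zero]
    refine hn z hz _ (fun v hv => ?_) ?_
    · simp [hVz v hv, h.isHor_gradVec hz p _ v hv]
    · ext b
      rw [← h.inner_gradVec hz]
      have h1 := congrArg (fun M => ∑ d, M b d * g z (V z) (gradVec g p d z))
        (Matrix.mul_nonsing_inv _ (h.isUnit_gram hs hn hz))
      simp only [Matrix.mul_apply, Matrix.of_apply, Matrix.one_apply, ite_mul, one_mul, zero_mul,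
        Finset.sum_ite_eq, Finset.mem_univ, if_true, Finset.sum_mul] at h1
      rw [Finset.sum_comm] at h1
      simp only [map_sub, map_sum, map_smul, smul_eq_mul, PiLp.zero_apply]
      rw [h.symm z hz, ← h1, sub_eq_zero]
      refine Finset.sum_congr rfl fun a _ => ?_
      rw [Finset.sum_mul]
      exact Finset.sum_congr rfl fun d _ => by ring

end Horizontal

end IsLeviCivitaOn

end

/-! ### Pluperfect fluids in coordinates -/

/-- A pluperfect fluid on the coordinate domain `U`; `p` is the coordinate expression of the
projection. -/
structure IsLocalFluid {n k : ℕ} (U : Set (Euc n)) (g : Euc n → Euc n →L[ℝ] Euc n →L[ℝ] ℝ)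
    (Γ : Euc n → Euc n →L[ℝ] Euc n →L[ℝ] Euc n) (Y X₀ : Euc n → Euc n) (p : Euc n → Euc k)
    (μ e : Euc n → ℝ) : Prop where
  conn : IsLeviCivitaOn U g Γ
  killing : IsKillingOn U g Y
  unit_killing : ∀ y ∈ U, g y (Y y) (Y y) = -1
  smooth_field : ContDiffOn ℝ ∞ X₀ U
  unit_field : ∀ y ∈ U, g y (X₀ y) (X₀ y) = -1
  smooth_proj : ContDiffOn ℝ ∞ p U
  proj_killing : ∀ y ∈ U, fderiv ℝ p y (Y y) = 0
  proj_surjective : ∀ y ∈ U, Function.Surjective (fderiv ℝ p y)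
  hor_nondegenerate : ∀ y ∈ U, ∀ w, IsHor g p y w → fderiv ℝ p y w = 0 → w = 0
  hor_field : ∀ y ∈ U, IsHor g p y (X₀ y)
  eigenvector : ∀ y ∈ U, ∀ u, IsHor g p y u →
    einsteinForm g Γ y u (X₀ y) = - μ y * g y u (X₀ y)
  eigenspace : ∀ y ∈ U, ∀ w, IsHor g p y w →
    (∀ u, IsHor g p y u → einsteinForm g Γ y u w = - μ y * g y u w) → ∃ t : ℝ, w = t • X₀ y
  pos : ∀ y ∈ U, 0 < μ y
  charge_eq : ∀ y ∈ U, e y = einsteinForm g Γ y (X₀ y) (Y y)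
  perfect : ∀ y ∈ U, ∀ u, einsteinForm g Γ y u (Y y) =
    - e y * g y u (X₀ y) - einsteinForm g Γ y (Y y) (Y y) * g y u (Y y)
  div_pressure : ∀ y ∈ U, ∀ c, divForm g Γ (fun z => einsteinForm g Γ z -
    planeForm g μ e (fun z => einsteinForm g Γ z (Y z) (Y z)) X₀ Y z) y c = 0

namespace IsLocalFluid

variable {n k : ℕ} {U : Set (Euc n)} {g : Euc n → Euc n →L[ℝ] Euc n →L[ℝ] ℝ}
  {Γ : Euc n → Euc n →L[ℝ] Euc n →L[ℝ] Euc n} {Y X₀ : Euc n → Euc n} {p : Euc n → Euc k}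
  {μ e : Euc n → ℝ} (hF : IsLocalFluid U g Γ Y X₀ p μ e) {y : Euc n}
include hF

theorem density_eq (hy : y ∈ U) : μ y = einsteinForm g Γ y (X₀ y) (X₀ y) := by
  rw [hF.eigenvector y hy _ (hF.hor_field y hy), hF.unit_field y hy]; ring

theorem inner_field_killing (hy : y ∈ U) : g y (X₀ y) (Y y) = 0 := by
  rw [hF.conn.symm y hy]; exact hF.hor_field y hy _ (hF.proj_killing y hy)

/-- The eigenvalue is only given pointwise; its expression as G(X₀,X₀) makes it smooth. -/
theorem smooth_density : ContDiffOn ℝ ∞ μ U :=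
  ((hF.conn.smooth_einsteinForm.clm_apply hF.smooth_field).clm_apply hF.smooth_field).congr
    fun _ hy => hF.density_eq hy

theorem smooth_charge : ContDiffOn ℝ ∞ e U :=
  ((hF.conn.smooth_einsteinForm.clm_apply hF.smooth_field).clm_apply hF.killing.smooth).congr
    fun _ hy => hF.charge_eq _ hy

theorem diff_density (hy : y ∈ U) : DifferentiableAt ℝ μ y :=
  ContDiffOn.diffAt hF.conn.isOpen hF.smooth_density hy

theorem diff_charge (hy : y ∈ U) : DifferentiableAt ℝ e y :=
  ContDiffOn.diffAt hF.conn.isOpen hF.smooth_charge hy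

theorem diff_field (hy : y ∈ U) : DifferentiableAt ℝ X₀ y :=
  ContDiffOn.diffAt hF.conn.isOpen hF.smooth_field hy

theorem diff_killing (hy : y ∈ U) : DifferentiableAt ℝ Y y :=
  ContDiffOn.diffAt hF.conn.isOpen hF.killing.smooth hy

theorem diff_einstein (hy : y ∈ U) : DifferentiableAt ℝ (einsteinForm g Γ) y :=
  ContDiffOn.diffAt hF.conn.isOpen hF.conn.smooth_einsteinForm hy

/-- The density and the apparent field of the fluid are invariant under the Killing field. -/
theorem lie_field_and_density (hy : y ∈ U) :
    fderiv ℝ X₀ y (Y y) = fderiv ℝ Y y (X₀ y) ∧ fderiv ℝ μ y (Y y) = 0 := by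
  have h := hF.conn
  obtain ⟨c, hc, hsum⟩ := h.exists_gradVec_coeff hF.proj_surjective hF.hor_nondegenerate
    hF.smooth_proj hF.smooth_field
  have hX : ∀ z ∈ U, X₀ z = ∑ a, c a z • gradVec g p a z := fun z hz =>
    hsum z hz (hF.hor_field z hz)
  have dX := hF.diff_field hy
  have dY := hF.diff_killing hy
  have du : ∀ a, DifferentiableAt ℝ (gradVec g p a) y := fun a =>
    ContDiffOn.diffAt h.isOpen (h.smooth_gradVec hF.smooth_proj a) hy
  have dc : ∀ a, DifferentiableAt ℝ (c a) y := fun a => ContDiffOn.diffAt h.isOpen (hc a) hy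
  have lu := h.lie_gradVec hF.smooth_proj hF.killing hF.proj_killing hy
  set Z := fderiv ℝ X₀ y (Y y) - fderiv ℝ Y y (X₀ y) with hZ
  -- The gradients are invariant under Y, so only their coefficients are differentiated; in
  -- particular Z = [Y,X₀] is horizontal.
  have hZsum : Z = ∑ a, fderiv ℝ (c a) y (Y y) • gradVec g p a y := by
    rw [hZ, fderiv_eq_of_eqOn h.isOpen hX hy, hX y hy,
      fderiv_fun_sum fun a _ => (dc a).fun_smul (du a), sum_apply, map_sum,
      ← Finset.sum_sub_distrib]
    refine Finset.sum_congr rfl fun a _ => ?_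
    rw [fderiv_fun_smul (dc a) (du a)]
    simp [lu]
  have hZhor : IsHor g p y Z := fun v hv => by
    rw [hZsum]
    simp [h.isHor_gradVec hy p _ v hv]
  have hGsymm := h.einsteinForm_symm hy
  have lG := h.lie_einsteinForm hF.killing hy
  -- The eigenvector equation, tested against the invariant gradients and differentiated along Y.
  have heq : ∀ a, einsteinForm g Γ y (gradVec g p a y) Z =
      - μ y * g y (gradVec g p a y) Z
        - fderiv ℝ μ y (Y y) * g y (gradVec g p a y) (X₀ y) := fun a => by
    have h1 := congrArg (fun L => L (Y y)) (fderiv_eq_of_eqOn h.isOpen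
      (fun z hz => hF.eigenvector z hz _ (h.isHor_gradVec hz p a)) hy)
    have dm := ((h.diff_metric hy).clm_apply (du a)).clm_apply dX
    rw [fderiv_of_lie_eq_zero (hF.diff_einstein hy) (du a) dX lG,
      fderiv_fun_mul (hF.diff_density hy).fun_neg dm] at h1
    simp only [add_apply, smul_apply, smul_eq_mul, fderiv_fun_neg, neg_apply] at h1
    rw [fderiv_of_lie_eq_zero (h.diff_metric hy) (du a) dX (hF.killing.corrDeriv_metric hy),
      lu, sub_self] at h1
    simp only [map_zero, zero_apply, zero_add] at h1
    rw [← hZ] at h1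
    linarith
  have hXsum : ∀ T : Euc n →L[ℝ] Euc n →L[ℝ] ℝ, ∀ v,
      T (X₀ y) v = ∑ a, c a y * T (gradVec g p a y) v := fun T v => by
    rw [hX y hy]; simp
  -- Testing `heq` against X₀ and comparing, through the symmetry of G, with the eigenvector
  -- equation tested against Z isolates Y(μ).
  have hμ : fderiv ℝ μ y (Y y) = 0 := by
    have h1 : einsteinForm g Γ y (X₀ y) Z =
        - μ y * g y (X₀ y) Z - fderiv ℝ μ y (Y y) * g y (X₀ y) (X₀ y) := by
      rw [hXsum, hXsum (g y) Z, hXsum (g y) (X₀ y), Finset.mul_sum, Finset.mul_sum,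
        ← Finset.sum_sub_distrib]
      exact Finset.sum_congr rfl fun a _ => by rw [heq]; ring
    have h2 := hF.eigenvector y hy Z hZhor
    rw [hGsymm, h1, hF.unit_field y hy, h.symm y hy Z] at h2
    linarith
  refine ⟨?_, hμ⟩
  -- With Y(μ) = 0, `heq` says that Z satisfies the eigenvector equation against gradients, and
  -- these span the horizontal space.
  obtain ⟨t, ht⟩ := hF.eigenspace y hy Z hZhor fun u hu => by
    obtain ⟨d, -, hd⟩ := h.exists_gradVec_coeff hF.proj_surjective hF.hor_nondegenerate
      hF.smooth_proj (contDiffOn_const (c := u))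
    have hu' := hd y hy hu
    rw [hu']
    simp only [map_sum, map_smul, sum_apply, smul_apply, smul_eq_mul, heq, hμ, Finset.mul_sum]
    exact Finset.sum_congr rfl fun a _ => by ring
  -- The square of X₀ is constant, so Z is orthogonal to X₀; being a multiple of X₀, it vanishes.
  have h3 : g y Z (X₀ y) = 0 := by
    have h1 := congrArg (fun L => L (Y y)) (fderiv_eq_of_eqOn h.isOpen hF.unit_field hy)
    rw [fderiv_of_lie_eq_zero (h.diff_metric hy) dX dX (hF.killing.corrDeriv_metric hy),
      ← hZ, h.symm y hy (X₀ y)] at h1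
    simp only [fderiv_fun_const, Pi.zero_apply, zero_apply] at h1
    linarith
  rw [ht] at h3
  simp only [map_smul, smul_apply, smul_eq_mul, hF.unit_field y hy] at h3
  have ht0 : t = 0 := by linarith
  rw [ht0, zero_smul, hZ] at ht
  exact sub_eq_zero.mp ht

theorem lie_field (hy : y ∈ U) : fderiv ℝ X₀ y (Y y) = fderiv ℝ Y y (X₀ y) :=
  (hF.lie_field_and_density hy).1

theorem fderiv_density_killing (hy : y ∈ U) : fderiv ℝ μ y (Y y) = 0 :=
  (hF.lie_field_and_density hy).2

theorem fderiv_charge_killing (hy : y ∈ U) : fderiv ℝ e y (Y y) = 0 := by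
  rw [fderiv_eq_of_eqOn hF.conn.isOpen hF.charge_eq hy,
    fderiv_of_lie_eq_zero (hF.diff_einstein hy) (hF.diff_field hy) (hF.diff_killing hy)
      (hF.conn.lie_einsteinForm hF.killing hy), hF.lie_field hy]
  simp

theorem fderiv_einstein_killing (hy : y ∈ U) :
    fderiv ℝ (fun z => einsteinForm g Γ z (Y z) (Y z)) y (Y y) = 0 := by
  rw [fderiv_of_lie_eq_zero (hF.diff_einstein hy) (hF.diff_killing hy) (hF.diff_killing hy)
      (hF.conn.lie_einsteinForm hF.killing hy)]
  simp

theorem covD_comm (hy : y ∈ U) : covD Γ X₀ y (Y y) = covD Γ Y y (X₀ y) := by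
  rw [covD_apply, covD_apply, hF.lie_field hy, hF.conn.torsion_free y hy]

theorem divV_killing (hy : y ∈ U) : divV Γ Y y = 0 :=
  hF.conn.sum_covD_killing hF.killing hy

theorem covD_killing_self (hy : y ∈ U) : covD Γ Y y (Y y) = 0 :=
  hF.conn.covD_killing_self hF.killing hF.unit_killing hy

theorem inner_covD_field (hy : y ∈ U) (a : Euc n) : g y (covD Γ X₀ y a) (X₀ y) = 0 := by
  have h1 := congrArg (fun L => L a) (fderiv_eq_of_eqOn hF.conn.isOpen hF.unit_field hy)
  have dX := hF.diff_field hy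
  simp only [fderiv_apply_two (hF.conn.diff_metric hy) dX dX, hF.conn.compat y hy,
    fderiv_fun_const, Pi.zero_apply, zero_apply] at h1
  rw [hF.conn.symm y hy (X₀ y), hF.conn.symm y hy (X₀ y) (fderiv ℝ X₀ y a)] at h1
  simp only [covD_apply, map_add, add_apply]
  linarith

/-- Differentiating g(X₀,Y) = 0 along X₀ leaves -g(X₀, ∇_{X₀}Y), which is zero by the Killing
equation. -/
theorem inner_covD_field_killing (hy : y ∈ U) :
    g y (covD Γ X₀ y (X₀ y)) (Y y) = 0 := by
  have h1 := congrArg (fun L => L (X₀ y))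
    (fderiv_eq_of_eqOn hF.conn.isOpen (fun z hz => hF.inner_field_killing hz) hy)
  have h2 := hF.conn.covD_skew hF.killing hy (X₀ y) (X₀ y)
  simp only [fderiv_apply_two (hF.conn.diff_metric hy) (hF.diff_field hy) (hF.diff_killing hy),
    hF.conn.compat y hy, fderiv_fun_const, Pi.zero_apply, zero_apply] at h1
  rw [hF.conn.symm y hy (X₀ y), hF.conn.symm y hy (X₀ y) (fderiv ℝ Y y (X₀ y))] at h1
  simp only [covD_apply, map_add, add_apply] at h2 ⊢
  linarith

/-- The divergence of G|_T, zero because those of G and P are. The Y⊗Y term contributes nothing, and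
the two mixed terms each give e ∇_{X₀}Y because [Y,X₀] = 0. -/
theorem balance (hy : y ∈ U) (c : Euc n) :
    (fderiv ℝ μ y (X₀ y) + μ y * divV Γ X₀ y) * g y (X₀ y) c
      + μ y * g y (covD Γ X₀ y (X₀ y)) c
      + (fderiv ℝ e y (X₀ y) + e y * divV Γ X₀ y) * g y (Y y) c
      + 2 * e y * g y (covD Γ Y y (X₀ y)) c = 0 := by
  have h := hF.conn
  have dX := hF.diff_field hy
  have dY := hF.diff_killing hy
  have dc : DifferentiableAt ℝ (fun z => einsteinForm g Γ z (Y z) (Y z)) y :=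
    ((hF.diff_einstein hy).clm_apply dY).clm_apply dY
  have t1 := h.diff_tensorForm hy (hF.diff_density hy) dX dX
  have t2 := h.diff_tensorForm hy (hF.diff_charge hy) dX dY
  have t3 := h.diff_tensorForm hy (hF.diff_charge hy) dY dX
  have t4 := h.diff_tensorForm hy dc dY dY
  have h1 := hF.div_pressure y hy c
  unfold planeForm at h1
  rw [divForm_sub (hF.diff_einstein hy) (((t1.fun_add t2).fun_add t3).fun_add t4),
    divForm_add ((t1.fun_add t2).fun_add t3) t4, divForm_add (t1.fun_add t2) t3,
    divForm_add t1 t2,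
    h.divForm_einsteinForm hy,
    h.divForm_tensorForm hy (hF.diff_density hy) dX dX,
    h.divForm_tensorForm hy (hF.diff_charge hy) dX dY,
    h.divForm_tensorForm hy (hF.diff_charge hy) dY dX,
    h.divForm_tensorForm hy dc dY dY, hF.divV_killing hy, hF.covD_killing_self hy,
    hF.covD_comm hy, hF.fderiv_charge_killing hy, hF.fderiv_einstein_killing hy] at h1
  simp only [map_zero, zero_apply] at h1
  linarith

/-- The Y-component of `balance`: every other vector in it is orthogonal to Y. -/
theorem charge_conservation (hy : y ∈ U) : fderiv ℝ e y (X₀ y) + e y * divV Γ X₀ y = 0 := by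
  have h1 := hF.balance hy (Y y)
  rw [hF.inner_field_killing hy, hF.inner_covD_field_killing hy, hF.unit_killing y hy,
    hF.conn.inner_covD_killing hF.killing hF.unit_killing hy] at h1
  linarith

/-- The X₀-component of `balance`: both covariant derivatives are orthogonal to X₀. -/
theorem density_conservation (hy : y ∈ U) : fderiv ℝ μ y (X₀ y) + μ y * divV Γ X₀ y = 0 := by
  have h1 := hF.balance hy (X₀ y)
  have h2 := hF.conn.covD_skew hF.killing hy (X₀ y) (X₀ y)
  rw [hF.charge_conservation hy, hF.unit_field y hy, hF.inner_covD_field hy] at h1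
  linear_combination -h1 + e y * h2

theorem equation_of_motion (hy : y ∈ U) :
    μ y • covD Γ X₀ y (X₀ y) = (-2 * e y) • covD Γ Y y (X₀ y) := by
  refine hF.conn.eq_of_inner hy fun c => ?_
  have h1 := hF.balance hy c
  rw [hF.density_conservation hy, hF.charge_conservation hy] at h1
  simp only [map_smul, smul_apply, smul_eq_mul]
  linarith

theorem diff_ratio (hy : y ∈ U) : DifferentiableAt ℝ (fun z => e z / μ z) y :=
  ContDiffOn.diffAt hF.conn.isOpen
    (hF.smooth_charge.div hF.smooth_density fun z hz => (hF.pos z hz).ne') hy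

/-- Product rule for e = (e/μ) μ. -/
theorem fderiv_charge (hy : y ∈ U) (v : Euc n) :
    fderiv ℝ e y v = e y / μ y * fderiv ℝ μ y v + μ y * fderiv ℝ (fun z => e z / μ z) y v := by
  rw [fderiv_eq_of_eqOn hF.conn.isOpen (h := fun z => e z / μ z * μ z)
      (fun z hz => (div_mul_cancel₀ _ (hF.pos z hz).ne').symm) hy,
    fderiv_fun_mul (hF.diff_ratio hy) (hF.diff_density hy)]
  simp

theorem fderiv_ratio_field (hy : y ∈ U) : fderiv ℝ (fun z => e z / μ z) y (X₀ y) = 0 := by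
  have hμ := (hF.pos y hy).ne'
  have h1 := hF.charge_conservation hy
  have h2 := hF.density_conservation hy
  have h3 := hF.fderiv_charge hy (X₀ y)
  have h4 : e y / μ y * μ y = e y := div_mul_cancel₀ _ hμ
  refine (mul_eq_zero.mp ?_).resolve_left hμ
  -- The charge law minus e/μ times the density law leaves μ X₀(e/μ).
  linear_combination h1 - h3 - e y / μ y * h2 + divV Γ X₀ y * h4

theorem fderiv_ratio_killing (hy : y ∈ U) : fderiv ℝ (fun z => e z / μ z) y (Y y) = 0 := by
  have h3 := hF.fderiv_charge hy (Y y)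
  rw [hF.fderiv_charge_killing hy, hF.fderiv_density_killing hy] at h3
  refine (mul_eq_zero.mp ?_).resolve_left (hF.pos y hy).ne'
  linarith

theorem diff_fluid (hy : y ∈ U) :
    DifferentiableAt ℝ (fun z => X₀ z + (e z / μ z) • Y z) y :=
  (hF.diff_field hy).fun_add ((hF.diff_ratio hy).fun_smul (hF.diff_killing hy))

/-- The added field (e/μ) Y is divergence free, since div Y = 0 and e/μ is constant along Y. -/
theorem divV_fluid (hy : y ∈ U) :
    divV Γ (fun z => X₀ z + (e z / μ z) • Y z) y = divV Γ X₀ y := by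
  rw [divV_add (hF.diff_field hy) ((hF.diff_ratio hy).fun_smul (hF.diff_killing hy)),
    divV_smul (hF.diff_ratio hy) (hF.diff_killing hy), hF.divV_killing hy,
    hF.fderiv_ratio_killing hy]
  ring

theorem divV_density_field (hy : y ∈ U) : divV Γ (fun z => μ z • X₀ z) y = 0 := by
  rw [divV_smul (hF.diff_density hy) (hF.diff_field hy), hF.density_conservation hy]

theorem divV_charge_field (hy : y ∈ U) : divV Γ (fun z => e z • X₀ z) y = 0 := by
  rw [divV_smul (hF.diff_charge hy) (hF.diff_field hy), hF.charge_conservation hy]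

theorem divV_density_fluid (hy : y ∈ U) :
    divV Γ (fun z => μ z • (X₀ z + (e z / μ z) • Y z)) y = 0 := by
  rw [divV_smul (hF.diff_density hy) (hF.diff_fluid hy), hF.divV_fluid hy]
  simp [hF.fderiv_density_killing hy, hF.density_conservation hy]

theorem divV_charge_fluid (hy : y ∈ U) :
    divV Γ (fun z => e z • (X₀ z + (e z / μ z) • Y z)) y = 0 := by
  rw [divV_smul (hF.diff_charge hy) (hF.diff_fluid hy), hF.divV_fluid hy]
  simp [hF.fderiv_charge_killing hy, hF.charge_conservation hy]

theorem fderiv_ratio_fluid (hy : y ∈ U) :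
    fderiv ℝ (fun z => e z / μ z) y (X₀ y + (e y / μ y) • Y y) = 0 := by
  simp [hF.fderiv_ratio_field hy, hF.fderiv_ratio_killing hy]

/-- With f = e/μ constant along X, ∇_X X = ∇_{X₀}X₀ + 2f ∇_{X₀}Y + f² ∇_Y Y. The last term is zero
and the first two cancel by `equation_of_motion`. -/
theorem covD_fluid_self (hy : y ∈ U) :
    covD Γ (fun z => X₀ z + (e z / μ z) • Y z) y (X₀ y + (e y / μ y) • Y y) = 0 := by
  have hμ := (hF.pos y hy).ne'
  rw [covD_add (hF.diff_field hy) ((hF.diff_ratio hy).fun_smul (hF.diff_killing hy)),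
    covD_smul (hF.diff_ratio hy) (hF.diff_killing hy), hF.fderiv_ratio_fluid hy, map_add,
    map_add, map_smul, map_smul, hF.covD_killing_self hy, hF.covD_comm hy]
  have h1 := hF.equation_of_motion hy
  have h2 : covD Γ X₀ y (X₀ y) = (-2 * (e y / μ y)) • covD Γ Y y (X₀ y) := by
    have := congrArg (fun v => (μ y)⁻¹ • v) h1
    simp only [smul_smul, inv_mul_cancel₀ hμ, one_smul] at this
    rw [this]
    congr 1
    field_simp
  rw [h2]
  module

theorem fieldForm_field (u : Euc n) (hy : y ∈ U) :
    e y * fieldForm g Γ Y y u (X₀ y) = μ y * g y u (covD Γ X₀ y (X₀ y)) := by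
  have h1 := congrArg (fun v => g y u v) (hF.equation_of_motion hy)
  have h2 := hF.conn.covD_skew hF.killing hy u (X₀ y)
  simp only [map_smul, smul_eq_mul] at h1
  rw [h1, fieldForm_apply, hF.conn.symm y hy u]
  linear_combination 2 * e y * h2

/-- Start from ∇·F = -2 Ric(Y,·). Perfectness gives -G(Y,·) = e X₀^♭ + G(Y,Y) Y^♭. As g(Y,Y) = -1,
G(Y,Y) = 2 Ric(Y,Y) + S; the scalar curvature cancels and 2 Ric(Y,Y) = |F|/2. -/
theorem divForm_fieldForm (hy : y ∈ U) (c : Euc n) :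
    divForm g Γ (fieldForm g Γ Y) y c = e y * g y (X₀ y) c +
      (1 / 2 * ∑ i, ∑ j, fieldForm g Γ Y y (stdVec i) (stdVec j) *
        fieldForm g Γ Y y (dualVec g i y) (dualVec g j y)) * g y (Y y) c := by
  have h := hF.conn
  rw [h.divForm_fieldForm hF.killing hy,
    h.contraction_fieldForm hF.killing hF.unit_killing hy, h.ricciForm_symm hy]
  have h1 := hF.perfect y hy c
  rw [h.symm y hy c, h.symm y hy c] at h1
  simp only [einsteinForm, sub_apply, smul_apply, smul_eq_mul, hF.unit_killing y hy] at h1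
  rw [h.symm y hy c] at h1
  linear_combination -h1

end IsLocalFluid

/-! ### Component formulas translated into invariant ones -/

/-- The form field with given component matrix. -/
def formOf {n : ℕ} (A : Euc n → Matrix (Fin n) (Fin n) ℝ) (y : Euc n) :
    Euc n →L[ℝ] Euc n →L[ℝ] ℝ :=
  ∑ i, ∑ j, (EuclideanSpace.proj i : Euc n →L[ℝ] ℝ).smulRight
    (A y i j • (EuclideanSpace.proj j : Euc n →L[ℝ] ℝ))

/-- The Christoffel symbols of a matrix field, as a bilinear map. -/
def connOf {n : ℕ} (A : Euc n → Matrix (Fin n) (Fin n) ℝ) (y : Euc n) :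
    Euc n →L[ℝ] Euc n →L[ℝ] Euc n :=
  ∑ i, ∑ j, (EuclideanSpace.proj i : Euc n →L[ℝ] ℝ).smulRight
    ((EuclideanSpace.proj j : Euc n →L[ℝ] ℝ).smulRight
      (WithLp.toLp 2 fun k => christoffel A k i j y : Euc n))

/-- The vector field with given components. -/
def vecOf {n : ℕ} (V : Euc n → Fin n → ℝ) (y : Euc n) : Euc n := WithLp.toLp 2 (V y)

section

variable {n : ℕ} {U : Set (Euc n)} {A : Euc n → Matrix (Fin n) (Fin n) ℝ} {y : Euc n}

theorem formOf_apply (y a b : Euc n) : formOf A y a b = ∑ i, ∑ j, a i * b j * A y i j := by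
  simp only [formOf, sum_apply, ContinuousLinearMap.smulRight_apply, smul_apply,
    PiLp.proj_apply, smul_eq_mul]
  exact Finset.sum_congr rfl fun i _ => Finset.sum_congr rfl fun j _ => by ring

theorem formOf_stdVec (y : Euc n) (i j : Fin n) : formOf A y (stdVec i) (stdVec j) = A y i j := by
  simp [formOf_apply]

theorem connOf_apply (y a b : Euc n) :
    connOf A y a b = ∑ i, ∑ j, (a i * b j) • (WithLp.toLp 2 fun k => christoffel A k i j y) := by
  simp only [connOf, sum_apply, ContinuousLinearMap.smulRight_apply, smul_apply,
    PiLp.proj_apply, smul_smul]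

theorem connOf_stdVec (y : Euc n) (i j k : Fin n) :
    (connOf A y (stdVec i) (stdVec j)) k = christoffel A k i j y := by
  simp [connOf_apply]

theorem vecOf_apply (V : Euc n → Fin n → ℝ) (y : Euc n) (i : Fin n) : vecOf V y i = V y i := rfl

theorem matrix_formOf (y : Euc n) :
    (Matrix.of fun k l => formOf A y (stdVec k) (stdVec l)) = A y := by
  ext i j; exact formOf_stdVec y i j

theorem dualVec_formOf (i : Fin n) (y : Euc n) :
    dualVec (formOf A) i y = ∑ j, (A y)⁻¹ i j • stdVec j := by
  rw [dualVec, matrix_formOf]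

theorem ext_stdVec {S T : Euc n →L[ℝ] Euc n →L[ℝ] ℝ}
    (hST : ∀ i j, S (stdVec i) (stdVec j) = T (stdVec i) (stdVec j)) : S = T := by
  ext a b
  have h1 : ∀ S : Euc n →L[ℝ] Euc n →L[ℝ] ℝ, S a b =
      ∑ i, ∑ j, a i * (b j * S (stdVec i) (stdVec j)) := fun S => by
    have e1 := map_eq_sum_coord (S.flip b).toLinearMap a
    simp only [ContinuousLinearMap.coe_coe, ContinuousLinearMap.flip_apply, smul_eq_mul] at e1
    rw [e1]
    refine Finset.sum_congr rfl fun i _ => ?_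
    have e2 := map_eq_sum_coord (S (stdVec i)).toLinearMap b
    simp only [ContinuousLinearMap.coe_coe, smul_eq_mul] at e2
    rw [e2, Finset.mul_sum]
  rw [h1 S, h1 T]
  simp only [hST]

theorem smooth_formOf (hA : ∀ i j, ContDiffOn ℝ ∞ (fun y => A y i j) U) :
    ContDiffOn ℝ ∞ (formOf A) U := by
  rw [contDiffOn_clm_apply]; intro a
  rw [contDiffOn_clm_apply]; intro b
  simp only [formOf_apply]
  exact ContDiffOn.sum fun i _ => ContDiffOn.sum fun j _ => contDiffOn_const.mul (hA i j)

theorem smooth_christoffel (hU : IsOpen U) (hA : ∀ i j, ContDiffOn ℝ ∞ (fun y => A y i j) U)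
    (hdet : ∀ y ∈ U, IsUnit (A y).det) (k i j : Fin n) :
    ContDiffOn ℝ ∞ (christoffel A k i j) U := by
  have hd : ∀ i j k, ContDiffOn ℝ ∞ (fun y => pd i (fun z => A z j k) y) U := fun i j k =>
    (ContDiffOn.fderivOn hU (hA j k)).clm_apply contDiffOn_const
  unfold christoffel
  exact contDiffOn_const.mul (ContDiffOn.sum fun l _ =>
    (contDiffOn_matrix_inv A hA hdet k l).mul (((hd i j l).add (hd j i l)).sub (hd l i j)))

theorem smooth_connOf (hU : IsOpen U) (hA : ∀ i j, ContDiffOn ℝ ∞ (fun y => A y i j) U)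
    (hdet : ∀ y ∈ U, IsUnit (A y).det) : ContDiffOn ℝ ∞ (connOf A) U := by
  rw [contDiffOn_clm_apply]; intro a
  rw [contDiffOn_clm_apply]; intro b
  simp only [connOf_apply]
  refine ContDiffOn.sum fun i _ => ContDiffOn.sum fun j _ => contDiffOn_const.fun_smul ?_
  rw [contDiffOn_euclidean]
  exact fun k => smooth_christoffel hU hA hdet k i j

theorem christoffel_symm (hU : IsOpen U) (hsymm : ∀ y ∈ U, ∀ i j, A y i j = A y j i)
    (hy : y ∈ U) (k i j : Fin n) : christoffel A k i j y = christoffel A k j i y := by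
  have : ∀ l, pd l (fun z => A z i j) y = pd l (fun z => A z j i) y := fun l => by
    rw [pd, pd, fderiv_eq_of_eqOn hU (fun z hz => hsymm z hz i j) hy]
  simp only [christoffel, this]
  congr 1
  exact Finset.sum_congr rfl fun l _ => by ring

/-- Lowering the index removes the inverse matrix and leaves the Koszul expression. -/
theorem christoffel_lower (hdet : IsUnit (A y).det) (m i j : Fin n) :
    ∑ k, A y m k * christoffel A k i j y = (1 / 2) *
      (pd i (fun z => A z j m) y + pd j (fun z => A z i m) y - pd m (fun z => A z i j) y) := by
  have h1 := congrArg (fun M => ∑ l, M m l *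
    (pd i (fun z => A z j l) y + pd j (fun z => A z i l) y - pd l (fun z => A z i j) y))
    (Matrix.mul_nonsing_inv _ hdet)
  simp only [Matrix.mul_apply, Matrix.one_apply, ite_mul, one_mul, zero_mul,
    Finset.sum_ite_eq, Finset.mem_univ, if_true, Finset.sum_mul] at h1
  rw [Finset.sum_comm] at h1
  rw [← h1, Finset.mul_sum]
  refine Finset.sum_congr rfl fun k _ => ?_
  rw [christoffel, Finset.mul_sum, Finset.mul_sum, Finset.mul_sum]
  exact Finset.sum_congr rfl fun l _ => by ring

theorem isLeviCivitaOn_formOf (hU : IsOpen U) (hA : ∀ i j, ContDiffOn ℝ ∞ (fun y => A y i j) U)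
    (hsymm : ∀ y ∈ U, ∀ i j, A y i j = A y j i) (hdet : ∀ y ∈ U, IsUnit (A y).det) :
    IsLeviCivitaOn U (formOf A) (connOf A) where
  isOpen := hU
  smooth := smooth_formOf hA
  smooth_conn := smooth_connOf hU hA hdet
  symm y hy a b := by
    rw [formOf_apply, formOf_apply, Finset.sum_comm]
    exact Finset.sum_congr rfl fun i _ => Finset.sum_congr rfl fun j _ => by
      rw [hsymm y hy]; ring
  nondeg y hy a ha := by
    have h1 : Matrix.vecMul a.ofLp (A y) = 0 := by
      ext j
      have := ha (stdVec j)
      rw [formOf_apply, Finset.sum_comm] at this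
      simp only [PiLp.single_apply, Pi.zero_apply, Matrix.vecMul, dotProduct] at this ⊢
      rw [← this, Finset.sum_comm]
      simp
    by_contra h0
    have h2 : a.ofLp ≠ 0 := fun h => h0 (by ext i; exact congrFun h i)
    exact (hdet y hy).ne_zero (Matrix.exists_vecMul_eq_zero_iff.mp ⟨_, h2, h1⟩)
  torsion_free y hy a b := by
    rw [connOf_apply, connOf_apply, Finset.sum_comm]
    refine Finset.sum_congr rfl fun i _ => Finset.sum_congr rfl fun j _ => ?_
    rw [mul_comm]
    congr 2
    ext k
    exact christoffel_symm hU hsymm hy k j i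
  compat y hy a b c := by
    have hd := ContDiffOn.diffAt hU (smooth_formOf hA) hy
    -- On basis vectors compatibility is the sum of two Koszul expressions, in which all but one
    -- derivative cancel.
    have hb : ∀ i j k, fderiv ℝ (formOf A) y (stdVec i) (stdVec j) (stdVec k) =
        formOf A y (connOf A y (stdVec i) (stdVec j)) (stdVec k) +
          formOf A y (stdVec j) (connOf A y (stdVec i) (stdVec k)) := by
      intro i j k
      rw [← fderiv_const_two hd]
      simp only [formOf_stdVec]
      have e1 : formOf A y (connOf A y (stdVec i) (stdVec j)) (stdVec k) =
          ∑ l, A y k l * christoffel A l i j y := by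
        have := map_eq_sum_coord ((formOf A y).flip (stdVec k)).toLinearMap
          (connOf A y (stdVec i) (stdVec j))
        simp only [ContinuousLinearMap.coe_coe, ContinuousLinearMap.flip_apply] at this
        rw [this]
        exact Finset.sum_congr rfl fun l _ => by
          rw [connOf_stdVec, formOf_stdVec, hsymm y hy, smul_eq_mul, mul_comm]
      have e2 : formOf A y (stdVec j) (connOf A y (stdVec i) (stdVec k)) =
          ∑ l, A y j l * christoffel A l i k y := by
        have := map_eq_sum_coord (formOf A y (stdVec j)).toLinearMap
          (connOf A y (stdVec i) (stdVec k))
        simp only [ContinuousLinearMap.coe_coe] at this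
        rw [this]
        exact Finset.sum_congr rfl fun l _ => by
          rw [connOf_stdVec, formOf_stdVec, smul_eq_mul, mul_comm]
      have hs : ∀ l i j, pd l (fun z => A z i j) y = pd l (fun z => A z j i) y := fun l i j => by
        rw [pd, pd, fderiv_eq_of_eqOn hU (fun z hz => hsymm z hz i j) hy]
      rw [e1, e2, christoffel_lower (hdet y hy), christoffel_lower (hdet y hy), hs i k j, hs j i k]
      change pd i (fun z => A z j k) y = _
      ring
    have hL : ∀ a, fderiv ℝ (formOf A) y a = (formOf A y).comp (connOf A y a) +
        ((formOf A y).flip.comp (connOf A y a)).flip := by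
      intro a
      refine ext_stdVec fun j k => ?_
      have e1 := map_eq_sum_coord (((fderiv ℝ (formOf A) y).flip (stdVec j)).flip
        (stdVec k)).toLinearMap a
      have e2 := map_eq_sum_coord (((formOf A y).flip (stdVec k)).comp
        ((connOf A y).flip (stdVec j))).toLinearMap a
      have e3 := map_eq_sum_coord ((formOf A y (stdVec j)).comp
        ((connOf A y).flip (stdVec k))).toLinearMap a
      simp only [ContinuousLinearMap.coe_coe, ContinuousLinearMap.flip_apply,
        ContinuousLinearMap.comp_apply] at e1 e2 e3
      simp only [add_apply, ContinuousLinearMap.flip_apply,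
        ContinuousLinearMap.comp_apply]
      rw [e1, e2, e3, ← Finset.sum_add_distrib]
      exact Finset.sum_congr rfl fun i _ => by rw [hb, smul_add]
    rw [hL]
    simp

theorem pd_vecOf {V : Euc n → Fin n → ℝ} (hV : DifferentiableAt ℝ (vecOf V) y) (i k : Fin n) :
    pd i (fun z => V z k) y = (fderiv ℝ (vecOf V) y (stdVec i)) k := by
  have hc : HasFDerivAt (fun z => V z k)
      ((EuclideanSpace.proj (𝕜 := ℝ) k).comp (fderiv ℝ (vecOf V) y)) y :=
    (EuclideanSpace.proj (𝕜 := ℝ) k).hasFDerivAt.comp y hV.hasFDerivAt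
  rw [pd, hc.fderiv]
  rfl

theorem covVec_eq {V : Euc n → Fin n → ℝ} (hV : DifferentiableAt ℝ (vecOf V) y) (i k : Fin n) :
    covVec A V i k y = (covD (connOf A) (vecOf V) y (stdVec i)) k := by
  have h1 := congrArg (fun w : Euc n => w k)
    (map_eq_sum_coord (connOf A y (stdVec i)).toLinearMap (vecOf V y))
  simp only [ContinuousLinearMap.coe_coe, WithLp.ofLp_sum, Finset.sum_apply, PiLp.smul_apply,
    smul_eq_mul] at h1
  rw [covVec, covD_apply, PiLp.add_apply, pd_vecOf hV, h1]
  congr 1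
  exact Finset.sum_congr rfl fun j _ => by rw [connOf_stdVec, vecOf_apply, mul_comm]

theorem divVecCoord_eq {V : Euc n → Fin n → ℝ} (hV : DifferentiableAt ℝ (vecOf V) y) :
    divVecCoord A V y = divV (connOf A) (vecOf V) y :=
  Finset.sum_congr rfl fun i _ => covVec_eq hV i i

theorem covVec_contract {V W : Euc n → Fin n → ℝ} (hW : DifferentiableAt ℝ (vecOf W) y)
    (k : Fin n) : ∑ i, V y i * covVec A W i k y =
      (covD (connOf A) (vecOf W) y (vecOf V y)) k := by
  have h1 := congrArg (fun w : Euc n => w k)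
    (map_eq_sum_coord (covD (connOf A) (vecOf W) y).toLinearMap (vecOf V y))
  simp only [ContinuousLinearMap.coe_coe, WithLp.ofLp_sum, Finset.sum_apply, PiLp.smul_apply,
    smul_eq_mul] at h1
  rw [h1]
  exact Finset.sum_congr rfl fun i _ => by rw [covVec_eq hW, vecOf_apply]

/-- The components need only agree with a differentiable form field on an open set, since the
formula depends on germs. -/
theorem covTensor_eq (hU : IsOpen U) (hy : y ∈ U) {T : Euc n → Matrix (Fin n) (Fin n) ℝ}
    {S : Euc n → Euc n →L[ℝ] Euc n →L[ℝ] ℝ} (hS : DifferentiableAt ℝ S y)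
    (hTS : ∀ z ∈ U, ∀ i j, T z i j = S z (stdVec i) (stdVec j)) (i j k : Fin n) :
    covTensor A T i j k y =
      corrDeriv S y (stdVec i) (connOf A y (stdVec i)) (stdVec j) (stdVec k) := by
  have h1 := map_eq_sum_coord ((S y).flip (stdVec k)).toLinearMap
    (connOf A y (stdVec i) (stdVec j))
  have h2 := map_eq_sum_coord (S y (stdVec j)).toLinearMap (connOf A y (stdVec i) (stdVec k))
  simp only [ContinuousLinearMap.coe_coe, ContinuousLinearMap.flip_apply, smul_eq_mul,
    connOf_stdVec] at h1 h2
  rw [covTensor, corrDeriv, h1, h2, pd, fderiv_eq_of_eqOn hU (fun z hz => hTS z hz j k) hy,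
    fderiv_const_two hS]
  simp only [hTS y hy]

theorem divTensorCoord_eq (hU : IsOpen U) (hy : y ∈ U)
    {T : Euc n → Matrix (Fin n) (Fin n) ℝ}
    {S : Euc n → Euc n →L[ℝ] Euc n →L[ℝ] ℝ} (hS : DifferentiableAt ℝ S y)
    (hTS : ∀ z ∈ U, ∀ i j, T z i j = S z (stdVec i) (stdVec j)) (k : Fin n) :
    divTensorCoord A T y k =
      ∑ l, (A y)⁻¹ k l * divForm (formOf A) (connOf A) S y (stdVec l) := by
  rw [divTensorCoord]
  refine Finset.sum_congr rfl fun l _ => ?_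
  congr 1
  refine Finset.sum_congr rfl fun i _ => ?_
  have hlin : ∀ b, corrDeriv S y (stdVec i) (connOf A y (stdVec i)) b (stdVec l) =
      ((fderiv ℝ S y (stdVec i)).flip (stdVec l) -
        ((S y).flip (stdVec l)).comp (connOf A y (stdVec i)) -
        (S y).flip (connOf A y (stdVec i) (stdVec l))) b := fun b => by
    simp [corrDeriv]
  rw [hlin, dualVec_formOf, map_sum]
  refine Finset.sum_congr rfl fun j _ => ?_
  rw [map_smul, smul_eq_mul, ← hlin, covTensor_eq hU hy hS hTS]

theorem ricciCoord_eq (hΓ : DifferentiableAt ℝ (connOf A) y) (j k : Fin n) :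
    ricciCoord A y j k = ricciForm (connOf A) y (stdVec j) (stdVec k) := by
  have hpd : ∀ a b c d, pd a (christoffel A b c d) y =
      (fderiv ℝ (connOf A) y (stdVec a) (stdVec c) (stdVec d)) b := by
    intro a b c d
    rw [← fderiv_const_two hΓ]
    have hd : DifferentiableAt ℝ (fun z => connOf A z (stdVec c) (stdVec d)) y :=
      (hΓ.clm_apply (differentiableAt_const _)).clm_apply (differentiableAt_const _)
    have hc : HasFDerivAt (fun z => (connOf A z (stdVec c) (stdVec d)) b)
        ((EuclideanSpace.proj (𝕜 := ℝ) b).comp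
          (fderiv ℝ (fun z => connOf A z (stdVec c) (stdVec d)) y)) y :=
      (EuclideanSpace.proj (𝕜 := ℝ) b).hasFDerivAt.comp y hd.hasFDerivAt
    simp only [connOf_stdVec] at hc
    rw [pd, hc.fderiv]
    rfl
  have hq : ∀ a b c i, (connOf A y (stdVec a) (connOf A y (stdVec b) (stdVec c))) i =
      ∑ l, christoffel A i a l y * christoffel A l b c y := by
    intro a b c i
    have h1 := congrArg (fun w : Euc n => w i) (map_eq_sum_coord
      (connOf A y (stdVec a)).toLinearMap (connOf A y (stdVec b) (stdVec c)))
    simp only [ContinuousLinearMap.coe_coe, WithLp.ofLp_sum, Finset.sum_apply, PiLp.smul_apply,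
      smul_eq_mul, connOf_stdVec] at h1
    rw [h1]
    exact Finset.sum_congr rfl fun l _ => mul_comm _ _
  rw [ricciForm_apply, ricciCoord, Matrix.of_apply]
  refine Finset.sum_congr rfl fun i _ => ?_
  rw [curv_apply]
  simp only [PiLp.add_apply, PiLp.sub_apply, hpd, hq, Finset.sum_sub_distrib]
  ring

theorem scalarCoord_eq (hΓ : DifferentiableAt ℝ (connOf A) y) :
    scalarCoord A y = metricTrace (formOf A) (ricciForm (connOf A)) y := by
  rw [scalarCoord, metricTrace]
  refine Finset.sum_congr rfl fun i _ => ?_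
  rw [dualVec_formOf, map_sum]
  exact Finset.sum_congr rfl fun j _ => by rw [ricciCoord_eq hΓ, map_smul, smul_eq_mul]

theorem einsteinCoord_eq (hΓ : DifferentiableAt ℝ (connOf A) y) (i j : Fin n) :
    ((2 : ℝ) • ricciCoord A y - scalarCoord A y • A y) i j =
      einsteinForm (formOf A) (connOf A) y (stdVec i) (stdVec j) := by
  simp [einsteinForm, formOf_stdVec, ricciCoord_eq hΓ, scalarCoord_eq hΓ]

theorem contraction_eq {T : Euc n → Matrix (Fin n) (Fin n) ℝ}
    {S : Euc n →L[ℝ] Euc n →L[ℝ] ℝ}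
    (hTS : ∀ i j, T y i j = S (stdVec i) (stdVec j)) :
    contraction A T y = ∑ i, ∑ j, S (stdVec i) (stdVec j) *
      S (dualVec (formOf A) i y) (dualVec (formOf A) j y) := by
  rw [contraction]
  refine Finset.sum_congr rfl fun i _ => Finset.sum_congr rfl fun j _ => ?_
  simp only [dualVec_formOf, map_sum, sum_apply, map_smul, smul_apply, smul_eq_mul,
    Finset.mul_sum, hTS]
  refine (Finset.sum_comm).trans ?_
  exact Finset.sum_congr rfl fun k _ => Finset.sum_congr rfl fun l _ => by ring

end

/-! ### Orthogonal projections and the restriction of a form to a plane -/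

section LinearAlgebra

variable {V : Type*} [AddCommGroup V] [Module ℝ V] {B : LinearMap.BilinForm ℝ V}

/-- Pairing a vector of both spaces with a pseudo-orthonormal basis isolates its coordinates, all of
which vanish. -/
theorem HasSignature.disjoint_orthogonal {K : Submodule ℝ V} {p q : ℕ}
    (hK : HasSignature B K p q) : Disjoint K (B.orthogonal K) := by
  obtain ⟨b, hneg, hpos, horth⟩ := hK
  rw [Submodule.disjoint_def]
  intro x hx hxo
  have hsum : x = ∑ s, b.repr ⟨x, hx⟩ s • (b s : V) := by
    have := congrArg (Subtype.val) (b.sum_repr ⟨x, hx⟩)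
    rw [AddSubmonoidClass.coe_finsetSum] at this
    exact this.symm
  have h0 : ∀ t, b.repr ⟨x, hx⟩ t = 0 := by
    intro t
    have h1 : B (b t) x = 0 := hxo _ (b t).2
    have h2 : B (b t) x = b.repr ⟨x, hx⟩ t * B (b t) (b t) := by
      conv_lhs => rw [hsum]
      rw [map_sum, Finset.sum_eq_single t]
      · simp
      · intro s _ hs
        rw [map_smul, horth t s hs.symm, smul_zero]
      · simp
    have h3 : B (b t) (b t) ≠ 0 := by
      rcases t with i | j
      · rw [hneg]; norm_num
      · rw [hpos]; norm_num
    rw [h2] at h1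
    exact (mul_eq_zero.mp h1).resolve_right h3
  rw [hsum]
  simp [h0]

theorem HasSignature.finrank_eq {K : Submodule ℝ V} {p q : ℕ}
    (hK : HasSignature B K p q) : Module.finrank ℝ K = p + q := by
  obtain ⟨b, -⟩ := hK
  rw [Module.finrank_eq_card_basis b]
  simp

theorem sub_orthProj_mem {K : Submodule ℝ V} (h : IsCompl K (B.orthogonal K)) (v : V) :
    v - orthProj B K v ∈ B.orthogonal K := by
  rw [orthProj, dif_pos h, ← Submodule.projectionOnto_apply_eq_zero_iff h, map_sub,
    Submodule.projectionOnto_apply_left, sub_self]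

theorem bilin_orthProj {K : Submodule ℝ V} (h : IsCompl K (B.orthogonal K)) {u : V} (hu : u ∈ K)
    (v : V) : B u (orthProj B K v) = B u v := by
  have := sub_orthProj_mem h v u hu
  rw [map_sub, sub_eq_zero] at this
  exact this.symm

theorem orthProj_eq {K : Submodule ℝ V} (h : IsCompl K (B.orthogonal K)) {v w : V} (hw : w ∈ K)
    (hvw : ∀ u ∈ K, B u w = B u v) : (orthProj B K v : V) = w := by
  rw [← sub_eq_zero]
  refine Submodule.disjoint_def.mp h.disjoint _ (sub_mem (Subtype.mem _) hw) fun u hu => ?_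
  rw [map_sub, bilin_orthProj h hu, hvw u hu, sub_self]

theorem endo_apply [FiniteDimensional ℝ V] (hB : B.Nondegenerate) (hs : ∀ u v, B u v = B v u)
    (T : LinearMap.BilinForm ℝ V) (u v : V) : B u (endo B hB T v) = T u v := by
  rw [hs, endo]
  simp [LinearMap.BilinForm.apply_toDual_symm_apply]

section Plane

variable [FiniteDimensional ℝ V] (hs : ∀ u v, B u v = B v u) {X Y : V} (hX : B X X = -1)
  (hY : B Y Y = -1) (hXY : B X Y = 0)
include hs hX hY hXY

theorem isCompl_orthogonal_span_pair :
    IsCompl (Submodule.span ℝ {X, Y}) (B.orthogonal (Submodule.span ℝ {X, Y})) := by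
  rw [LinearMap.BilinForm.isCompl_orthogonal_iff_disjoint fun u v h => by rw [hs, h],
    Submodule.disjoint_def]
  intro x hx hxo
  obtain ⟨a, b, rfl⟩ := Submodule.mem_span_pair.mp hx
  have h1 := hxo X (Submodule.subset_span (by simp))
  have h2 := hxo Y (Submodule.subset_span (by simp))
  simp only [map_add, map_smul, hX, hXY, hY, hs Y X, smul_eq_mul] at h1 h2
  have ha : a = 0 := by linarith
  have hb : b = 0 := by linarith
  simp [ha, hb]

/-- The minus signs come from B(X,X) = B(Y,Y) = -1; in `restrictTo_span_pair` they occur twice and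
disappear. -/
theorem orthProj_span_pair (v : V) :
    (orthProj B (Submodule.span ℝ {X, Y}) v : V) = (-B X v) • X + (-B Y v) • Y := by
  refine orthProj_eq (isCompl_orthogonal_span_pair hs hX hY hXY)
    (Submodule.mem_span_pair.mpr ⟨_, _, rfl⟩) fun u hu => ?_
  obtain ⟨a, b, rfl⟩ := Submodule.mem_span_pair.mp hu
  simp only [map_add, map_smul, LinearMap.add_apply, LinearMap.smul_apply, hX, hXY, hY, hs Y X, smul_eq_mul]
  ring

theorem restrictTo_span_pair (T : LinearMap.BilinForm ℝ V) (u v : V) :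
    restrictTo B (Submodule.span ℝ {X, Y}) T u v =
      T X X * (B X u * B X v) + T X Y * (B X u * B Y v) + T Y X * (B Y u * B X v)
        + T Y Y * (B Y u * B Y v) := by
  simp only [restrictTo, LinearMap.compl₁₂_apply, LinearMap.comp_apply, Submodule.subtype_apply,
    orthProj_span_pair hs hX hY hXY, map_add, map_smul, LinearMap.add_apply, LinearMap.smul_apply, smul_eq_mul]
  ring

end Plane

end LinearAlgebra

/-! ### Smoothness of fields and of the metric in a chart -/

section Charts

variable {n : ℕ} {M : Type*} [TopologicalSpace M] [ChartedSpace (EuclideanSpace ℝ (Fin n)) M]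
  (φ : OpenPartialHomeomorph M (EuclideanSpace ℝ (Fin n)))

/-- The differential of a chart. -/
def toCoord (x : M) : TangentSpace (𝓡 n) x →L[ℝ] Euc n := mfderiv (𝓡 n) (𝓡 n) φ x

/-- The inverse of the differential of a chart. -/
def ofCoord (x : M) : Euc n →L[ℝ] TangentSpace (𝓡 n) x := (mfderiv (𝓡 n) (𝓡 n) φ x).inverse

theorem components_eq (x : M) (v : TangentSpace (𝓡 n) x) (i : Fin n) :
    components φ x v i = toCoord φ x v i := rfl

theorem ofComponents_eq (x : M) (a : Fin n → ℝ) :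
    ofComponents φ x a = ofCoord φ x (WithLp.toLp 2 a) := by
  have := map_eq_sum_coord (ofCoord φ x).toLinearMap (WithLp.toLp 2 a)
  simp only [ContinuousLinearMap.coe_coe] at this
  rw [this]
  rfl

theorem vecOf_vecInChart (V : ∀ x : M, TangentSpace (𝓡 n) x) (y : Euc n) :
    vecOf (vecInChart φ V) y = toCoord φ (φ.symm y) (V (φ.symm y)) := rfl

theorem formOf_tensorInChart (T : ∀ x : M, LinearMap.BilinForm ℝ (TangentSpace (𝓡 n) x))
    (y a b : Euc n) : formOf (tensorInChart φ T) y a b =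
      T (φ.symm y) (ofCoord φ (φ.symm y) a) (ofCoord φ (φ.symm y) b) := by
  have h1 : T (φ.symm y) (ofCoord φ (φ.symm y) a) (ofCoord φ (φ.symm y) b) =
      ∑ i, a i • T (φ.symm y) (ofCoord φ (φ.symm y) (stdVec i)) (ofCoord φ (φ.symm y) b) :=
    map_eq_sum_coord ((T (φ.symm y)).flip (ofCoord φ (φ.symm y) b) ∘ₗ
      (ofCoord φ (φ.symm y)).toLinearMap) a
  have h2 : ∀ i, T (φ.symm y) (ofCoord φ (φ.symm y) (stdVec i)) (ofCoord φ (φ.symm y) b) =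
      ∑ j, b j • T (φ.symm y) (ofCoord φ (φ.symm y) (stdVec i))
        (ofCoord φ (φ.symm y) (stdVec j)) := fun i =>
    map_eq_sum_coord ((T (φ.symm y)) (ofCoord φ (φ.symm y) (stdVec i)) ∘ₗ
      (ofCoord φ (φ.symm y)).toLinearMap) b
  rw [h1, formOf_apply]
  refine Finset.sum_congr rfl fun i _ => ?_
  rw [h2, smul_eq_mul, Finset.mul_sum]
  exact Finset.sum_congr rfl fun j _ => by
    rw [smul_eq_mul, ← mul_assoc]; rfl

theorem tensorOfComponents_apply (A : Euc n → Matrix (Fin n) (Fin n) ℝ) (x : M)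
    (u v : TangentSpace (𝓡 n) x) : tensorOfComponents φ A x u v =
      formOf A (φ x) (toCoord φ x u) (toCoord φ x v) := by
  rw [tensorOfComponents, LinearMap.compl₁₂_apply, Matrix.toBilin'_apply, formOf_apply]
  exact Finset.sum_congr rfl fun i _ => Finset.sum_congr rfl fun j _ => by
    rw [components_eq, components_eq]; ring

variable {φ}

theorem mdifferentiable_of_mem_smoothCharts (hφ : φ ∈ smoothCharts n M) :
    φ.MDifferentiable (𝓡 n) (𝓡 n) :=
  ⟨(contMDiffOn_of_mem_maximalAtlas hφ).mdifferentiableOn (by simp),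
    (contMDiffOn_symm_of_mem_maximalAtlas hφ).mdifferentiableOn (by simp)⟩

theorem isOpen_preimage_symm {M : Type*} [TopologicalSpace M]
    (φ : OpenPartialHomeomorph M (EuclideanSpace ℝ (Fin n))) {D : Set M} (hD : IsOpen D) :
    IsOpen (φ.target ∩ φ.symm ⁻¹' D) :=
  φ.symm.isOpen_inter_preimage hD

variable (hφ : φ ∈ smoothCharts n M)
include hφ

theorem isInvertible_toCoord {x : M} (hx : x ∈ φ.source) :
    (mfderiv (𝓡 n) (𝓡 n) φ x).IsInvertible :=
  ⟨(mdifferentiable_of_mem_smoothCharts hφ).mfderiv hx, rfl⟩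

theorem ofCoord_toCoord {x : M} (hx : x ∈ φ.source) (v : TangentSpace (𝓡 n) x) :
    ofCoord φ x (toCoord φ x v) = v :=
  (isInvertible_toCoord hφ hx).inverse_apply_self v

theorem toCoord_ofCoord {x : M} (hx : x ∈ φ.source) (a : Euc n) :
    toCoord φ x (ofCoord φ x a) = a :=
  (isInvertible_toCoord hφ hx).self_apply_inverse a

theorem mfderiv_symm_eq_ofCoord {y : Euc n} (hy : y ∈ φ.target) :
    mfderiv (𝓡 n) (𝓡 n) φ.symm y = ofCoord φ (φ.symm y) := by
  have h := (mdifferentiable_of_mem_smoothCharts hφ).comp_symm_deriv hy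
  ext1 a
  have h1 : toCoord φ (φ.symm y) (mfderiv (𝓡 n) (𝓡 n) φ.symm y a) = a :=
    congrArg (fun L => L a) h
  conv_rhs => rw [← h1]
  exact (ofCoord_toCoord hφ (φ.map_target hy) _).symm

theorem smooth_symm : ContMDiffOn (𝓡 n) (𝓡 n) ∞ φ.symm φ.target :=
  contMDiffOn_symm_of_mem_maximalAtlas hφ

variable [IsManifold (𝓡 n) ∞ M]

/-- The coordinate field is the section `V` transported by the tangent map of the chart. -/
theorem smooth_vecInChart {V : ∀ x : M, TangentSpace (𝓡 n) x} {D : Set M}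
    (hV : SmoothFieldOn V D) :
    ContDiffOn ℝ ∞ (vecOf (vecInChart φ V)) (φ.target ∩ φ.symm ⁻¹' D) := by
  have h1 : ContMDiffOn (𝓡 n) (𝓡 n).tangent ∞
      (fun y => (⟨φ.symm y, V (φ.symm y)⟩ : TangentBundle (𝓡 n) M))
      (φ.target ∩ φ.symm ⁻¹' D) :=
    ContMDiffOn.comp hV ((smooth_symm hφ).mono Set.inter_subset_left) fun y hy => hy.2
  have h2 := (contMDiffOn_of_mem_maximalAtlas hφ).contMDiffOn_tangentMapWithin (m := ∞)
    (by simp) φ.open_source.uniqueMDiffOn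
  have h3 := h2.comp h1 fun y hy => φ.map_target hy.1
  refine contMDiffOn_vectorSpace_iff_contDiffOn
    (V := fun y : Euc n => (vecOf (vecInChart φ V) y : TangentSpace (𝓡 n) y)).mp ?_
  refine h3.congr fun y hy => ?_
  simp only [Function.comp, tangentMapWithin]
  rw [mfderivWithin_of_isOpen φ.open_source (φ.map_target hy.1)]
  rw [φ.right_inv hy.1]
  rfl

/-- A constant field on coordinate space, transported by the tangent map of the inverse chart. -/
theorem smooth_ofCoord (a : Euc n) : ContMDiffOn (𝓡 n) (𝓡 n).tangent ∞
    (fun y => (⟨φ.symm y, ofCoord φ (φ.symm y) a⟩ : TangentBundle (𝓡 n) M)) φ.target := by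
  have h1 : ContMDiff (𝓡 n) (𝓡 n).tangent ∞
      (fun y : Euc n => (⟨y, a⟩ : TangentBundle (𝓡 n) (Euc n))) :=
    contMDiff_vectorSpace_iff_contDiff.mpr contDiff_const
  have h2 := (smooth_symm hφ).contMDiffOn_tangentMapWithin (m := ∞) (by simp)
    φ.open_target.uniqueMDiffOn
  refine (h2.comp h1.contMDiffOn (s := φ.target) fun y hy => hy).congr fun y hy => ?_
  simp only [Function.comp, tangentMapWithin]
  rw [mfderivWithin_of_isOpen φ.open_target hy, mfderiv_symm_eq_ofCoord hφ hy]
  rfl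

theorem smooth_inChart (g : SemiRiemannianMetric n M) (i j : Fin n) :
    ContDiffOn ℝ ∞ (fun y => g.inChart φ y i j) φ.target := by
  have h1 := g.contMDiff.comp_contMDiffOn (smooth_symm hφ)
  have h2 := ContMDiffOn.clm_bundle_apply₂ (F₁ := Euc n) (F₂ := Euc n) (F₃ := ℝ)
    (E₁ := fun x : M => TangentSpace (𝓡 n) x) (E₂ := fun x : M => TangentSpace (𝓡 n) x)
    (E₃ := fun _ : M => ℝ) (b := fun y => φ.symm y) (ψ := fun y => g.inner (φ.symm y))
    (v := fun y => ofCoord φ (φ.symm y) (stdVec i))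
    (w := fun y => ofCoord φ (φ.symm y) (stdVec j)) h1 (smooth_ofCoord hφ _) (smooth_ofCoord hφ _)
  rw [← contMDiffOn_iff_contDiffOn]
  intro y hy
  have h3 := h2 y hy
  rw [Bundle.contMDiffWithinAt_totalSpace] at h3
  exact h3.2

end Charts

/-! ### Differential operators of the manifold expressed in a chart -/

/-- Raising an index with the inverse matrix and lowering it with the form. -/
theorem formOf_raise {n : ℕ} {A : Euc n → Matrix (Fin n) (Fin n) ℝ} {y : Euc n}
    (hsymm : ∀ i j, A y i j = A y j i) (hdet : IsUnit (A y).det) (d : Fin n → ℝ) (j : Fin n) :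
    formOf A y (WithLp.toLp 2 fun k => ∑ l, (A y)⁻¹ k l * d l) (stdVec j) = d j := by
  have h1 := congrArg (fun v : Fin n → ℝ => v j) (Matrix.mulVec_mulVec d (A y) (A y)⁻¹)
  rw [Matrix.mul_nonsing_inv _ hdet, Matrix.one_mulVec] at h1
  simp only [Matrix.mulVec, dotProduct] at h1
  rw [← h1, formOf_apply]
  refine Finset.sum_congr rfl fun i _ => ?_
  rw [Finset.sum_eq_single j]
  · simp [hsymm j i, mul_comm]
  · intro b _ hb
    simp [hb]
  · simp

theorem divForm_eq_sum {n : ℕ} {g : Euc n → Euc n →L[ℝ] Euc n →L[ℝ] ℝ}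
    {Γ : Euc n → Euc n →L[ℝ] Euc n →L[ℝ] Euc n} {T : Euc n → Euc n →L[ℝ] Euc n →L[ℝ] ℝ}
    (y c : Euc n) : divForm g Γ T y c = ∑ l, c l * divForm g Γ T y (stdVec l) := by
  let L : Euc n →L[ℝ] ℝ := ∑ i, (fderiv ℝ T y (stdVec i) (dualVec g i y)
    - T y (Γ y (stdVec i) (dualVec g i y)) - (T y (dualVec g i y)).comp (Γ y (stdVec i)))
  have hL : ∀ c, divForm g Γ T y c = L c := fun c => by
    simp [L, divForm, corrDeriv]
  simp only [hL]
  exact map_eq_sum_coord L.toLinearMap c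

section Charts

variable {n : ℕ} {M : Type*} [TopologicalSpace M] [ChartedSpace (EuclideanSpace ℝ (Fin n)) M]
  {φ : OpenPartialHomeomorph M (EuclideanSpace ℝ (Fin n))} [IsManifold (𝓡 n) ∞ M]
  (hφ : φ ∈ smoothCharts n M) (g : SemiRiemannianMetric n M)

theorem bilin_symm (x : M) (u v : TangentSpace (𝓡 n) x) : g.bilin x u v = g.bilin x v u :=
  g.symm x u v

theorem formOf_inChart (y a b : Euc n) : formOf (g.inChart φ) y a b =
    g.bilin (φ.symm y) (ofCoord φ (φ.symm y) a) (ofCoord φ (φ.symm y) b) :=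
  formOf_tensorInChart φ g.bilin y a b

theorem inChart_symm (y : Euc n) (i j : Fin n) : g.inChart φ y i j = g.inChart φ y j i :=
  bilin_symm g _ _ _

include hφ

theorem bilin_eq_formOf {y : Euc n} (hy : y ∈ φ.target) (u v : TangentSpace (𝓡 n) (φ.symm y)) :
    g.bilin (φ.symm y) u v =
      formOf (g.inChart φ) y (toCoord φ (φ.symm y) u) (toCoord φ (φ.symm y) v) := by
  rw [formOf_inChart, ofCoord_toCoord hφ (φ.map_target hy), ofCoord_toCoord hφ (φ.map_target hy)]

theorem isUnit_det_inChart {y : Euc n} (hy : y ∈ φ.target) : IsUnit (g.inChart φ y).det := by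
  rw [isUnit_iff_ne_zero]
  intro h0
  obtain ⟨v, hv, hv0⟩ := Matrix.exists_vecMul_eq_zero_iff.mpr h0
  apply hv
  have h1 : ∀ b, formOf (g.inChart φ) y (WithLp.toLp 2 v) b = 0 := fun b => by
    rw [formOf_apply, Finset.sum_comm]
    refine Finset.sum_eq_zero fun j _ => ?_
    have := congrFun hv0 j
    simp only [Matrix.vecMul, dotProduct, Pi.zero_apply] at this
    rw [← mul_zero (b j), ← this, Finset.mul_sum]
    exact Finset.sum_congr rfl fun i _ => by ring
  have h2 : ofCoord φ (φ.symm y) (WithLp.toLp 2 v) = 0 := by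
    refine (g.bilin_nondegenerate (φ.symm y)).1 _ fun w => ?_
    rw [bilin_eq_formOf hφ g hy, toCoord_ofCoord hφ (φ.map_target hy), h1]
  have h3 : (WithLp.toLp 2 v : Euc n) = 0 := by
    rw [← toCoord_ofCoord hφ (φ.map_target hy) (WithLp.toLp 2 v), h2, map_zero]
  ext i
  exact congrArg (fun w : Euc n => w i) h3

theorem isLeviCivitaOn_inChart :
    IsLeviCivitaOn φ.target (formOf (g.inChart φ)) (connOf (g.inChart φ)) :=
  isLeviCivitaOn_formOf φ.open_target (smooth_inChart hφ g) (fun y _ => inChart_symm g y)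
    fun _ hy => isUnit_det_inChart hφ g hy

theorem einstein_eq {y : Euc n} (hy : y ∈ φ.target) (u v : TangentSpace (𝓡 n) (φ.symm y)) :
    g.einstein φ (φ.symm y) u v = einsteinForm (formOf (g.inChart φ)) (connOf (g.inChart φ)) y
      (toCoord φ (φ.symm y) u) (toCoord φ (φ.symm y) v) := by
  rw [SemiRiemannianMetric.einstein, tensorOfComponents_apply, φ.right_inv hy]
  congr 2
  refine ext_stdVec fun i j => ?_
  rw [formOf_stdVec]
  exact einsteinCoord_eq ((isLeviCivitaOn_inChart hφ g).diff_conn hy) i j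

theorem isKillingOn_vecInChart {Y : ∀ x : M, TangentSpace (𝓡 n) x}
    (hs : SmoothFieldOn Y Set.univ) (hK : g.IsKilling Y) :
    IsKillingOn φ.target (formOf (g.inChart φ)) (vecOf (vecInChart φ Y)) := by
  have hsm : ContDiffOn ℝ ∞ (vecOf (vecInChart φ Y)) φ.target := by
    have := smooth_vecInChart hφ hs
    rwa [Set.preimage_univ, Set.inter_univ] at this
  refine IsKillingOn.of_skew (isLeviCivitaOn_inChart hφ g) hsm fun y hy a b => ?_
  have hd := ContDiffOn.diffAt φ.open_target hsm hy
  set S := (formOf (g.inChart φ) y).comp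
    (covD (connOf (g.inChart φ)) (vecOf (vecInChart φ Y)) y) with hS
  have hS0 : S + S.flip = 0 := by
    refine ext_stdVec fun i j => ?_
    have h1 := hK φ hφ (φ.symm y) (φ.map_target hy) i j
    rw [φ.right_inv hy] at h1
    have h2 : ∀ i j, S (stdVec i) (stdVec j) = ∑ k, g.inChart φ y j k *
        covVec (g.inChart φ) (vecInChart φ Y) i k y := fun i j => by
      have h3 := map_eq_sum_coord ((formOf (g.inChart φ) y).flip (stdVec j)).toLinearMap
        (covD (connOf (g.inChart φ)) (vecOf (vecInChart φ Y)) y (stdVec i))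
      simp only [ContinuousLinearMap.coe_coe, ContinuousLinearMap.flip_apply] at h3
      rw [hS, ContinuousLinearMap.comp_apply, h3]
      exact Finset.sum_congr rfl fun k _ => by
        rw [covVec_eq hd, formOf_stdVec, inChart_symm, smul_eq_mul, mul_comm]
    simp only [add_apply, ContinuousLinearMap.flip_apply, h2, h1]
    simp
  exact congrArg (fun L => L a b) hS0

omit hφ in
theorem nabla_eq {V W : ∀ x : M, TangentSpace (𝓡 n) x} {y : Euc n} (hy : y ∈ φ.target)
    (hW : DifferentiableAt ℝ (vecOf (vecInChart φ W)) y) :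
    g.nabla φ V W (φ.symm y) = ofCoord φ (φ.symm y)
      (covD (connOf (g.inChart φ)) (vecOf (vecInChart φ W)) y (vecOf (vecInChart φ V) y)) := by
  rw [SemiRiemannianMetric.nabla, ofComponents_eq, φ.right_inv hy]
  congr 1
  ext k
  exact covVec_contract hW k

omit hφ in
theorem divVec_eq {V : ∀ x : M, TangentSpace (𝓡 n) x} {y : Euc n} (hy : y ∈ φ.target)
    (hV : DifferentiableAt ℝ (vecOf (vecInChart φ V)) y) :
    g.divVec φ V (φ.symm y) = divV (connOf (g.inChart φ)) (vecOf (vecInChart φ V)) y := by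
  rw [SemiRiemannianMetric.divVec, φ.right_inv hy, divVecCoord_eq hV]

/-- The divergence of a tensor, characterized by its inner products. -/
theorem inner_divTensor {T : ∀ x : M, LinearMap.BilinForm ℝ (TangentSpace (𝓡 n) x)}
    {S : Euc n → Euc n →L[ℝ] Euc n →L[ℝ] ℝ} {U : Set (Euc n)} (hU : IsOpen U)
    (hUt : U ⊆ φ.target) {y : Euc n} (hy : y ∈ U) (hS : DifferentiableAt ℝ S y)
    (hTS : ∀ z ∈ U, ∀ i j, tensorInChart φ T z i j = S z (stdVec i) (stdVec j)) (c : Euc n) :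
    formOf (g.inChart φ) y (toCoord φ (φ.symm y) (g.divTensor φ T (φ.symm y))) c =
      divForm (formOf (g.inChart φ)) (connOf (g.inChart φ)) S y c := by
  have hyt := hUt hy
  rw [SemiRiemannianMetric.divTensor, ofComponents_eq, φ.right_inv hyt,
    toCoord_ofCoord hφ (φ.map_target hyt), divForm_eq_sum]
  have h1 : divTensorCoord (g.inChart φ) (tensorInChart φ T) y = fun k =>
      ∑ l, (g.inChart φ y)⁻¹ k l *
        divForm (formOf (g.inChart φ)) (connOf (g.inChart φ)) S y (stdVec l) :=
    funext fun k => divTensorCoord_eq hU hy hS hTS k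
  rw [h1]
  set w : Euc n := WithLp.toLp 2 fun k => ∑ l, (g.inChart φ y)⁻¹ k l *
        divForm (formOf (g.inChart φ)) (connOf (g.inChart φ)) S y (stdVec l)
  have h2 := map_eq_sum_coord (formOf (g.inChart φ) y w).toLinearMap c
  simp only [ContinuousLinearMap.coe_coe, smul_eq_mul] at h2
  rw [h2]
  exact Finset.sum_congr rfl fun l _ => by
    rw [formOf_raise (inChart_symm g y) (isUnit_det_inChart hφ g hyt)]

/-- The components of Y^♭ agree with the coordinate 1-form on the whole target, so their derivatives
agree; `fieldForm_eq_extDeriv` then applies because Y is Killing. -/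
theorem dFlat_eq {Y : ∀ x : M, TangentSpace (𝓡 n) x}
    (hY : IsKillingOn φ.target (formOf (g.inChart φ)) (vecOf (vecInChart φ Y))) {y : Euc n}
    (hy : y ∈ φ.target) (u v : TangentSpace (𝓡 n) (φ.symm y)) :
    g.dFlat φ Y (φ.symm y) u v = fieldForm (formOf (g.inChart φ)) (connOf (g.inChart φ))
      (vecOf (vecInChart φ Y)) y (toCoord φ (φ.symm y) u) (toCoord φ (φ.symm y) v) := by
  have hL := isLeviCivitaOn_inChart hφ g
  rw [SemiRiemannianMetric.dFlat, tensorOfComponents_apply, φ.right_inv hy]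
  congr 2
  refine ext_stdVec fun i j => ?_
  have hf : ∀ j, ∀ z ∈ φ.target, g.flat φ Y z j =
      formOf (g.inChart φ) z (vecOf (vecInChart φ Y) z) (stdVec j) := fun j z hz => by
    rw [formOf_inChart, vecOf_vecInChart, ofCoord_toCoord hφ (φ.map_target hz)]
    rfl
  have hα : DifferentiableAt ℝ
      (fun z => formOf (g.inChart φ) z (vecOf (vecInChart φ Y) z)) y :=
    (hL.diff_metric hy).clm_apply (hL.diff_killing hY hy)
  rw [formOf_stdVec, hL.fieldForm_eq_extDeriv hY hy, ← fderiv_const_one hα,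
    ← fderiv_const_one hα, ← fderiv_eq_of_eqOn φ.open_target (hf j) hy,
    ← fderiv_eq_of_eqOn φ.open_target (hf i) hy]
  rfl

omit [IsManifold (𝓡 n) ∞ M] in
theorem dirDeriv_eq {V : ∀ x : M, TangentSpace (𝓡 n) x} {f : M → ℝ} {y : Euc n}
    (hy : y ∈ φ.target) (hf : DifferentiableAt ℝ (fun z => f (φ.symm z)) y) :
    dirDeriv V f (φ.symm y) = fderiv ℝ (fun z => f (φ.symm z)) y (vecOf (vecInChart φ V) y) := by
  have hx := φ.map_target hy
  have h1 : f =ᶠ[nhds (φ.symm y)] (fun z => f (φ.symm z)) ∘ φ :=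
    Filter.eventually_of_mem (φ.open_source.mem_nhds hx) fun z hz => by simp [φ.left_inv hz]
  have h2 : MDifferentiableAt (𝓡 n) 𝓘(ℝ, ℝ) (fun z => f (φ.symm z)) (φ (φ.symm y)) := by
    rw [φ.right_inv hy]; exact hf.mdifferentiableAt
  rw [dirDeriv, h1.mfderiv_eq, mfderiv_comp (φ.symm y) h2
    ((mdifferentiable_of_mem_smoothCharts hφ).mdifferentiableAt hx), mfderiv_eq_fderiv]
  change fderiv ℝ (fun z => f (φ.symm z)) (φ (φ.symm y)) (toCoord φ (φ.symm y) (V (φ.symm y))) = _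
  rw [φ.right_inv hy]
  rfl

end Charts

/-! ### From the multi-fiber bundle to a fluid in coordinates -/

section Fluid

variable {m : ℕ} {M B W : Type*}
  [TopologicalSpace M] [ChartedSpace (EuclideanSpace ℝ (Fin (5 + m))) M]
  [IsManifold (𝓡 (5 + m)) ∞ M]
  [TopologicalSpace B] [ChartedSpace (EuclideanSpace ℝ (Fin 4)) B]
  [TopologicalSpace W] [ChartedSpace (EuclideanSpace ℝ (Fin m)) W]
  (𝓑 : MultiFiberBundle m M B W) (g : SemiRiemannianMetric (5 + m) M)
  (φ : OpenPartialHomeomorph M (EuclideanSpace ℝ (Fin (5 + m))))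
  (ψ : OpenPartialHomeomorph B (EuclideanSpace ℝ (Fin 4)))

/-- The projection in the charts `φ` and `ψ`. -/
def projInChart (y : Euc (5 + m)) : Euc 4 := ψ (𝓑.proj (φ.symm y))

/-- The part of `D` covered by the charts `φ` and `ψ`. -/
def chartDomain (D : Set M) : Set (Euc (5 + m)) :=
  φ.target ∩ φ.symm ⁻¹' (D ∩ 𝓑.proj ⁻¹' ψ.source)

variable {𝓑 g φ ψ}

omit [IsManifold (𝓡 (5 + m)) ∞ M] in
theorem isOpen_chartDomain {D : Set M} (hD : IsOpen D) : IsOpen (chartDomain 𝓑 φ ψ D) :=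
  isOpen_preimage_symm φ (hD.inter (ψ.open_source.preimage 𝓑.contMDiff_proj.continuous))

theorem isCompl_horizontal (hg : 𝓑.IsCompatible g) (x : M) :
    IsCompl (𝓑.horizontal g x) ((g.bilin x).orthogonal (𝓑.horizontal g x)) := by
  rw [LinearMap.BilinForm.isCompl_orthogonal_iff_disjoint fun u v h => by rw [bilin_symm, h]]
  exact (hg.horizontal x).disjoint_orthogonal

theorem eq_zero_of_horizontal_of_fiber (hg : 𝓑.IsCompatible g) {x : M}
    {v : TangentSpace (𝓡 (5 + m)) x} (h1 : v ∈ 𝓑.horizontal g x) (h2 : v ∈ 𝓑.fiberTangent x) :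
    v = 0 :=
  Submodule.disjoint_def.mp (isCompl_horizontal hg x).disjoint v h1 fun u hu => by
    rw [bilin_symm]; exact hu v h2

/-- Dimension count: H has dimension 4 by its signature, and the dimension of the orthogonal of ker
dπ is the rank of dπ. -/
theorem mfderiv_proj_surjective (hg : 𝓑.IsCompatible g) (x : M) :
    Function.Surjective (mfderiv (𝓡 (5 + m)) (𝓡 4) 𝓑.proj x) := by
  let L : Euc (5 + m) →ₗ[ℝ] Euc 4 := (mfderiv (𝓡 (5 + m)) (𝓡 4) 𝓑.proj x).toLinearMap
  have h1 : Module.finrank ℝ (𝓑.horizontal g x) =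
      Module.finrank ℝ (TangentSpace (𝓡 (5 + m)) x) - Module.finrank ℝ (𝓑.fiberTangent x) :=
    LinearMap.BilinForm.finrank_orthogonal (g.bilin_nondegenerate x) _
  have h2 := (hg.horizontal x).finrank_eq
  have h3 : Module.finrank ℝ (LinearMap.range L) + Module.finrank ℝ (LinearMap.ker L) =
      Module.finrank ℝ (Euc (5 + m)) := L.finrank_range_add_finrank_ker
  have h4 : Module.finrank ℝ (TangentSpace (𝓡 (5 + m)) x) = 5 + m :=
    finrank_euclideanSpace_fin
  have h5 : Module.finrank ℝ (Euc (5 + m)) = 5 + m := finrank_euclideanSpace_fin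
  have h6 : Module.finrank ℝ (𝓑.fiberTangent x) = Module.finrank ℝ (LinearMap.ker L) := rfl
  have h7 : Module.finrank ℝ (LinearMap.range L) = Module.finrank ℝ (Euc 4) := by
    rw [finrank_euclideanSpace_fin]; omega
  exact LinearMap.range_eq_top.mp (Submodule.eq_top_of_finrank_eq h7)

/-- Membership in an eigenspace of `pr_H ∘ ᵉG|_H`, tested against horizontal vectors. -/
theorem mem_eigenspace_endoH (hg : 𝓑.IsCompatible g) {x : M} {r : ℝ}
    (w : 𝓑.horizontal g x) :
    w ∈ Module.End.eigenspace (𝓑.endoH g φ x) r ↔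
      ∀ u ∈ 𝓑.horizontal g x, g.einstein φ x u w = r * g.bilin x u w := by
  have hc := isCompl_horizontal hg x
  have key : ∀ u ∈ 𝓑.horizontal g x, g.bilin x u (𝓑.endoH g φ x w) = g.einstein φ x u w :=
    fun u hu => (bilin_orthProj hc hu _).trans
      (endo_apply (g.bilin_nondegenerate x) (bilin_symm g x) _ u w)
  rw [Module.End.mem_eigenspace_iff]
  constructor
  · intro h u hu
    rw [← key u hu, h]
    simp
  · intro h
    rw [← sub_eq_zero]
    refine Subtype.ext (Submodule.disjoint_def.mp hc.disjoint _ (Subtype.mem _) fun u hu => ?_)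
    have := h u hu
    rw [← key u hu] at this
    simp [this]

section Local

variable (hg : 𝓑.IsCompatible g) (hφ : φ ∈ smoothCharts (5 + m) M) (hψ : ψ ∈ smoothCharts 4 B)
include hφ hψ

omit [IsManifold (𝓡 (5 + m)) ∞ M] in
theorem fderiv_projInChart {D : Set M} {y : Euc (5 + m)} (hy : y ∈ chartDomain 𝓑 φ ψ D)
    (v : Euc (5 + m)) : fderiv ℝ (projInChart 𝓑 φ ψ) y v =
      toCoord ψ (𝓑.proj (φ.symm y)) (mfderiv (𝓡 (5 + m)) (𝓡 4) 𝓑.proj (φ.symm y)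
        (ofCoord φ (φ.symm y) v)) := by
  have h1 := (mdifferentiable_of_mem_smoothCharts hφ).mdifferentiableAt_symm hy.1
  have h2 : MDifferentiableAt (𝓡 (5 + m)) (𝓡 4) 𝓑.proj (φ.symm y) :=
    (𝓑.contMDiff_proj _).mdifferentiableAt (by simp)
  have h3 := (mdifferentiable_of_mem_smoothCharts hψ).mdifferentiableAt hy.2.2
  have h4 : mfderiv (𝓡 (5 + m)) (𝓡 4) (projInChart 𝓑 φ ψ) y =
      (mfderiv (𝓡 4) (𝓡 4) ψ (𝓑.proj (φ.symm y))).comp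
        ((mfderiv (𝓡 (5 + m)) (𝓡 4) 𝓑.proj (φ.symm y)).comp
          (mfderiv (𝓡 (5 + m)) (𝓡 (5 + m)) φ.symm y)) :=
    (mfderiv_comp (g := ψ) (f := 𝓑.proj ∘ φ.symm) y h3 (h2.comp y h1)).trans
      (congrArg (fun L => (mfderiv (𝓡 4) (𝓡 4) ψ (𝓑.proj (φ.symm y))).comp L)
        (mfderiv_comp (g := 𝓑.proj) (f := φ.symm) y h2 h1))
  rw [← mfderiv_eq_fderiv, h4, mfderiv_symm_eq_ofCoord hφ hy.1]
  rfl

omit [IsManifold (𝓡 (5 + m)) ∞ M] in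
theorem smooth_projInChart {D : Set M} :
    ContDiffOn ℝ ∞ (projInChart 𝓑 φ ψ) (chartDomain 𝓑 φ ψ D) := by
  rw [← contMDiffOn_iff_contDiffOn]
  exact (contMDiffOn_of_mem_maximalAtlas hψ).comp
    (𝓑.contMDiff_proj.comp_contMDiffOn ((smooth_symm hφ).mono Set.inter_subset_left))
    fun y hy => hy.2.2

omit [IsManifold (𝓡 (5 + m)) ∞ M] in
theorem fderiv_projInChart_eq_zero {D : Set M} {y : Euc (5 + m)}
    (hy : y ∈ chartDomain 𝓑 φ ψ D) (v : Euc (5 + m)) :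
    fderiv ℝ (projInChart 𝓑 φ ψ) y v = 0 ↔
      ofCoord φ (φ.symm y) v ∈ 𝓑.fiberTangent (φ.symm y) := by
  rw [fderiv_projInChart hφ hψ hy]
  refine ⟨fun h => ?_, fun h => ?_⟩
  · have := congrArg (ofCoord ψ (𝓑.proj (φ.symm y))) h
    rw [ofCoord_toCoord hψ hy.2.2, map_zero] at this
    exact this
  · exact (congrArg (toCoord ψ (𝓑.proj (φ.symm y))) h).trans (map_zero _)

theorem isHor_iff {D : Set M} {y : Euc (5 + m)}
    (hy : y ∈ chartDomain 𝓑 φ ψ D) (v : Euc (5 + m)) :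
    IsHor (formOf (g.inChart φ)) (projInChart 𝓑 φ ψ) y v ↔
      ofCoord φ (φ.symm y) v ∈ 𝓑.horizontal g (φ.symm y) := by
  have hx := φ.map_target hy.1
  refine ⟨fun h u hu => ?_, fun h u hu => ?_⟩
  · have h1 := h (toCoord φ (φ.symm y) u)
    rw [fderiv_projInChart_eq_zero hφ hψ hy, ofCoord_toCoord hφ hx, formOf_inChart,
      ofCoord_toCoord hφ hx] at h1
    exact h1 hu
  · rw [formOf_inChart]
    exact h _ ((fderiv_projInChart_eq_zero hφ hψ hy u).mp hu)

variable {Y X₀ : ∀ x : M, TangentSpace (𝓡 (5 + m)) x} {D : Set M} {μ : M → ℝ}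
  (hY : 𝓑.IsPotential g Y) (hD : 𝓑.IsFluidDomain g D μ X₀) (hP : IsPluperfect g Y X₀ D)
include hg hY hD

-- X₀ is horizontal and Y tangent to the fiber, so the two are orthogonal and the plane formula
-- applies; moreover G(X₀,X₀) = -μ·(-1) = μ.
omit hψ in
theorem pressure_apply {x : M} (hx : x ∈ D ∩ φ.source) (u v : TangentSpace (𝓡 (5 + m)) x) :
    pressure g φ Y X₀ x u v = g.einstein φ x u v -
      (μ x * (g.bilin x (X₀ x) u * g.bilin x (X₀ x) v)
      + charge g φ Y X₀ x * (g.bilin x (X₀ x) u * g.bilin x (Y x) v)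
      + g.einstein φ x (Y x) (X₀ x) * (g.bilin x (Y x) u * g.bilin x (X₀ x) v)
      + g.einstein φ x (Y x) (Y x) * (g.bilin x (Y x) u * g.bilin x (Y x) v)) := by
  obtain ⟨hX, he⟩ := hD.mem_eigenspace φ hφ x hx
  have h1 := (mem_eigenspace_endoH hg _).mp he (X₀ x) hX
  have h2 : g.bilin x (X₀ x) (Y x) = 0 := by
    rw [bilin_symm]; exact hX (Y x) (hY.tangent x).1
  rw [hD.unit x hx.1] at h1
  rw [pressure, LinearMap.sub_apply, LinearMap.sub_apply, timePlane,
    restrictTo_span_pair (bilin_symm g x) (hD.unit x hx.1) (hY.unit x) h2]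
  have h3 : g.einstein φ x (X₀ x) (X₀ x) = μ x := by rw [h1]; ring
  rw [h3]
  rfl

include hP

theorem isLocalFluid : IsLocalFluid (chartDomain 𝓑 φ ψ D) (formOf (g.inChart φ))
    (connOf (g.inChart φ)) (vecOf (vecInChart φ Y)) (vecOf (vecInChart φ X₀))
    (projInChart 𝓑 φ ψ) (fun y => μ (φ.symm y)) (fun y => charge g φ Y X₀ (φ.symm y)) := by
  have hsub : chartDomain 𝓑 φ ψ D ⊆ φ.target := Set.inter_subset_left
  have hopen : IsOpen (chartDomain 𝓑 φ ψ D) := isOpen_chartDomain hD.isOpen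
  have hL := isLeviCivitaOn_inChart hφ g
  have hL' : IsLeviCivitaOn (chartDomain 𝓑 φ ψ D) (formOf (g.inChart φ))
      (connOf (g.inChart φ)) :=
    ⟨hopen, hL.smooth.mono hsub, hL.smooth_conn.mono hsub, fun y hy => hL.symm y (hsub hy),
      fun y hy => hL.nondeg y (hsub hy), fun y hy => hL.torsion_free y (hsub hy),
      fun y hy => hL.compat y (hsub hy)⟩
  have hK := isKillingOn_vecInChart hφ g hY.smooth hY.killing
  have hK' : IsKillingOn (chartDomain 𝓑 φ ψ D) (formOf (g.inChart φ))
      (vecOf (vecInChart φ Y)) :=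
    ⟨hK.smooth.mono hsub, fun y hy => hK.lie_metric y (hsub hy)⟩
  have hxD : ∀ y ∈ chartDomain 𝓑 φ ψ D, φ.symm y ∈ D ∩ φ.source := fun y hy =>
    ⟨hy.2.1, φ.map_target hy.1⟩
  have hsmX : ContDiffOn ℝ ∞ (vecOf (vecInChart φ X₀)) (chartDomain 𝓑 φ ψ D) :=
    (smooth_vecInChart hφ hD.smooth).mono fun y hy => ⟨hy.1, hy.2.1⟩
  have hbil : ∀ y ∈ chartDomain 𝓑 φ ψ D, ∀ (V : ∀ x : M, TangentSpace (𝓡 (5 + m)) x) (c),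
      formOf (g.inChart φ) y (vecOf (vecInChart φ V) y) c =
        g.bilin (φ.symm y) (V (φ.symm y)) (ofCoord φ (φ.symm y) c) := fun y hy V c => by
    rw [bilin_eq_formOf hφ g (hsub hy), toCoord_ofCoord hφ (hxD y hy).2]; rfl
  have hein : ∀ y ∈ chartDomain 𝓑 φ ψ D, ∀ u v : Euc (5 + m),
      g.einstein φ (φ.symm y) (ofCoord φ (φ.symm y) u) (ofCoord φ (φ.symm y) v) =
        einsteinForm (formOf (g.inChart φ)) (connOf (g.inChart φ)) y u v := fun y hy u v => by
    rw [einstein_eq hφ g (hsub hy), toCoord_ofCoord hφ (hxD y hy).2,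
      toCoord_ofCoord hφ (hxD y hy).2]
  have hvec : ∀ y ∈ chartDomain 𝓑 φ ψ D, ∀ V : ∀ x : M, TangentSpace (𝓡 (5 + m)) x,
      ofCoord φ (φ.symm y) (vecOf (vecInChart φ V) y) = V (φ.symm y) := fun y hy V =>
    ofCoord_toCoord hφ (hxD y hy).2 _
  have hsymmE : ∀ y ∈ chartDomain 𝓑 φ ψ D, ∀ u v, g.einstein φ (φ.symm y) u v =
      g.einstein φ (φ.symm y) v u := fun y hy u v => by
    rw [einstein_eq hφ g (hsub hy), einstein_eq hφ g (hsub hy), hL.einsteinForm_symm (hsub hy)]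
  refine
    { conn := hL'
      killing := hK'
      unit_killing := fun y hy => ?_
      smooth_field := hsmX
      unit_field := fun y hy => ?_
      smooth_proj := smooth_projInChart hφ hψ
      proj_killing := fun y hy => ?_
      proj_surjective := fun y hy w => ?_
      hor_nondegenerate := fun y hy w hw hw0 => ?_
      hor_field := fun y hy => ?_
      eigenvector := fun y hy u hu => ?_
      eigenspace := fun y hy w hw hwe => ?_
      pos := fun y hy => hD.pos _ hy.2.1
      charge_eq := fun y hy => ?_
      perfect := fun y hy u => ?_
      div_pressure := fun y hy c => ?_ }
  · rw [hbil y hy, hvec y hy, hY.unit]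
  · rw [hbil y hy, hvec y hy, hD.unit _ hy.2.1]
  · rw [fderiv_projInChart_eq_zero hφ hψ hy, hvec y hy]
    exact (hY.tangent _).1
  · obtain ⟨v, hv⟩ := mfderiv_proj_surjective hg (φ.symm y) (ofCoord ψ (𝓑.proj (φ.symm y)) w)
    refine ⟨toCoord φ (φ.symm y) v, ?_⟩
    rw [fderiv_projInChart hφ hψ hy, ofCoord_toCoord hφ (hxD y hy).2, hv,
      toCoord_ofCoord hψ hy.2.2]
  · have h1 := eq_zero_of_horizontal_of_fiber hg ((isHor_iff hφ hψ hy w).mp hw)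
      ((fderiv_projInChart_eq_zero hφ hψ hy w).mp hw0)
    rw [← toCoord_ofCoord hφ (hxD y hy).2 w, h1, map_zero]
  · rw [isHor_iff hφ hψ hy, hvec y hy]
    exact (hD.mem_eigenspace φ hφ _ (hxD y hy)).1
  · obtain ⟨hX, he⟩ := hD.mem_eigenspace φ hφ _ (hxD y hy)
    have h1 := (mem_eigenspace_endoH hg _).mp he _ ((isHor_iff hφ hψ hy u).mp hu)
    rw [← hein y hy, formOf_inChart, hvec y hy]
    exact h1
  · obtain ⟨hX, he⟩ := hD.mem_eigenspace φ hφ _ (hxD y hy)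
    -- X₀ is nonzero because its square is -1, so it generates the one-dimensional eigenspace.
    have hne : (⟨⟨X₀ (φ.symm y), hX⟩, he⟩ :
        Module.End.eigenspace (𝓑.endoH g φ (φ.symm y)) (-μ (φ.symm y))) ≠ 0 := by
      intro h0
      have h1 : X₀ (φ.symm y) = 0 := congrArg Subtype.val (congrArg Subtype.val h0)
      have h2 := hD.unit _ hy.2.1
      rw [h1] at h2
      simp at h2
    have hw' := (isHor_iff hφ hψ hy w).mp hw
    have hwe' : (⟨ofCoord φ (φ.symm y) w, hw'⟩ : 𝓑.horizontal g (φ.symm y)) ∈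
        Module.End.eigenspace (𝓑.endoH g φ (φ.symm y)) (-μ (φ.symm y)) := by
      rw [mem_eigenspace_endoH hg]
      intro u hu
      have h1 := hwe (toCoord φ (φ.symm y) u) (by
        rw [isHor_iff hφ hψ hy, ofCoord_toCoord hφ (hxD y hy).2]; exact hu)
      rw [← hein y hy, formOf_inChart, ofCoord_toCoord hφ (hxD y hy).2] at h1
      exact h1
    obtain ⟨t, ht⟩ := (finrank_eq_one_iff_of_nonzero' _ hne).mp
      (hD.finrank_eigenspace φ hφ _ (hxD y hy)) ⟨_, hwe'⟩
    refine ⟨t, ?_⟩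
    have h1 : t • X₀ (φ.symm y) = ofCoord φ (φ.symm y) w :=
      congrArg Subtype.val (congrArg Subtype.val ht)
    rw [← toCoord_ofCoord hφ (hxD y hy).2 w, ← h1, map_smul]
    rfl
  · rw [← hein y hy, hvec y hy, hvec y hy]
    rfl
  · have h1 := hP.perfect φ hφ _ (hxD y hy)
    have h2 := endo_apply (g.bilin_nondegenerate (φ.symm y)) (bilin_symm g (φ.symm y))
      (pressure g φ Y X₀ (φ.symm y)) (ofCoord φ (φ.symm y) u) (Y (φ.symm y))
    have h3 : g.bilin (φ.symm y) (X₀ (φ.symm y)) (Y (φ.symm y)) = 0 := by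
      rw [bilin_symm]
      exact (hD.mem_eigenspace φ hφ _ (hxD y hy)).1 _ (hY.tangent _).1
    rw [SemiRiemannianMetric.endoAt] at h1
    rw [h1, map_zero, pressure_apply hg hφ hY hD (hxD y hy), h3, hY.unit,
      bilin_symm g _ (X₀ _), bilin_symm g _ (Y _)] at h2
    rw [← hein y hy, ← hein y hy, formOf_inChart, formOf_inChart, hvec y hy, hvec y hy]
    linarith
  · have hE := hL'.smooth_einsteinForm
    have hμ : ContDiffOn ℝ ∞ (fun y => μ (φ.symm y)) (chartDomain 𝓑 φ ψ D) :=
      ((hE.clm_apply hsmX).clm_apply hsmX).congr fun z hz => by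
        obtain ⟨hX, he⟩ := hD.mem_eigenspace φ hφ _ (hxD z hz)
        have h1 := (mem_eigenspace_endoH hg _).mp he (X₀ (φ.symm z)) hX
        rw [hD.unit _ hz.2.1] at h1
        rw [← hein z hz, hvec z hz, h1]
        ring
    have he : ContDiffOn ℝ ∞ (fun y => charge g φ Y X₀ (φ.symm y)) (chartDomain 𝓑 φ ψ D) :=
      ((hE.clm_apply hsmX).clm_apply hK'.smooth).congr fun z hz => by
        rw [← hein z hz, hvec z hz, hvec z hz]
        rfl
    have hS : DifferentiableAt ℝ (fun z => einsteinForm (formOf (g.inChart φ))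
        (connOf (g.inChart φ)) z - planeForm (formOf (g.inChart φ)) (fun y => μ (φ.symm y))
        (fun y => charge g φ Y X₀ (φ.symm y))
        (fun z => einsteinForm (formOf (g.inChart φ)) (connOf (g.inChart φ)) z
          (vecOf (vecInChart φ Y) z) (vecOf (vecInChart φ Y) z))
        (vecOf (vecInChart φ X₀)) (vecOf (vecInChart φ Y)) z) y :=
      have hd := fun {E : Type} [NormedAddCommGroup E] [NormedSpace ℝ E] {f : Euc (5 + m) → E}
        (hf : ContDiffOn ℝ ∞ f (chartDomain 𝓑 φ ψ D)) => ContDiffOn.diffAt hopen hf hy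
      (hd hE).fun_sub ((((hL'.diff_tensorForm hy (hd hμ) (hd hsmX) (hd hsmX)).fun_add
        (hL'.diff_tensorForm hy (hd he) (hd hsmX) (hd hK'.smooth))).fun_add
        (hL'.diff_tensorForm hy (hd he) (hd hK'.smooth) (hd hsmX))).fun_add
        (hL'.diff_tensorForm hy (hd ((hE.clm_apply hK'.smooth).clm_apply hK'.smooth))
          (hd hK'.smooth) (hd hK'.smooth)))
    rw [← inner_divTensor hφ g hopen hsub hy hS
      (T := pressure g φ Y X₀), hP.div_pressure φ hφ _ (hxD y hy)]
    · simp
    -- The components must agree throughout the domain, since the divergence differentiates them.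
    · intro z hz i j
      have h1 : tensorInChart φ (pressure g φ Y X₀) z i j = pressure g φ Y X₀ (φ.symm z)
        (ofCoord φ (φ.symm z) (stdVec i)) (ofCoord φ (φ.symm z) (stdVec j)) := rfl
      rw [h1, pressure_apply hg hφ hY hD (hxD z hz), hein z hz]
      simp only [planeForm, sub_apply, add_apply, tensorForm_apply, hbil z hz]
      rw [← hein z hz (vecOf (vecInChart φ Y) z), hvec z hz, hsymmE z hz (Y _) (X₀ _)]
      rfl

end Local

end Fluid

/-! ### The conclusions on the manifold -/

section Conclusions

variable {m : ℕ} {M : Type*}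
  [TopologicalSpace M] [ChartedSpace (EuclideanSpace ℝ (Fin (5 + m))) M]
  [IsManifold (𝓡 (5 + m)) ∞ M]
  {g : SemiRiemannianMetric (5 + m) M}
  {φ : OpenPartialHomeomorph M (EuclideanSpace ℝ (Fin (5 + m)))}
  {Y X₀ : ∀ x : M, TangentSpace (𝓡 (5 + m)) x} {μ : M → ℝ}

theorem vecOf_smul {n : ℕ} {M : Type*} [TopologicalSpace M]
    [ChartedSpace (EuclideanSpace ℝ (Fin n)) M]
    {φ : OpenPartialHomeomorph M (EuclideanSpace ℝ (Fin n))} (f : M → ℝ)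
    (V : ∀ x : M, TangentSpace (𝓡 n) x) :
    vecOf (vecInChart φ (fun z => f z • V z)) =
      fun y => f (φ.symm y) • vecOf (vecInChart φ V) y :=
  funext fun y => by
    rw [vecOf_vecInChart, vecOf_vecInChart, map_smul]

theorem vecOf_fluidField : vecOf (vecInChart φ (fluidField g φ Y X₀ μ)) = fun y =>
    vecOf (vecInChart φ X₀) y +
      (charge g φ Y X₀ (φ.symm y) / μ (φ.symm y)) • vecOf (vecInChart φ Y) y :=
  funext fun y => by
    rw [vecOf_vecInChart, vecOf_vecInChart, vecOf_vecInChart, fluidField, map_add, map_smul]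

/-- The 2-form `d(V^♭)` of a Killing field in coordinates. -/
theorem tensorInChart_dFlat (hφ : φ ∈ smoothCharts (5 + m) M)
    (hK : IsKillingOn φ.target (formOf (g.inChart φ)) (vecOf (vecInChart φ Y)))
    {y : Euc (5 + m)} (hy : y ∈ φ.target) (i j : Fin (5 + m)) :
    tensorInChart φ (g.dFlat φ Y) y i j = fieldForm (formOf (g.inChart φ))
      (connOf (g.inChart φ)) (vecOf (vecInChart φ Y)) y (stdVec i) (stdVec j) := by
  have h1 : tensorInChart φ (g.dFlat φ Y) y i j = g.dFlat φ Y (φ.symm y)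
    (ofCoord φ (φ.symm y) (stdVec i)) (ofCoord φ (φ.symm y) (stdVec j)) := rfl
  rw [h1, dFlat_eq hφ g hK hy, toCoord_ofCoord hφ (φ.map_target hy),
    toCoord_ofCoord hφ (φ.map_target hy)]

theorem extDerivTwo_dFlat (hφ : φ ∈ smoothCharts (5 + m) M)
    (hK : IsKillingOn φ.target (formOf (g.inChart φ)) (vecOf (vecInChart φ Y)))
    {y : Euc (5 + m)} (hy : y ∈ φ.target) (i j k : Fin (5 + m)) :
    extDerivTwo (tensorInChart φ (g.dFlat φ Y)) i j k y = 0 := by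
  have hL := isLeviCivitaOn_inChart hφ g
  have hd := ContDiffOn.diffAt φ.open_target (IsLeviCivitaOn.smooth_fieldForm hK.smooth hL) hy
  have h1 : ∀ i j k, pd i (fun z => tensorInChart φ (g.dFlat φ Y) z j k) y =
      fderiv ℝ (fieldForm (formOf (g.inChart φ)) (connOf (g.inChart φ))
        (vecOf (vecInChart φ Y))) y (stdVec i) (stdVec j) (stdVec k) := fun i j k => by
    rw [pd, fderiv_eq_of_eqOn φ.open_target
      (fun z hz => tensorInChart_dFlat hφ hK hz j k) hy, fderiv_const_two hd]
  rw [extDerivTwo, h1, h1, h1]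
  exact hL.fieldForm_closed hK hy _ _ _

end Conclusions

section Final

variable {m : ℕ} {M : Type*}
  [TopologicalSpace M] [ChartedSpace (EuclideanSpace ℝ (Fin (5 + m))) M]
  [IsManifold (𝓡 (5 + m)) ∞ M] {k : ℕ} {g : SemiRiemannianMetric (5 + m) M}
  {φ : OpenPartialHomeomorph M (EuclideanSpace ℝ (Fin (5 + m)))}
  {Y X₀ : ∀ x : M, TangentSpace (𝓡 (5 + m)) x} {μ : M → ℝ}
  {U : Set (Euc (5 + m))} {p : Euc (5 + m) → Euc k} {y : Euc (5 + m)}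
  (hφ : φ ∈ smoothCharts (5 + m) M)
  (hF : IsLocalFluid U (formOf (g.inChart φ)) (connOf (g.inChart φ)) (vecOf (vecInChart φ Y))
    (vecOf (vecInChart φ X₀)) p (fun y => μ (φ.symm y)) (fun y => charge g φ Y X₀ (φ.symm y)))
  (hU : U ⊆ φ.target) (hy : y ∈ U)
include hF hU hy

theorem divVec_density : g.divVec φ (fun z => μ z • fluidField g φ Y X₀ μ z) (φ.symm y) = 0 ∧
    g.divVec φ (fun z => μ z • X₀ z) (φ.symm y) = 0 := by
  constructor
  · rw [divVec_eq g (hU hy), vecOf_smul, vecOf_fluidField]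
    · exact hF.divV_density_fluid hy
    · rw [vecOf_smul, vecOf_fluidField]
      exact (hF.diff_density hy).fun_smul (hF.diff_fluid hy)
  · rw [divVec_eq g (hU hy), vecOf_smul]
    · exact hF.divV_density_field hy
    · rw [vecOf_smul]
      exact (hF.diff_density hy).fun_smul (hF.diff_field hy)

theorem divVec_charge :
    g.divVec φ (fun z => charge g φ Y X₀ z • fluidField g φ Y X₀ μ z) (φ.symm y) = 0 ∧
    g.divVec φ (fun z => charge g φ Y X₀ z • X₀ z) (φ.symm y) = 0 := by
  constructor
  · rw [divVec_eq g (hU hy), vecOf_smul, vecOf_fluidField]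
    · exact hF.divV_charge_fluid hy
    · rw [vecOf_smul, vecOf_fluidField]
      exact (hF.diff_charge hy).fun_smul (hF.diff_fluid hy)
  · rw [divVec_eq g (hU hy), vecOf_smul]
    · exact hF.divV_charge_field hy
    · rw [vecOf_smul]
      exact (hF.diff_charge hy).fun_smul (hF.diff_field hy)

theorem nabla_fluidField :
    g.nabla φ (fluidField g φ Y X₀ μ) (fluidField g φ Y X₀ μ) (φ.symm y) = 0 := by
  rw [nabla_eq g (hU hy), vecOf_fluidField]
  · exact (congrArg _ (hF.covD_fluid_self hy)).trans (map_zero _)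
  · rw [vecOf_fluidField]
    exact hF.diff_fluid hy

include hφ

theorem dirDeriv_ratio :
    dirDeriv (fluidField g φ Y X₀ μ) (fun z => charge g φ Y X₀ z / μ z) (φ.symm y) = 0 ∧
    dirDeriv X₀ (fun z => charge g φ Y X₀ z / μ z) (φ.symm y) = 0 := by
  rw [dirDeriv_eq hφ (hU hy) (hF.diff_ratio hy), dirDeriv_eq hφ (hU hy) (hF.diff_ratio hy),
    vecOf_fluidField]
  exact ⟨hF.fderiv_ratio_fluid hy, hF.fderiv_ratio_field hy⟩

variable (hK : IsKillingOn φ.target (formOf (g.inChart φ)) (vecOf (vecInChart φ Y)))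
include hK

/-- Both sides are compared through their inner products with an arbitrary tangent vector, which
reduces the equation to `fieldForm_field`. -/
theorem lorentz_force : μ (φ.symm y) • g.nabla φ X₀ X₀ (φ.symm y) =
    charge g φ Y X₀ (φ.symm y) •
      g.endoAt (φ.symm y) (g.dFlat φ Y (φ.symm y)) (X₀ (φ.symm y)) := by
  have hx := φ.map_target (hU hy)
  have hnd : ∀ v w : TangentSpace (𝓡 (5 + m)) (φ.symm y),
      (∀ u, g.bilin (φ.symm y) u v = g.bilin (φ.symm y) u w) → v = w := fun v w h =>
    sub_eq_zero.mp ((g.bilin_nondegenerate _).2 _ fun u => by rw [map_sub, h, sub_self])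
  refine hnd _ _ fun u => ?_
  rw [map_smul, map_smul, SemiRiemannianMetric.endoAt,
    endo_apply (g.bilin_nondegenerate _) (bilin_symm g _), dFlat_eq hφ g hK (hU hy),
    nabla_eq g (hU hy) (hF.diff_field hy), bilin_eq_formOf hφ g (hU hy),
    toCoord_ofCoord hφ hx]
  exact (hF.fieldForm_field _ hy).symm

theorem divTensor_dFlat : g.divTensor φ (g.dFlat φ Y) (φ.symm y) =
    charge g φ Y X₀ (φ.symm y) • X₀ (φ.symm y) +
      ((1 / 2 : ℝ) * contraction (g.inChart φ) (tensorInChart φ (g.dFlat φ Y)) y) •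
        Y (φ.symm y) := by
  have hx := φ.map_target (hU hy)
  have hL := isLeviCivitaOn_inChart hφ g
  have hTS := fun z hz => tensorInChart_dFlat (g := g) hφ hK (y := z) hz
  have hd := ContDiffOn.diffAt φ.open_target (IsLeviCivitaOn.smooth_fieldForm hK.smooth hL) (hU hy)
  have h1 : toCoord φ (φ.symm y) (g.divTensor φ (g.dFlat φ Y) (φ.symm y)) =
      charge g φ Y X₀ (φ.symm y) • vecOf (vecInChart φ X₀) y +
        ((1 / 2 : ℝ) * contraction (g.inChart φ) (tensorInChart φ (g.dFlat φ Y)) y) •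
          vecOf (vecInChart φ Y) y := hL.eq_of_inner (hU hy) fun c => by
    rw [inner_divTensor hφ g φ.open_target subset_rfl (hU hy) hd hTS, hF.divForm_fieldForm hy,
      contraction_eq (hTS y (hU hy))]
    simp only [map_add, map_smul, add_apply, smul_apply, smul_eq_mul]
  rw [← ofCoord_toCoord hφ hx (g.divTensor φ (g.dFlat φ Y) (φ.symm y)), h1, map_add, map_smul,
    map_smul, vecOf_vecInChart, vecOf_vecInChart, ofCoord_toCoord hφ hx, ofCoord_toCoord hφ hx]

end Final

end KaluzaKlein

end

theorem mainTheorem3 {m : ℕ} {M B W : Type*}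
    [TopologicalSpace M] [T2Space M] [SecondCountableTopology M]
    [ChartedSpace (EuclideanSpace ℝ (Fin (5 + m))) M] [IsManifold (𝓡 (5 + m)) ∞ M]
    [TopologicalSpace B] [T2Space B] [SecondCountableTopology B]
    [ChartedSpace (EuclideanSpace ℝ (Fin 4)) B] [IsManifold (𝓡 4) ∞ B]
    [TopologicalSpace W] [T2Space W] [CompactSpace W]
    [ChartedSpace (EuclideanSpace ℝ (Fin m)) W] [IsManifold (𝓡 m) ∞ W]
    (𝓑 : KaluzaKlein.MultiFiberBundle m M B W)
    (g : KaluzaKlein.SemiRiemannianMetric (5 + m) M) (hg : 𝓑.IsCompatible g)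
    (Y : ∀ x : M, TangentSpace (𝓡 (5 + m)) x) (hY : 𝓑.IsPotential g Y)
    (D : Set M) (μ : M → ℝ) (X₀ : ∀ x : M, TangentSpace (𝓡 (5 + m)) x)
    (hD : 𝓑.IsFluidDomain g D μ X₀) (hP : KaluzaKlein.IsPluperfect g Y X₀ D)
    (φ : OpenPartialHomeomorph M (EuclideanSpace ℝ (Fin (5 + m))))
    (hφ : φ ∈ KaluzaKlein.smoothCharts (5 + m) M) (x : M) (hx : x ∈ D ∩ φ.source)
    (e : M → ℝ) (he : e = KaluzaKlein.charge g φ Y X₀)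
    (X : ∀ x : M, TangentSpace (𝓡 (5 + m)) x) (hX : X = KaluzaKlein.fluidField g φ Y X₀ μ)
    (F : ∀ x : M, LinearMap.BilinForm ℝ (TangentSpace (𝓡 (5 + m)) x)) (hF : F = g.dFlat φ Y) :
    (g.divVec φ (fun z => μ z • X z) x = 0 ∧ g.divVec φ (fun z => μ z • X₀ z) x = 0) ∧
    (g.divVec φ (fun z => e z • X z) x = 0 ∧ g.divVec φ (fun z => e z • X₀ z) x = 0) ∧
    (KaluzaKlein.dirDeriv X (fun z => e z / μ z) x = 0 ∧
      KaluzaKlein.dirDeriv X₀ (fun z => e z / μ z) x = 0) ∧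
    g.nabla φ X X x = 0 ∧
    μ x • g.nabla φ X₀ X₀ x = e x • g.endoAt x (F x) (X₀ x) ∧
    (e x = 0 → g.nabla φ X₀ X₀ x = 0) ∧
    (∀ i j k : Fin (5 + m),
      KaluzaKlein.extDerivTwo (KaluzaKlein.tensorInChart φ F) i j k (φ x) = 0) ∧
    g.divTensor φ F x = e x • X₀ x +
      ((1 / 2 : ℝ) *
        KaluzaKlein.contraction (g.inChart φ) (KaluzaKlein.tensorInChart φ F) (φ x)) • Y x := by

  obtain ⟨y, hy, rfl⟩ : ∃ y ∈ φ.target, φ.symm y = x :=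
    ⟨φ x, φ.map_source hx.2, φ.left_inv hx.2⟩
  subst he hX hF
  -- A chart of the base around π(x) supplies the functions whose gradients span the horizontal
  -- spaces near `x`.
  have hψ := IsManifold.chart_mem_maximalAtlas (I := 𝓡 4) (n := ∞) (𝓑.proj (φ.symm y))
  have hyU : y ∈ KaluzaKlein.chartDomain 𝓑 φ (chartAt _ (𝓑.proj (φ.symm y))) D :=
    ⟨hy, hx.1, mem_chart_source _ _⟩
  have hU : KaluzaKlein.chartDomain 𝓑 φ (chartAt _ (𝓑.proj (φ.symm y))) D ⊆ φ.target :=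
    Set.inter_subset_left
  have hF := KaluzaKlein.isLocalFluid hg hφ hψ hY hD hP
  have hK := KaluzaKlein.isKillingOn_vecInChart hφ g hY.smooth hY.killing
  have hforce := KaluzaKlein.lorentz_force hφ hF hU hyU hK
  refine ⟨KaluzaKlein.divVec_density hF hU hyU, KaluzaKlein.divVec_charge hF hU hyU,
    KaluzaKlein.dirDeriv_ratio hφ hF hU hyU, KaluzaKlein.nabla_fluidField hF hU hyU, hforce,
    fun h0 => ?_, fun i j k => ?_, ?_⟩
  · rw [h0, zero_smul] at hforce
    exact (smul_eq_zero.mp hforce).resolve_left (hD.pos _ hx.1).ne'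
  · rw [φ.right_inv hy]
    exact KaluzaKlein.extDerivTwo_dFlat hφ hK hy i j k
  · rw [φ.right_inv hy]
    exact KaluzaKlein.divTensor_dFlat hφ hF hU hyU hK
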